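/- Let $n\ge 1$ and $1<q<\infty$. For $1\le j\le n$ and $0\le\beta<n$ let $K_{j,\beta}(x)=\dfrac{x_j}{|x|^{n+1-\beta}}$ on $\mathbb R^n$ and let $T_{j,\beta}f=K_{j,\beta}*f$, i.e. $T_{j,\beta}f(x)=\int_{\mathbb R^n}K_{j,\beta}(x-y)f(y)\,dy$ for $\beta>0$, and $T_{j,0}f(x)=\lim_{\varepsilon\to0+}\int_{|x-y|>\varepsilon}K_{j,0}(x-y)f(y)\,dy$ (principal value) for $\beta=0$, which is the Riesz transform up to normalization. Write $\|\cdot\|_r$ for the norm of $L^r(\mathbb R^n)$ (complex-valued functions). There is a constant $C=C(n,q)>0$, independent of $\beta$, $j$ and $f$, such that for all $f\in L^1(\mathbb R^n)\cap L^q(\mathbb R^n)$, all $j$ and all $\beta$ with $0\le\beta<\frac{n(q-1)}{q}$, the integral defining $T_{j,\beta}f(x)$ converges for almost every $x$ (absolutely if $\beta>0$, as a principal value if $\beta=0$), $T_{j,\beta}f\in L^q(\mathbb R^n)$, and $$\|T_{j,\beta}f\|_q\le C\Big(\|f\|_q+\|f\|_p+\frac{\beta^{\frac{n(q-1)}{q}}}{(n(q-1)-\beta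 q)^{\frac1q}}\,\|f\|_1\Big)$$ for $1<p\le q$ with $\frac1q=\frac1p-\frac\beta n$. Consequently $$\|T_{j,\beta}f\|_q\le C\big(\|f\|_q+L(\beta)\|f\|_1\big),\qquad L(\beta)=\frac{\beta^{\frac{n(q-1)}{q}}}{(n(q-1)-\beta q)^{\frac1q}}+\frac{\beta q}{(q-1)n}.$$ Moreover $L(\beta)\to0$ as $\beta\to0+$, and for $\beta=0$ the strong $(q,q)$ bound $\|T_{j,0}f\|_q\le C\|f\|_q$ of the Riesz transform is recovered. -/

import Mathlib

open MeasureTheory Filter Topology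

noncomputable section

namespace RieszExt

/-- The kernel `K(x) = x_j / |x|^(n+1-β)` on `ℝⁿ`. Its value at the origin is `0`. -/
def kernel {n : ℕ} (j : Fin n) (β : ℝ) (x : EuclideanSpace ℝ (Fin n)) : ℝ :=
  x j / ‖x‖ ^ ((n : ℝ) + 1 - β)

/-- The truncated convolution: integration over `|x - y| > ε`. -/
def truncated {n : ℕ} (j : Fin n) (β ε : ℝ) (f : EuclideanSpace ℝ (Fin n) → ℂ)
    (x : EuclideanSpace ℝ (Fin n)) : ℂ :=
  ∫ y in {y | ε < ‖x - y‖}, kernel j β (x - y) • f y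

/-- `Tf = K * f` is given at `x` by an absolutely convergent integral when `β ≠ 0`, and by a
convergent principal value integral when `β = 0`. -/
def Converges {n : ℕ} (j : Fin n) (β : ℝ) (f : EuclideanSpace ℝ (Fin n) → ℂ)
    (x : EuclideanSpace ℝ (Fin n)) : Prop :=
  if β = 0 then ∃ l : ℂ, Tendsto (fun ε => truncated j 0 ε f x) (𝓝[>] 0) (𝓝 l)
  else Integrable (fun y => kernel j β (x - y) • f y)

/-- The operator `Tf = K * f`: the convolution integral when `β ≠ 0`, the principal value
when `β = 0` (the Riesz transform, up to normalization). Meaningful where `Converges` holds. -/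
def T {n : ℕ} (j : Fin n) (β : ℝ) (f : EuclideanSpace ℝ (Fin n) → ℂ)
    (x : EuclideanSpace ℝ (Fin n)) : ℂ :=
  if β = 0 then limUnder (𝓝[>] (0 : ℝ)) (fun ε => truncated j 0 ε f x)
  else ∫ y, kernel j β (x - y) • f y

/-- The factor `β^(n(q-1)/q) / (n(q-1) - βq)^(1/q)`. -/
def tailFactor (n : ℕ) (q β : ℝ) : ℝ :=
  β ^ ((n : ℝ) * (q - 1) / q) / ((n : ℝ) * (q - 1) - β * q) ^ (1 / q)

/-- `L(β) = β^(n(q-1)/q) / (n(q-1) - βq)^(1/q) + βq / ((q-1)n)`. -/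
def L (n : ℕ) (q β : ℝ) : ℝ :=
  tailFactor n q β + β * q / ((q - 1) * n)

end RieszExt

end

/-!
The proof reduces every kernel to the truncated Riesz kernels `u_j |u|^(-n-1) 1_{|u| > ε}`, for
which convolution is bounded on `L^q` uniformly in `ε` (`exists_eLpNorm_truncKernel_le`).

*Uniform bounds for truncations.* On the line, let `F` be the Cauchy integral of a nonnegative `g`.
It takes values in the right half plane, so `F ^ p` is holomorphic and, for `1 < p ≤ 2`, its
integral over a horizontal line vanishes by Cauchy's theorem. Integrating the elementary inequality
`|Im w| ^ p ≤ A (Re w) ^ p - B Re (w ^ p)` bounds the conjugate Poisson integral by the Poisson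
integral, hence the truncated Hilbert transform; exponents above `2` follow by duality
(`exists_eLpNorm_truncHilbert_le`). In `ℝⁿ`, the average over the unit ball of the directional
Hilbert transforms, with weight `z_j`, is convolution with a capped Riesz kernel
(`integral_ballWeight_dirHilbert`), which differs from the truncated one by a kernel bounded
in `L¹`.

*Positive order.* For `|u| ≤ R` one has `|u| ^ β = ∫_0^R β s^(β-1) 1_{s < |u|} ds`, so the part of
the fractional kernel inside the ball of radius `R` is a superposition of truncated Riesz kernels
of total mass at most `2 R ^ β` (`localKernel_eq`). The part outside is in `L^q`, and Young's
inequality gives the `L¹` term. For `R = 1 / β` the mass is bounded, since `β ^ (-β)` is, and the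
`L^q` norm of the tail is a multiple of `tailFactor`. The resulting estimate does not need the
`L^p` norm of `f`.

*Order zero.* The truncated transforms of `f` are Cauchy in `L^q`, since they are for smooth
compactly supported functions and the bounds are uniform. Let `g` be their limit. At a common
Lebesgue point of `f` and `g`, the truncation at `ε` is compared with the mollification of `g` at
scale `ε`: the difference of the two kernels is odd with a Poisson-like majorant
(`exists_abs_truncKernel_sub_mollifiedKernel_le`), so the error is at most a Poisson average of
`|f (x - u) - f x|`, which tends to `0`. Hence the principal value exists and equals `g` almost
everywhere (`ae_tendsto_kernelConv_truncKernel`).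
-/

open scoped ENNReal NNReal

namespace RieszExt

/-! ### Minkowski's integral inequality -/

/-- Jensen's inequality for the measure of density `w`, not normalised to mass one. -/
theorem rpow_lintegral_mul_le {α : Type*} [MeasurableSpace α] {μ : Measure α} {q : ℝ} (hq : 1 < q)
    {w g : α → ℝ≥0∞} (hw : AEMeasurable w μ) (hg : AEMeasurable g μ) :
    (∫⁻ a, w a * g a ∂μ) ^ q ≤ (∫⁻ a, w a ∂μ) ^ (q - 1) * ∫⁻ a, w a * g a ^ q ∂μ := by
  have hq0 : 0 < q := by linarith
  have hc : (q.conjExponent).HolderConjugate q := (Real.HolderConjugate.conjExponent hq).symm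
  have hc1 : 1 / q.conjExponent + 1 / q = 1 := by simpa using hc.inv_add_inv_eq_one
  have h := ENNReal.lintegral_mul_le_Lp_mul_Lq μ hc (f := fun a => w a ^ (1 / q.conjExponent))
    (g := fun a => w a ^ (1 / q) * g a) (hw.pow_const _) ((hw.pow_const _).mul hg)
  have hl : ∀ a, w a ^ (1 / q.conjExponent) * (w a ^ (1 / q) * g a) = w a * g a := by
    intro a
    rw [← mul_assoc, ← ENNReal.rpow_add_of_nonneg _ _ (by have := hc.pos; positivity) (by positivity),
      hc1, ENNReal.rpow_one]
  have h1 : ∀ a, (w a ^ (1 / q.conjExponent)) ^ q.conjExponent = w a := by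
    intro a
    rw [← ENNReal.rpow_mul, one_div_mul_cancel hc.ne_zero, ENNReal.rpow_one]
  have h2 : ∀ a, (w a ^ (1 / q) * g a) ^ q = w a * g a ^ q := by
    intro a
    rw [ENNReal.mul_rpow_of_nonneg _ _ hq0.le, ← ENNReal.rpow_mul, one_div_mul_cancel hq0.ne',
      ENNReal.rpow_one]
  simp only [Pi.mul_apply, hl, h1, h2] at h
  calc _ ≤ _ := ENNReal.rpow_le_rpow h hq0.le
    _ = _ := by
      rw [ENNReal.mul_rpow_of_nonneg _ _ hq0.le, ← ENNReal.rpow_mul, ← ENNReal.rpow_mul,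
        one_div_mul_cancel hq0.ne', ENNReal.rpow_one]
      congr 2
      have : 1 / q.conjExponent = 1 - 1 / q := by linarith
      rw [this]; field_simp

/-- **Minkowski's integral inequality**, for an integral against a real weight. -/
theorem eLpNorm_integral_smul_le {α β V : Type*} [MeasurableSpace α] [MeasurableSpace β]
    [NormedAddCommGroup V] [NormedSpace ℝ V] {μ : Measure α} {ν : Measure β}
    [SFinite μ] [SFinite ν] {q : ℝ} (hq : 1 < q) {w : α → ℝ} (hw : Measurable w)
    {G : α → β → V} (hG : StronglyMeasurable (Function.uncurry G)) {C : ℝ≥0∞}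
    (h : ∀ a, w a ≠ 0 → eLpNorm (G a) (ENNReal.ofReal q) ν ≤ C) :
    eLpNorm (fun x => ∫ a, w a • G a x ∂μ) (ENNReal.ofReal q) ν ≤ (∫⁻ a, ‖w a‖ₑ ∂μ) * C := by
  have hq0 : 0 < q := by linarith
  have hqt : (ENNReal.ofReal q).toReal = q := ENNReal.toReal_ofReal hq0.le
  have hq0' : ENNReal.ofReal q ≠ 0 := by simpa using hq0
  rw [eLpNorm_eq_lintegral_rpow_enorm_toReal hq0' ENNReal.ofReal_ne_top, hqt,
    one_div, ENNReal.rpow_inv_le_iff hq0]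
  have hGm : Measurable (fun z : α × β => ‖G z.1 z.2‖ₑ) := hG.enorm
  have hGa : ∀ x, Measurable (fun a => ‖G a x‖ₑ) := fun x =>
    hGm.comp (measurable_id.prodMk measurable_const)
  calc ∫⁻ x, ‖∫ a, w a • G a x ∂μ‖ₑ ^ q ∂ν
      ≤ ∫⁻ x, (∫⁻ a, ‖w a‖ₑ ∂μ) ^ (q - 1) * ∫⁻ a, ‖w a‖ₑ * ‖G a x‖ₑ ^ q ∂μ ∂ν := by
        refine lintegral_mono fun x => ?_
        refine le_trans (ENNReal.rpow_le_rpow (enorm_integral_le_lintegral_enorm _) hq0.le) ?_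
        simp only [enorm_smul]
        exact rpow_lintegral_mul_le hq hw.enorm.aemeasurable (hGa x).aemeasurable
    _ = (∫⁻ a, ‖w a‖ₑ ∂μ) ^ (q - 1) * ∫⁻ a, ‖w a‖ₑ * ∫⁻ x, ‖G a x‖ₑ ^ q ∂ν ∂μ := by
        have hm : Measurable (fun z : β × α => ‖w z.2‖ₑ * ‖G z.2 z.1‖ₑ ^ q) :=
          (hw.enorm.comp measurable_snd).mul ((hGm.comp measurable_swap).pow_const _)
        rw [lintegral_const_mul _ hm.lintegral_prod_right', lintegral_lintegral_swap hm.aemeasurable]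
        congr 1
        refine lintegral_congr fun a => ?_
        dsimp only
        rw [lintegral_const_mul]
        exact (hGm.comp (measurable_const.prodMk measurable_id)).pow_const _
    _ ≤ (∫⁻ a, ‖w a‖ₑ ∂μ) ^ (q - 1) * ∫⁻ a, ‖w a‖ₑ * C ^ q ∂μ := by
        refine mul_le_mul' le_rfl (lintegral_mono fun a => ?_)
        by_cases hwa : w a = 0
        · simp [hwa]
        · have := h a hwa
          rw [eLpNorm_eq_lintegral_rpow_enorm_toReal hq0' ENNReal.ofReal_ne_top, hqt,
            one_div, ENNReal.rpow_inv_le_iff hq0] at this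
          exact mul_le_mul' le_rfl this
    _ = ((∫⁻ a, ‖w a‖ₑ ∂μ) * C) ^ q := by
        rw [lintegral_mul_const _ hw.enorm, ENNReal.mul_rpow_of_nonneg _ _ hq0.le, ← mul_assoc]
        congr 1
        conv_lhs => rw [← ENNReal.rpow_one (∫⁻ a, ‖w a‖ₑ ∂μ)]
        rw [← ENNReal.rpow_mul, ← ENNReal.rpow_add_of_nonneg _ _ (by linarith) (by norm_num)]
        congr 1; ring

theorem eLpNorm_comp_sub_right {G V : Type*} [AddGroup G] [MeasurableSpace G] [MeasurableAdd G]
    [NormedAddCommGroup V] {μ : Measure G} [μ.IsAddRightInvariant] {f : G → V} (g : G) (p : ℝ≥0∞)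
    (hf : AEStronglyMeasurable f μ) : eLpNorm (fun x => f (x - g)) p μ = eLpNorm f p μ :=
  eLpNorm_comp_measurePreserving hf (measurePreserving_sub_right μ g)

/-! ### The conjugate function inequality for Poisson integrals -/

/-- The pointwise inequality behind the `L^p` bound for conjugate functions: once `w ^ p` is
integrated away by Cauchy's theorem, the imaginary part of `w` is controlled by its positive real
part. -/
theorem exists_abs_im_rpow_le {p : ℝ} (hp : 1 < p) (hp2 : p ≤ 2) :
    ∃ A B : ℝ, 0 ≤ A ∧ 0 ≤ B ∧ ∀ w : ℂ, 0 < w.re →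
      |w.im| ^ p ≤ A * w.re ^ p - B * (w ^ (p : ℂ)).re := by
  have hpi := Real.pi_pos
  -- For `|arg w| ≥ θ₀` the real part of `w ^ p` is negative and comparable with `-‖w‖ ^ p`; for
  -- `|arg w| < θ₀` the real part of `w` is comparable with `‖w‖`.
  set θ₀ : ℝ := (Real.pi / (2 * p) + Real.pi / 2) / 2 with hθ₀
  have hlt : Real.pi / (2 * p) < Real.pi / 2 := by
    apply div_lt_div_of_pos_left hpi <;> linarith
  have h1 : Real.pi / (2 * p) < θ₀ := by rw [hθ₀]; linarith
  have h2 : θ₀ < Real.pi / 2 := by rw [hθ₀]; linarith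
  have hθpos : 0 < θ₀ := lt_trans (by positivity) h1
  have h3 : Real.pi / 2 < p * θ₀ := by
    have := mul_lt_mul_of_pos_left h1 (show 0 < p by linarith)
    have e : p * (Real.pi / (2 * p)) = Real.pi / 2 := by field_simp
    linarith
  have h4 : p * θ₀ < Real.pi := by nlinarith
  have hc : Real.cos (p * θ₀) < 0 :=
    Real.cos_neg_of_pi_div_two_lt_of_lt h3 (by linarith)
  have hc0 : 0 < Real.cos θ₀ := Real.cos_pos_of_mem_Ioo ⟨by linarith, h2⟩
  set B : ℝ := 1 / (-Real.cos (p * θ₀)) with hB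
  have hBpos : 0 < B := by rw [hB]; apply div_pos one_pos; linarith
  refine ⟨(1 + B) / Real.cos θ₀ ^ p, B, by positivity, hBpos.le, fun w hw => ?_⟩
  have hp0 : 0 < p := by linarith
  have harg : |Complex.arg w| < Real.pi / 2 := Complex.abs_arg_lt_pi_div_two_iff.2 (Or.inl hw)
  have hcos : Real.cos (Complex.arg w * p) = Real.cos (p * |Complex.arg w|) := by
    rw [mul_comm, ← Real.cos_abs, abs_mul, abs_of_pos hp0]
  have hre : w.re = ‖w‖ * Real.cos |Complex.arg w| := by
    rw [Real.cos_abs, Complex.norm_mul_cos_arg]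
  have him : |w.im| ^ p ≤ ‖w‖ ^ p := by
    gcongr; exact Complex.abs_im_le_norm w
  rw [Complex.cpow_ofReal_re, hcos]
  have hn : 0 ≤ ‖w‖ ^ p := by positivity
  rcases le_or_gt θ₀ |Complex.arg w| with h | h
  · have hle : Real.cos (p * |Complex.arg w|) ≤ Real.cos (p * θ₀) := by
      apply Real.cos_le_cos_of_nonneg_of_le_pi
      · positivity
      · nlinarith
      · gcongr
    have : B * (‖w‖ ^ p * Real.cos (p * |w.arg|)) ≤ - ‖w‖ ^ p := by
      have e : B * Real.cos (p * θ₀) = -1 := by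
        rw [hB, one_div, inv_neg, neg_mul, inv_mul_cancel₀ hc.ne]
      calc _ = (B * ‖w‖ ^ p) * Real.cos (p * |w.arg|) := by ring
        _ ≤ (B * ‖w‖ ^ p) * Real.cos (p * θ₀) := by gcongr
        _ = _ := by linear_combination ‖w‖ ^ p * e
    have : 0 ≤ (1 + B) / Real.cos θ₀ ^ p * w.re ^ p := by positivity
    linarith
  · have hle : Real.cos θ₀ ≤ Real.cos |Complex.arg w| := by
      apply Real.cos_le_cos_of_nonneg_of_le_pi (abs_nonneg _) <;> linarith
    have hk : (1 + B) * ‖w‖ ^ p ≤ (1 + B) / Real.cos θ₀ ^ p * w.re ^ p := by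
      rw [hre, Real.mul_rpow (norm_nonneg _) (hc0.le.trans hle), div_mul_eq_mul_div,
        le_div_iff₀ (by positivity)]
      have : Real.cos θ₀ ^ p ≤ Real.cos |w.arg| ^ p := by gcongr
      calc _ ≤ (1 + B) * ‖w‖ ^ p * Real.cos |w.arg| ^ p := by gcongr
        _ = _ := by ring
    have : B * ‖w‖ ^ p * Real.cos (p * |w.arg|) ≤ B * ‖w‖ ^ p * 1 := by
      gcongr; exact Real.cos_le_one _
    linarith

/-- Bounded measurable functions with bounded support. -/
structure IsBoundedSupp {E V : Type*} [NormedAddCommGroup E] [MeasurableSpace E]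
    [NormedAddCommGroup V] [MeasurableSpace V] (f : E → V) : Prop where
  measurable : Measurable f
  exists_bound : ∃ B, ∀ x, ‖f x‖ ≤ B
  exists_supp : ∃ N, ∀ x, N < ‖x‖ → f x = 0

namespace IsBoundedSupp

variable {E V : Type*} [NormedAddCommGroup E] [MeasurableSpace E]
    [NormedAddCommGroup V] [MeasurableSpace V] [BorelSpace V] {f : E → V}

theorem memLp [ProperSpace E] [BorelSpace E] [SecondCountableTopology V] {μ : Measure E} [IsFiniteMeasureOnCompacts μ]
    (hf : IsBoundedSupp f) (p : ℝ≥0∞) : MemLp f p μ := by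
  obtain ⟨B, hB⟩ := hf.exists_bound
  obtain ⟨N, hN⟩ := hf.exists_supp
  have : f = (Metric.closedBall 0 N).indicator f := by
    ext x
    by_cases h : x ∈ Metric.closedBall (0 : E) N
    · rw [Set.indicator_of_mem h]
    · rw [Set.indicator_of_notMem h]
      exact hN x (by simpa using h)
  rw [this, memLp_indicator_iff_restrict Metric.isClosed_closedBall.measurableSet]
  have : IsFiniteMeasure (μ.restrict (Metric.closedBall 0 N)) :=
    ⟨by simpa using (isCompact_closedBall (0 : E) N).measure_lt_top⟩
  exact MemLp.of_bound hf.measurable.aestronglyMeasurable B (Eventually.of_forall hB)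

theorem integrable [ProperSpace E] [BorelSpace E] [SecondCountableTopology V] {μ : Measure E} [IsFiniteMeasureOnCompacts μ]
    (hf : IsBoundedSupp f) : Integrable f μ := memLp_one_iff_integrable.1 (hf.memLp 1)

end IsBoundedSupp

/-- The Cauchy integral of `g`, normalised so that its real and imaginary parts are the Poisson and the
conjugate Poisson integrals of `g`, up to the common factor `π`. -/
noncomputable def cauchyIntegral (g : ℝ → ℝ) (z : ℂ) : ℂ :=
  ∫ t, (g t : ℂ) * (Complex.I / (z - t))

section Cauchy

variable {g : ℝ → ℝ}

theorem im_le_norm_sub_ofReal (z : ℂ) (t : ℝ) : z.im ≤ ‖z - t‖ := by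
  have := Complex.abs_im_le_norm (z - t)
  simp only [Complex.sub_im, Complex.ofReal_im, sub_zero] at this
  exact (le_abs_self _).trans this

theorem sub_ofReal_ne_zero {z : ℂ} (hz : 0 < z.im) (t : ℝ) : z - t ≠ 0 := by
  rw [← norm_pos_iff]; exact hz.trans_le (im_le_norm_sub_ofReal z t)

theorem measurable_cauchyKernel (hg : Measurable g) (z : ℂ) :
    Measurable (fun t : ℝ => (g t : ℂ) * (Complex.I / (z - t))) := by fun_prop

theorem integrable_cauchyIntegrand (hg : Integrable g) (hm : Measurable g) {z : ℂ} (hz : 0 < z.im) :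
    Integrable (fun t => (g t : ℂ) * (Complex.I / (z - t))) := by
  refine Integrable.mono' (hg.norm.const_mul (1 / z.im))
    (measurable_cauchyKernel hm z).aestronglyMeasurable (Eventually.of_forall fun t => ?_)
  have := im_le_norm_sub_ofReal z t
  simp only [norm_mul, norm_div, Complex.norm_I, Complex.norm_real]
  rw [mul_comm]
  gcongr

theorem differentiableAt_cauchyIntegral (hg : Integrable g) (hm : Measurable g) {z : ℂ}
    (hz : 0 < z.im) : DifferentiableAt ℂ (cauchyIntegral g) z := by
  have hball : ∀ w ∈ Metric.ball z (z.im / 2), z.im / 2 < w.im := by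
    intro w hw
    have h1 := Complex.abs_im_le_norm (w - z)
    rw [Metric.mem_ball, dist_eq_norm] at hw
    have := (abs_lt.1 (h1.trans_lt hw)).1
    simp at this; linarith
  refine (hasDerivAt_integral_of_dominated_loc_of_deriv_le
    (F := fun w (t : ℝ) => (g t : ℂ) * (Complex.I / (w - t)))
    (F' := fun w t => (g t : ℂ) * (-Complex.I / (w - t) ^ 2)) (μ := volume)
    (bound := fun t => ‖g t‖ * (1 / (z.im / 2) ^ 2))
    (Metric.ball_mem_nhds z (half_pos hz)) ?_ ?_ ?_ ?_ ?_ ?_).2.differentiableAt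
  · exact Eventually.of_forall fun w => (measurable_cauchyKernel hm w).aestronglyMeasurable
  · exact integrable_cauchyIntegrand hg hm hz
  · exact Measurable.aestronglyMeasurable (by fun_prop)
  · refine Eventually.of_forall fun t w hw => ?_
    have h1 := hball w hw
    have := im_le_norm_sub_ofReal w t
    simp only [norm_mul, norm_div, norm_neg, Complex.norm_I, Complex.norm_real, norm_pow]
    gcongr
    linarith
  · exact hg.norm.mul_const _
  · refine Eventually.of_forall fun t w hw => ?_
    have h1 := hball w hw
    have hne := sub_ofReal_ne_zero ((half_pos hz).trans h1) t
    have h2 : HasDerivAt (fun w : ℂ => w - (t : ℂ)) 1 w := (hasDerivAt_id w).sub_const _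
    have := ((hasDerivAt_const w Complex.I).div h2 hne).const_mul (g t : ℂ)
    exact this.congr_deriv (by simp)

/-- `π` times the Poisson integral of `g`, at height `y`. -/
noncomputable def poissonIntegral (y : ℝ) (g : ℝ → ℝ) (x : ℝ) : ℝ :=
  ∫ s, (y / (s ^ 2 + y ^ 2)) • g (x - s)

/-- `π` times the conjugate Poisson integral of `g`, at height `y`. -/
noncomputable def conjPoissonIntegral (y : ℝ) (g : ℝ → ℝ) (x : ℝ) : ℝ :=
  ∫ s, (s / (s ^ 2 + y ^ 2)) • g (x - s)

theorem cauchyIntegral_re (hg : Integrable g) (hm : Measurable g) {x y : ℝ} (hy : 0 < y) :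
    (cauchyIntegral g (x + y * Complex.I)).re = poissonIntegral y g x := by
  have hz : 0 < (x + y * Complex.I : ℂ).im := by simpa
  have := Complex.reCLM.integral_comp_comm (integrable_cauchyIntegrand hg hm hz)
  simp only [Complex.reCLM_apply] at this
  rw [cauchyIntegral, ← this, poissonIntegral, ← integral_sub_left_eq_self _ volume x]
  refine integral_congr_ae (Eventually.of_forall fun t => ?_)
  simp [Complex.div_re, Complex.normSq_apply]
  ring

theorem cauchyIntegral_im (hg : Integrable g) (hm : Measurable g) {x y : ℝ} (hy : 0 < y) :
    (cauchyIntegral g (x + y * Complex.I)).im = conjPoissonIntegral y g x := by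
  have hz : 0 < (x + y * Complex.I : ℂ).im := by simpa
  have := Complex.imCLM.integral_comp_comm (integrable_cauchyIntegrand hg hm hz)
  simp only [Complex.imCLM_apply] at this
  rw [cauchyIntegral, ← this, conjPoissonIntegral, ← integral_sub_left_eq_self _ volume x]
  refine integral_congr_ae (Eventually.of_forall fun t => ?_)
  simp [Complex.div_im, Complex.normSq_apply]
  ring

/-- Decay of the Cauchy integral away from the support. -/
theorem norm_cauchyIntegral_le (hg : Integrable g) {N : ℝ} (hN : ∀ t, N < |t| → g t = 0)
    {R : ℝ} (hR : 2 * N ≤ R) (hR0 : 0 < R) {z : ℂ} (hz : 0 < z.im) (h : R ≤ |z.re| ∨ R ≤ z.im) :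
    ‖cauchyIntegral g z‖ ≤ (2 * ∫ t, |g t|) / R := by
  have : ∀ t, ‖(g t : ℂ) * (Complex.I / (z - t))‖ ≤ |g t| * (2 / R) := by
    intro t
    by_cases ht : N < |t|
    · simp [hN t ht]
    · have hle : R / 2 ≤ ‖z - t‖ := by
        rcases h with h | h
        · have h1 := Complex.abs_re_le_norm (z - t)
          simp only [Complex.sub_re, Complex.ofReal_re] at h1
          have h2 := abs_sub_abs_le_abs_sub z.re t
          push Not at ht
          linarith
        · have := im_le_norm_sub_ofReal z t
          linarith
      simp only [norm_mul, norm_div, Complex.norm_I, Complex.norm_real, Real.norm_eq_abs]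
      refine mul_le_mul_of_nonneg_left ?_ (abs_nonneg _)
      rw [div_le_div_iff₀ (by linarith) hR0]
      linarith
  calc _ ≤ ∫ t, |g t| * (2 / R) := norm_integral_le_of_norm_le (hg.abs.mul_const _) (Eventually.of_forall this)
    _ = _ := by rw [integral_mul_const]; ring

theorem cauchyIntegral_re_pos (hg : Integrable g) (hm : Measurable g) (h0 : ∀ t, 0 ≤ g t)
    (hpos : 0 < ∫ t, g t) {x y : ℝ} (hy : 0 < y) :
    0 < (cauchyIntegral g (x + y * Complex.I)).re := by
  have hz : 0 < (x + y * Complex.I : ℂ).im := by simpa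
  rw [cauchyIntegral_re hg hm hy, poissonIntegral, ← integral_sub_left_eq_self _ volume x]
  simp only [sub_sub_cancel, smul_eq_mul]
  rw [integral_pos_iff_support_of_nonneg]
  · rw [integral_pos_iff_support_of_nonneg h0 hg] at hpos
    convert hpos using 2
    ext t
    have : 0 < y / ((x - t) ^ 2 + y ^ 2) := by positivity
    rw [Function.mem_support, Function.mem_support, mul_ne_zero_iff]
    exact ⟨fun h => h.2, fun h => ⟨this.ne', h⟩⟩
  · intro t
    have := h0 t
    simp only [Pi.zero_apply]
    positivity
  · refine Integrable.bdd_mul (c := 1 / y) hg (Measurable.aestronglyMeasurable (by fun_prop)) ?_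
    refine Eventually.of_forall fun t => ?_
    rw [Real.norm_of_nonneg (by positivity), div_le_div_iff₀ (by positivity) hy]
    nlinarith [sq_nonneg (x - t)]

/-- By Cauchy's theorem, the integral of the `p`-th power of the Cauchy integral over a horizontal
segment equals the one over the other three sides of a rectangle of size `R`, where the Cauchy
integral is `O(1 / R)`. For `p > 1` the bound tends to `0` as `R` grows. -/
theorem norm_integral_cauchyIntegral_cpow_le (hg : Integrable g) (hm : Measurable g)
    (h0 : ∀ t, 0 ≤ g t) (hpos : 0 < ∫ t, g t) {N : ℝ} (hN : ∀ t, N < |t| → g t = 0)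
    {p y R : ℝ} (hp : 0 < p) (hy : 0 < y) (hR : 2 * N ≤ R) (hyR : y ≤ R) :
    ‖∫ x in (-R)..R, (cauchyIntegral g (x + y * Complex.I)) ^ (p : ℂ)‖ ≤
      4 * R * ((2 * ∫ t, |g t|) / R) ^ p := by
  have hR0 : 0 < R := hy.trans_le hyR
  have key := Complex.integral_boundary_rect_eq_zero_of_differentiableOn
    (fun z => (cauchyIntegral g z) ^ (p : ℂ)) (⟨-R, y⟩) (⟨R, R⟩) (by
      intro z hz
      have hz2 : y ≤ z.im := by
        have := hz.2
        simp only [Set.mem_preimage] at this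
        rw [Set.uIcc_of_le hyR] at this
        exact this.1
      have hzi : 0 < z.im := hy.trans_le hz2
      have hre : 0 < (cauchyIntegral g z).re := by
        have := cauchyIntegral_re_pos hg hm h0 hpos (x := z.re) hzi
        rwa [Complex.re_add_im] at this
      exact ((differentiableAt_cauchyIntegral hg hm hzi).cpow_const
        (Or.inl hre)).differentiableWithinAt)
  simp only at key
  set M := ((2 * ∫ t, |g t|) / R) ^ p with hM
  have bound : ∀ z : ℂ, 0 < z.im → (R ≤ |z.re| ∨ R ≤ z.im) →
      ‖(cauchyIntegral g z) ^ (p : ℂ)‖ ≤ M := by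
    intro z hz h
    rw [Complex.norm_cpow_real]
    exact Real.rpow_le_rpow (norm_nonneg _) (norm_cauchyIntegral_le hg hN hR hR0 hz h) hp.le
  have e1 : ‖∫ x in (-R)..R, (cauchyIntegral g (x + R * Complex.I)) ^ (p : ℂ)‖ ≤ M * |R - -R| := by
    apply intervalIntegral.norm_integral_le_of_norm_le_const
    intro x _
    apply bound <;> simp [hR0]
  have e2 : ∀ s : ℝ, |s| = R → ‖∫ x in y..R, (cauchyIntegral g (s + x * Complex.I)) ^ (p : ℂ)‖ ≤ M * |R - y| := by
    intro s hs
    apply intervalIntegral.norm_integral_le_of_norm_le_const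
    intro x hx
    rw [Set.uIoc_of_le hyR] at hx
    apply bound
    · simpa using hy.trans hx.1
    · left; simp [hs]
  have e3 := e2 R (abs_of_pos hR0)
  have e4 := e2 (-R) (by rw [abs_neg, abs_of_pos hR0])
  have hMnn : 0 ≤ M := by positivity
  rw [show R - -R = 2 * R by ring, abs_of_pos (by positivity)] at e1
  rw [abs_of_nonneg (by linarith)] at e3 e4
  set a := ∫ x in (-R)..R, (cauchyIntegral g (x + y * Complex.I)) ^ (p : ℂ)
  set b := ∫ x in (-R)..R, (cauchyIntegral g (x + R * Complex.I)) ^ (p : ℂ)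
  set c := ∫ x in y..R, (cauchyIntegral g ((R : ℝ) + x * Complex.I)) ^ (p : ℂ)
  set d := ∫ x in y..R, (cauchyIntegral g ((-R : ℝ) + x * Complex.I)) ^ (p : ℂ)
  have hab : a = b - Complex.I • c + Complex.I • d := by linear_combination key
  have hc' : ‖Complex.I • c‖ = ‖c‖ := by simp
  have hd' : ‖Complex.I • d‖ = ‖d‖ := by simp
  calc ‖a‖ ≤ ‖b‖ + ‖c‖ + ‖d‖ := by
        rw [hab, ← hc', ← hd']
        exact (norm_add_le _ _).trans (by gcongr; exact norm_sub_le _ _)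
    _ ≤ 4 * R * M := by nlinarith

theorem lintegral_enorm_poissonKernel {y : ℝ} (hy : 0 < y) :
    ∫⁻ s : ℝ, ‖y / (s ^ 2 + y ^ 2)‖ₑ = ENNReal.ofReal Real.pi := by
  have e : ∀ s : ℝ, y / (s ^ 2 + y ^ 2) = y⁻¹ * (1 + (s / y) ^ 2)⁻¹ := by
    intro s; field_simp; ring
  have hi : Integrable (fun s : ℝ => y / (s ^ 2 + y ^ 2)) := by
    simp only [e]
    exact (integrable_inv_one_add_sq.comp_div hy.ne').const_mul _
  rw [← ofReal_integral_norm_eq_lintegral_enorm hi]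
  congr 1
  have : ∀ s : ℝ, ‖y / (s ^ 2 + y ^ 2)‖ = y⁻¹ * (1 + (s / y) ^ 2)⁻¹ := fun s => by
    rw [Real.norm_of_nonneg (by positivity), e]
  simp only [this]
  rw [integral_const_mul, Measure.integral_comp_div (fun s => (1 + s ^ 2)⁻¹),
    integral_univ_inv_one_add_sq, abs_of_pos hy, smul_eq_mul]
  field_simp

theorem eLpNorm_poissonIntegral_le {p : ℝ} (hp : 1 < p) {y : ℝ} (hy : 0 < y)
    (hm : Measurable g) :
    eLpNorm (poissonIntegral y g) (ENNReal.ofReal p) volume ≤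
      ENNReal.ofReal Real.pi * eLpNorm g (ENNReal.ofReal p) volume := by
  rw [← lintegral_enorm_poissonKernel hy]
  refine eLpNorm_integral_smul_le (w := fun s : ℝ => y / (s ^ 2 + y ^ 2))
    (G := fun s x => g (x - s)) hp (by fun_prop) ?_ ?_
  · exact Measurable.stronglyMeasurable (by simp only [Function.uncurry_def]; fun_prop)
  · intro s _
    exact (eLpNorm_comp_sub_right s _ hm.aestronglyMeasurable).le

/-- **M. Riesz' inequality** for nonnegative functions and exponents `1 < p ≤ 2`: integrate the
pointwise inequality `exists_abs_im_rpow_le` along a horizontal line. Nonnegativity of `g` puts the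
Cauchy integral in the right half plane, where its `p`-th power is holomorphic. -/
theorem exists_lintegral_conjPoissonIntegral_le {p : ℝ} (hp : 1 < p) (hp2 : p ≤ 2) :
    ∃ A : ℝ, 0 ≤ A ∧ ∀ g : ℝ → ℝ, IsBoundedSupp g → (∀ t, 0 ≤ g t) → ∀ y : ℝ, 0 < y →
      ∫⁻ x, ENNReal.ofReal (|conjPoissonIntegral y g x| ^ p) ≤
        ENNReal.ofReal A * ∫⁻ x, ENNReal.ofReal (poissonIntegral y g x ^ p) := by
  obtain ⟨A, B, hA, hB, hAB⟩ := exists_abs_im_rpow_le hp hp2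
  have hp0 : 0 < p := by linarith
  refine ⟨A, hA, fun g hgb h0 y hy => ?_⟩
  have hg : Integrable g := hgb.integrable
  have hm := hgb.measurable
  rcases (integral_nonneg (μ := volume) (show 0 ≤ g from h0)).eq_or_lt with hz | hpos
  · have hz' : g =ᵐ[volume] 0 := (integral_eq_zero_iff_of_nonneg h0 hg).1 hz.symm
    have : ∀ x, conjPoissonIntegral y g x = 0 := by
      intro x
      rw [← cauchyIntegral_im hg hm hy, cauchyIntegral, integral_eq_zero_of_ae]
      · simp
      · filter_upwards [hz'] with t ht
        simp [ht]
    simp [this, Real.zero_rpow hp0.ne']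
  obtain ⟨N, hN⟩ := hgb.exists_supp
  have hFc : Continuous fun x : ℝ => cauchyIntegral g (x + y * Complex.I) := by
    rw [continuous_iff_continuousAt]
    intro x
    have h1 : ContinuousAt (cauchyIntegral g) (x + y * Complex.I) :=
      (differentiableAt_cauchyIntegral hg hm (by simpa)).continuousAt
    exact h1.comp (f := fun x : ℝ => (x + y * Complex.I : ℂ)) (by fun_prop)
  have hpos' : ∀ x : ℝ, 0 < (cauchyIntegral g (x + y * Complex.I)).re := fun x =>
    cauchyIntegral_re_pos hg hm h0 hpos hy
  have hu : Continuous fun x => poissonIntegral y g x ^ p := by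
    simp only [← cauchyIntegral_re hg hm hy]
    exact (Complex.continuous_re.comp hFc).rpow_const fun x => Or.inr hp0.le
  have hv : Continuous fun x => |conjPoissonIntegral y g x| ^ p := by
    simp only [← cauchyIntegral_im hg hm hy]
    exact (Complex.continuous_im.comp hFc).abs.rpow_const fun x => Or.inr hp0.le
  have hFp : Continuous fun x : ℝ => (cauchyIntegral g (x + y * Complex.I)) ^ (p : ℂ) :=
    hFc.cpow continuous_const fun x => Or.inl (hpos' x)
  have hFr : Continuous fun x : ℝ => ((cauchyIntegral g (x + y * Complex.I)) ^ (p : ℂ)).re :=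
    Complex.continuous_re.comp hFp
  have hu0 : ∀ x, 0 ≤ poissonIntegral y g x := fun x => by
    rw [← cauchyIntegral_re hg hm hy]; exact (hpos' x).le
  set c := 2 * ∫ t, |g t| with hc
  have hc0 : 0 ≤ c := by
    have : 0 ≤ ∫ t, |g t| := integral_nonneg fun t => abs_nonneg _
    linarith
  have step : ∀ R : ℝ, 2 * N ≤ R → y ≤ R →
      ∫⁻ x in Set.Ioc (-R) R, ENNReal.ofReal (|conjPoissonIntegral y g x| ^ p) ≤
        ENNReal.ofReal A * (∫⁻ x, ENNReal.ofReal (poissonIntegral y g x ^ p)) +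
          ENNReal.ofReal (B * (4 * c ^ p * R ^ (-(p - 1)))) := by
    intro R hR hyR
    have hR0 : 0 < R := hy.trans_le hyR
    have hle : -R ≤ R := by linarith
    have h1 : ∫ x in (-R)..R, |conjPoissonIntegral y g x| ^ p ≤
        A * (∫ x in (-R)..R, poissonIntegral y g x ^ p) +
          B * (4 * c ^ p * R ^ (-(p - 1))) := by
      have h2 : ∫ x in (-R)..R, |conjPoissonIntegral y g x| ^ p ≤
          ∫ x in (-R)..R, (A * poissonIntegral y g x ^ p -
            B * ((cauchyIntegral g (x + y * Complex.I)) ^ (p : ℂ)).re) := by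
        apply intervalIntegral.integral_mono_on hle (hv.intervalIntegrable _ _)
        · exact ((hu.const_mul A).sub (hFr.const_mul B)).intervalIntegrable _ _
        · intro x _
          have := hAB _ (hpos' x)
          rwa [cauchyIntegral_im hg hm hy, cauchyIntegral_re hg hm hy] at this
      have h3 : ∫ x in (-R)..R, (A * poissonIntegral y g x ^ p -
            B * ((cauchyIntegral g (x + y * Complex.I)) ^ (p : ℂ)).re) =
          A * (∫ x in (-R)..R, poissonIntegral y g x ^ p) -
          B * (∫ x in (-R)..R, (cauchyIntegral g (x + y * Complex.I)) ^ (p : ℂ)).re := by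
        rw [intervalIntegral.integral_sub ((hu.const_mul A).intervalIntegrable _ _)
          ((hFr.const_mul B).intervalIntegrable _ _),
          intervalIntegral.integral_const_mul, intervalIntegral.integral_const_mul]
        congr 2
        exact Complex.reCLM.intervalIntegral_comp_comm (hFp.intervalIntegrable _ _)
      have h4 := norm_integral_cauchyIntegral_cpow_le hg hm h0 hpos hN hp0 hy hR hyR
      have h5 := (abs_le.1 (Complex.abs_re_le_norm
        (∫ x in (-R)..R, (cauchyIntegral g (x + y * Complex.I)) ^ (p : ℂ)))).1
      have h6 : 4 * R * (c / R) ^ p = 4 * c ^ p * R ^ (-(p - 1)) := by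
        rw [Real.div_rpow hc0 hR0.le, neg_sub, Real.rpow_sub hR0, Real.rpow_one]
        ring
      rw [← hc, h6] at h4
      rw [h3] at h2
      have h7 : B * -(4 * c ^ p * R ^ (-(p - 1))) ≤ B * (∫ x in (-R)..R, (cauchyIntegral g (x + y * Complex.I)) ^ (p : ℂ)).re := by
        gcongr; linarith
      linarith
    rw [intervalIntegral.integral_of_le hle, intervalIntegral.integral_of_le hle] at h1
    rw [← ofReal_integral_eq_lintegral_ofReal]
    · refine (ENNReal.ofReal_le_ofReal h1).trans (ENNReal.ofReal_add_le.trans ?_)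
      gcongr
      rw [ENNReal.ofReal_mul hA]
      gcongr
      rw [ofReal_integral_eq_lintegral_ofReal]
      · exact setLIntegral_le_lintegral _ _
      · exact hu.integrableOn_Ioc
      · exact Eventually.of_forall fun x => Real.rpow_nonneg (hu0 x) _
    · exact hv.integrableOn_Ioc
    · exact Eventually.of_forall fun x => by positivity
  have hcov : AECover (volume : Measure ℝ) atTop fun R : ℝ => Set.Ioc (-R) R :=
    aecover_Ioc tendsto_neg_atTop_atBot tendsto_id
  have hlim1 := hcov.lintegral_tendsto_of_countably_generated
    (f := fun x => ENNReal.ofReal (|conjPoissonIntegral y g x| ^ p))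
    hv.measurable.ennreal_ofReal.aemeasurable
  have hlim2 : Tendsto (fun R : ℝ => ENNReal.ofReal A * (∫⁻ x, ENNReal.ofReal (poissonIntegral y g x ^ p)) +
          ENNReal.ofReal (B * (4 * c ^ p * R ^ (-(p - 1))))) atTop
      (𝓝 (ENNReal.ofReal A * (∫⁻ x, ENNReal.ofReal (poissonIntegral y g x ^ p)) +
          ENNReal.ofReal (B * (4 * c ^ p * 0)))) := by
    refine Tendsto.add tendsto_const_nhds (ENNReal.tendsto_ofReal ?_)
    exact ((tendsto_rpow_neg_atTop (by linarith : 0 < p - 1)).const_mul _).const_mul _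
  simp only [mul_zero, ENNReal.ofReal_zero, add_zero] at hlim2
  refine le_of_tendsto_of_tendsto hlim1 hlim2 ?_
  filter_upwards [eventually_ge_atTop (2 * N), eventually_ge_atTop y] with R h1 h2
  exact step R h1 h2

end Cauchy

/-! ### The truncated Hilbert transform -/

/-- The truncated Hilbert kernel `1_{|t| > ε} / t`. -/
noncomputable def hilbertKernel (ε t : ℝ) : ℝ := if ε < |t| then t⁻¹ else 0

@[fun_prop]
theorem measurable_hilbertKernel (ε : ℝ) : Measurable (hilbertKernel ε) :=
  Measurable.ite (measurableSet_lt measurable_const measurable_id.abs) measurable_inv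
    measurable_const

theorem hilbertKernel_neg (ε t : ℝ) : hilbertKernel ε (-t) = -hilbertKernel ε t := by
  unfold hilbertKernel
  rw [abs_neg]
  split_ifs <;> simp [inv_neg]

theorem norm_hilbertKernel_le {ε : ℝ} (hε : 0 < ε) (t : ℝ) : ‖hilbertKernel ε t‖ ≤ ε⁻¹ := by
  unfold hilbertKernel
  split_ifs with h
  · rw [norm_inv, Real.norm_eq_abs]
    gcongr
  · simpa using hε.le

/-- The truncated Hilbert transform, without the normalising factor `1 / π`. -/
noncomputable def truncHilbert (ε : ℝ) (g : ℝ → ℝ) (x : ℝ) : ℝ :=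
  ∫ t, hilbertKernel ε t • g (x - t)

theorem IsBoundedSupp.integrable_kernel_smul {g : ℝ → ℝ} (hg : IsBoundedSupp g)
    {k : ℝ → ℝ} (hk : Measurable k) {c : ℝ} (hc : ∀ t, ‖k t‖ ≤ c) (x : ℝ) :
    Integrable fun t => k t • g (x - t) :=
  (hg.integrable.comp_sub_left x).bdd_mul hk.aestronglyMeasurable (Eventually.of_forall hc)

theorem abs_hilbertKernel_sub_le {ε : ℝ} (hε : 0 < ε) (t : ℝ) :
    |hilbertKernel ε t - t / (t ^ 2 + ε ^ 2)| ≤ ε / (t ^ 2 + ε ^ 2) := by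
  have hpos : 0 < t ^ 2 + ε ^ 2 := by positivity
  unfold hilbertKernel
  split_ifs with h
  · have ht : t ≠ 0 := by
      rintro rfl; simp at h; linarith
    have : t⁻¹ - t / (t ^ 2 + ε ^ 2) = ε ^ 2 / (t * (t ^ 2 + ε ^ 2)) := by
      field_simp; ring
    rw [this, abs_div, abs_mul, abs_of_pos hpos, abs_of_pos (by positivity : 0 < ε ^ 2),
      div_le_div_iff₀ (by positivity) hpos]
    have : ε ^ 2 ≤ ε * |t| := by nlinarith
    nlinarith
  · rw [zero_sub, abs_neg, abs_div, abs_of_pos hpos]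
    gcongr
    exact not_lt.1 h

/-- At equal scales the truncated Hilbert transform differs from the conjugate Poisson integral by
at most the Poisson integral. -/
theorem abs_truncHilbert_le {g : ℝ → ℝ} (hg : IsBoundedSupp g) (h0 : ∀ t, 0 ≤ g t) {ε : ℝ}
    (hε : 0 < ε) (x : ℝ) :
    ‖truncHilbert ε g x‖ ≤ ‖|conjPoissonIntegral ε g x| + poissonIntegral ε g x‖ := by
  have hb : ∀ t : ℝ, ε / (t ^ 2 + ε ^ 2) ≤ ε⁻¹ := by
    intro t
    rw [inv_eq_one_div, div_le_div_iff₀ (by positivity) hε]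
    nlinarith [sq_nonneg t]
  have hb2 : ∀ t : ℝ, ‖t / (t ^ 2 + ε ^ 2)‖ ≤ ε⁻¹ := by
    intro t
    rw [norm_div, Real.norm_eq_abs, Real.norm_of_nonneg (by positivity), inv_eq_one_div,
      div_le_div_iff₀ (by positivity) hε]
    nlinarith [sq_nonneg (|t| - ε), sq_abs t]
  have i1 := hg.integrable_kernel_smul (measurable_hilbertKernel ε) (norm_hilbertKernel_le hε) x
  have i2 := hg.integrable_kernel_smul (k := fun t => t / (t ^ 2 + ε ^ 2)) (by fun_prop) hb2 x
  have i3 := hg.integrable_kernel_smul (k := fun t => ε / (t ^ 2 + ε ^ 2)) (by fun_prop)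
    (fun t => by rw [Real.norm_of_nonneg (by positivity)]; exact hb t) x
  have hu : 0 ≤ poissonIntegral ε g x :=
    integral_nonneg fun t => by
      have := h0 (x - t)
      simp only [Pi.zero_apply, smul_eq_mul]
      positivity
  rw [Real.norm_of_nonneg (r := |_| + _) (by positivity), Real.norm_eq_abs]
  have : |truncHilbert ε g x - conjPoissonIntegral ε g x| ≤ poissonIntegral ε g x := by
    rw [truncHilbert, conjPoissonIntegral, ← integral_sub i1 i2]
    refine norm_integral_le_of_norm_le
      (f := fun t => hilbertKernel ε t • g (x - t) - (t / (t ^ 2 + ε ^ 2)) • g (x - t)) i3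
      (Eventually.of_forall fun t => ?_)
    rw [← sub_smul, norm_smul, Real.norm_eq_abs, Real.norm_of_nonneg (h0 _), smul_eq_mul]
    exact mul_le_mul_of_nonneg_right (abs_hilbertKernel_sub_le hε t) (h0 _)
  have h2 := abs_sub_abs_le_abs_sub (truncHilbert ε g x) (conjPoissonIntegral ε g x)
  linarith

theorem measurable_integral_smul_comp_sub {k g : ℝ → ℝ} (hk : Measurable k) (hg : Measurable g) :
    Measurable fun x => ∫ t, k t • g (x - t) := by
  apply StronglyMeasurable.measurable
  apply StronglyMeasurable.integral_prod_right
  exact Measurable.stronglyMeasurable (by simp only [Function.uncurry_def]; fun_prop)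

theorem measurable_truncHilbert {g : ℝ → ℝ} (hg : Measurable g) (ε : ℝ) :
    Measurable (truncHilbert ε g) :=
  measurable_integral_smul_comp_sub (measurable_hilbertKernel ε) hg

theorem eLpNorm_eq_lintegral_ofReal_abs_rpow {g : ℝ → ℝ} {p : ℝ} (hp : 0 < p) :
    eLpNorm g (ENNReal.ofReal p) volume = (∫⁻ x, ENNReal.ofReal (|g x| ^ p)) ^ (1 / p) := by
  rw [eLpNorm_eq_lintegral_rpow_enorm_toReal (by simpa using hp) ENNReal.ofReal_ne_top,
    ENNReal.toReal_ofReal hp.le]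
  congr 1
  refine lintegral_congr fun x => ?_
  rw [← Real.norm_eq_abs, ← ENNReal.ofReal_rpow_of_nonneg (norm_nonneg _) hp.le, ofReal_norm]

/-- Functions of either sign are split into positive and negative parts, as M. Riesz' inequality
above is for nonnegative functions. -/
theorem exists_eLpNorm_truncHilbert_le_of_le_two {p : ℝ} (hp : 1 < p) (hp2 : p ≤ 2) :
    ∃ C : ℝ≥0, ∀ g : ℝ → ℝ, IsBoundedSupp g → ∀ ε : ℝ, 0 < ε →
      eLpNorm (truncHilbert ε g) (ENNReal.ofReal p) volume ≤
        C * eLpNorm g (ENNReal.ofReal p) volume := by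
  obtain ⟨A, hA, hAb⟩ := exists_lintegral_conjPoissonIntegral_le hp hp2
  have hp0 : 0 < p := by linarith
  have hp1 : 1 ≤ ENNReal.ofReal p := by simpa using hp.le
  set C₁ : ℝ≥0∞ := ENNReal.ofReal A ^ (1 / p) * ENNReal.ofReal Real.pi + ENNReal.ofReal Real.pi
    with hC₁
  have hC₁t : C₁ ≠ ∞ := by
    rw [hC₁]
    refine ENNReal.add_ne_top.2 ⟨ENNReal.mul_ne_top ?_ ENNReal.ofReal_ne_top, ENNReal.ofReal_ne_top⟩
    exact ENNReal.rpow_ne_top_of_nonneg (by positivity) ENNReal.ofReal_ne_top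
  have pos : ∀ g : ℝ → ℝ, IsBoundedSupp g → (∀ t, 0 ≤ g t) → ∀ ε : ℝ, 0 < ε →
      eLpNorm (truncHilbert ε g) (ENNReal.ofReal p) volume ≤
        C₁ * eLpNorm g (ENNReal.ofReal p) volume := by
    intro g hg h0 ε hε
    have hum : Measurable (poissonIntegral ε g) :=
      measurable_integral_smul_comp_sub (by fun_prop) hg.measurable
    have hvm : Measurable (conjPoissonIntegral ε g) :=
      measurable_integral_smul_comp_sub (by fun_prop) hg.measurable
    have hu := eLpNorm_poissonIntegral_le hp hε hg.measurable
    have hu0 : ∀ x, 0 ≤ poissonIntegral ε g x := fun x =>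
      integral_nonneg fun t => by
        have := h0 (x - t)
        simp only [Pi.zero_apply, smul_eq_mul]
        positivity
    have hv : eLpNorm (conjPoissonIntegral ε g) (ENNReal.ofReal p) volume ≤
        ENNReal.ofReal A ^ (1 / p) * eLpNorm (poissonIntegral ε g) (ENNReal.ofReal p) volume := by
      rw [eLpNorm_eq_lintegral_ofReal_abs_rpow hp0, eLpNorm_eq_lintegral_ofReal_abs_rpow hp0,
        ← ENNReal.mul_rpow_of_nonneg _ _ (by positivity)]
      refine ENNReal.rpow_le_rpow ?_ (by positivity)
      refine (hAb g hg h0 ε hε).trans_eq ?_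
      simp only [abs_of_nonneg (hu0 _)]
    calc _ ≤ eLpNorm (fun x => |conjPoissonIntegral ε g x| + poissonIntegral ε g x)
            (ENNReal.ofReal p) volume := eLpNorm_mono (abs_truncHilbert_le hg h0 hε)
      _ ≤ eLpNorm (fun x => |conjPoissonIntegral ε g x|) (ENNReal.ofReal p) volume +
            eLpNorm (poissonIntegral ε g) (ENNReal.ofReal p) volume :=
          eLpNorm_add_le hvm.abs.aestronglyMeasurable hum.aestronglyMeasurable hp1
      _ = eLpNorm (conjPoissonIntegral ε g) (ENNReal.ofReal p) volume +
            eLpNorm (poissonIntegral ε g) (ENNReal.ofReal p) volume := by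
          congr 1
          exact eLpNorm_norm (conjPoissonIntegral ε g)
      _ ≤ ENNReal.ofReal A ^ (1 / p) *
            (ENNReal.ofReal Real.pi * eLpNorm g (ENNReal.ofReal p) volume) +
            ENNReal.ofReal Real.pi * eLpNorm g (ENNReal.ofReal p) volume := by
          gcongr
          exact hv.trans (by gcongr)
      _ = _ := by rw [hC₁]; ring
  refine ⟨(2 * C₁).toNNReal, fun g hg ε hε => ?_⟩
  rw [ENNReal.coe_toNNReal (ENNReal.mul_ne_top ENNReal.ofNat_ne_top hC₁t)]
  obtain ⟨B, hB⟩ := hg.exists_bound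
  obtain ⟨N, hN⟩ := hg.exists_supp
  have hgp : IsBoundedSupp fun t => max (g t) 0 := by
    refine ⟨hg.measurable.max measurable_const, ⟨B, fun x => ?_⟩, ⟨N, fun x hx => by simp [hN x hx]⟩⟩
    refine le_trans ?_ (hB x)
    rw [Real.norm_of_nonneg (le_max_right _ _), Real.norm_eq_abs]
    exact max_le (le_abs_self _) (abs_nonneg _)
  have hgn : IsBoundedSupp fun t => max (-g t) 0 := by
    refine ⟨hg.measurable.neg.max measurable_const, ⟨B, fun x => ?_⟩, ⟨N, fun x hx => by simp [hN x hx]⟩⟩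
    refine le_trans ?_ (hB x)
    rw [Real.norm_of_nonneg (le_max_right _ _), Real.norm_eq_abs]
    exact max_le (neg_le_abs _) (abs_nonneg _)
  have hdec : truncHilbert ε g =
      truncHilbert ε (fun t => max (g t) 0) - truncHilbert ε (fun t => max (-g t) 0) := by
    ext x
    rw [Pi.sub_apply, truncHilbert, truncHilbert, truncHilbert, ← integral_sub
      (hgp.integrable_kernel_smul (measurable_hilbertKernel ε) (norm_hilbertKernel_le hε) x)
      (hgn.integrable_kernel_smul (measurable_hilbertKernel ε) (norm_hilbertKernel_le hε) x)]
    refine integral_congr_ae (Eventually.of_forall fun t => ?_)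
    simp only
    rw [← smul_sub]
    congr 1
    rcases le_total 0 (g (x - t)) with h | h <;> simp [h]
  rw [hdec]
  refine (eLpNorm_sub_le (measurable_truncHilbert hgp.measurable ε).aestronglyMeasurable
    (measurable_truncHilbert hgn.measurable ε).aestronglyMeasurable hp1).trans ?_
  have e1 : eLpNorm (fun t => max (g t) 0) (ENNReal.ofReal p) volume ≤
      eLpNorm g (ENNReal.ofReal p) volume := eLpNorm_mono fun x => by
    rw [Real.norm_of_nonneg (le_max_right _ _), Real.norm_eq_abs]
    exact max_le (le_abs_self _) (abs_nonneg _)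
  have e2 : eLpNorm (fun t => max (-g t) 0) (ENNReal.ofReal p) volume ≤
      eLpNorm g (ENNReal.ofReal p) volume := eLpNorm_mono fun x => by
    rw [Real.norm_of_nonneg (le_max_right _ _), Real.norm_eq_abs]
    exact max_le (neg_le_abs _) (abs_nonneg _)
  calc _ ≤ C₁ * eLpNorm g (ENNReal.ofReal p) volume + C₁ * eLpNorm g (ENNReal.ofReal p) volume := by
        gcongr
        · exact (pos _ hgp (fun t => le_max_right _ _) ε hε).trans (by gcongr)
        · exact (pos _ hgn (fun t => le_max_right _ _) ε hε).trans (by gcongr)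
    _ = _ := by ring

/-- The truncated Hilbert kernel is odd, so the transform is antisymmetric. -/
theorem integral_truncHilbert_mul {g h : ℝ → ℝ} (hg : IsBoundedSupp g) (hh : IsBoundedSupp h)
    {ε : ℝ} (hε : 0 < ε) :
    ∫ x, truncHilbert ε g x * h x = -∫ x, g x * truncHilbert ε h x := by
  have e1 : ∀ x, truncHilbert ε g x = ∫ t, hilbertKernel ε (x - t) * g t := by
    intro x
    rw [truncHilbert, ← integral_sub_left_eq_self _ volume x]
    simp
  have e2 : ∀ x, truncHilbert ε h x = -∫ t, hilbertKernel ε (t - x) * h t := by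
    intro x
    rw [truncHilbert, ← integral_sub_left_eq_self _ volume x, ← integral_neg]
    simp only [sub_sub_cancel, smul_eq_mul]
    congr 1
    ext t
    rw [← neg_mul, ← hilbertKernel_neg, neg_sub]
  simp only [e1, e2, mul_neg, integral_neg, neg_neg, ← integral_mul_const, ← integral_const_mul]
  rw [integral_integral_swap]
  · refine integral_congr_ae (Eventually.of_forall fun x => ?_)
    refine integral_congr_ae (Eventually.of_forall fun t => ?_)
    simp only; ring
  · have hi : Integrable (fun z : ℝ × ℝ => h z.1 * g z.2) (volume.prod volume) :=
      hh.integrable.mul_prod hg.integrable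
    have hgm := hg.measurable
    have hhm := hh.measurable
    refine (hi.bdd_mul (f := fun z : ℝ × ℝ => hilbertKernel ε (z.1 - z.2)) (c := ε⁻¹)
      (Measurable.aestronglyMeasurable (by fun_prop))
      (Eventually.of_forall fun z => norm_hilbertKernel_le hε _)).congr ?_
    refine Eventually.of_forall fun z => ?_
    simp only [Function.uncurry_def]; ring

/-- The uniform `L^q` bound for truncated Hilbert transforms; exponents `q > 2` by duality. -/
theorem exists_eLpNorm_truncHilbert_le {q : ℝ} (hq : 1 < q) :
    ∃ C : ℝ≥0, ∀ g : ℝ → ℝ, IsBoundedSupp g → ∀ ε : ℝ, 0 < ε →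
      eLpNorm (truncHilbert ε g) (ENNReal.ofReal q) volume ≤
        C * eLpNorm g (ENNReal.ofReal q) volume := by
  rcases le_or_gt q 2 with hq2 | hq2
  · exact exists_eLpNorm_truncHilbert_le_of_le_two hq hq2
  have hpq : (q.conjExponent).HolderConjugate q := (Real.HolderConjugate.conjExponent hq).symm
  set p := q.conjExponent with hpdef
  have hp1 : 1 < p := hpq.lt
  have hp2 : p ≤ 2 := by
    rw [hpdef, Real.conjExponent, div_le_iff₀ (by linarith)]; linarith
  have hq0 : 0 < q := by linarith
  have hp0 : 0 < p := by linarith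
  obtain ⟨C, hC⟩ := exists_eLpNorm_truncHilbert_le_of_le_two hp1 hp2
  refine ⟨C, fun g hg ε hε => ?_⟩
  obtain ⟨B, hB⟩ := hg.exists_bound
  have hB0 : 0 ≤ B := (norm_nonneg _).trans (hB 0)
  set G := truncHilbert ε g with hG
  have hGm : Measurable G := measurable_truncHilbert hg.measurable ε
  -- `G` is bounded
  have hGb : ∀ x, |G x| ≤ ε⁻¹ * ∫ t, |g t| := by
    intro x
    rw [hG, truncHilbert]
    have : Integrable fun t => ε⁻¹ * |g (x - t)| := (hg.integrable.abs.comp_sub_left x).const_mul _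
    refine (norm_integral_le_of_norm_le (f := fun t => hilbertKernel ε t • g (x - t)) this
      (Eventually.of_forall fun t => ?_)).trans_eq ?_
    · rw [norm_smul, Real.norm_eq_abs (g _)]
      exact mul_le_mul_of_nonneg_right (norm_hilbertKernel_le hε t) (abs_nonneg _)
    · rw [integral_const_mul, integral_sub_left_eq_self (fun t => |g t|) volume x]
  have hloc : ∀ N : ℕ, ∫⁻ x in Set.Ioc (-(N : ℝ)) N, ENNReal.ofReal (|G x| ^ q) ≤
      (C * eLpNorm g (ENNReal.ofReal q) volume) ^ q := by
    intro N
    set s : Set ℝ := Set.Ioc (-(N : ℝ)) N with hs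
    have hsm : MeasurableSet s := measurableSet_Ioc
    -- the extremal function for the duality pairing
    set h : ℝ → ℝ := s.indicator fun x => SignType.sign (G x) * |G x| ^ (q - 1) with hh
    have habs : ∀ x, |h x| = s.indicator (fun x => |G x| ^ (q - 1)) x := by
      intro x
      by_cases hx : x ∈ s
      · rw [hh, Set.indicator_of_mem hx, Set.indicator_of_mem hx, abs_mul]
        rcases eq_or_ne (G x) 0 with h0 | h0
        · simp [h0, Real.zero_rpow (by linarith : q - 1 ≠ 0)]
        · have : |((SignType.sign (G x) : SignType) : ℝ)| = 1 := by
            rcases lt_or_gt_of_ne h0 with h1 | h1 <;> simp [h1]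
          rw [this, one_mul, abs_of_nonneg (by positivity)]
      · simp [hh, hx]
    have hhs : IsBoundedSupp h := by
      refine ⟨?_, ⟨(ε⁻¹ * ∫ t, |g t|) ^ (q - 1), fun x => ?_⟩, ⟨N, fun x hx => ?_⟩⟩
      · refine Measurable.indicator (Measurable.mul ?_ (by fun_prop)) hsm
        have e : (fun x => ((SignType.sign (G x) : SignType) : ℝ)) =
            fun x => if 0 < G x then 1 else if G x < 0 then -1 else 0 := by
          ext x
          rw [sign_apply]
          split_ifs <;> simp
        rw [e]
        exact Measurable.ite (measurableSet_lt measurable_const hGm) measurable_const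
          (Measurable.ite (measurableSet_lt hGm measurable_const) measurable_const
            measurable_const)
      · rw [Real.norm_eq_abs, habs]
        by_cases hx : x ∈ s
        · rw [Set.indicator_of_mem hx]
          exact Real.rpow_le_rpow (abs_nonneg _) (hGb x) (by linarith)
        · rw [Set.indicator_of_notMem hx]
          exact Real.rpow_nonneg ((abs_nonneg _).trans (hGb x)) _
      · rw [hh, Set.indicator_of_notMem]
        rw [hs, Set.mem_Ioc]
        rintro ⟨h1, h2⟩
        exact absurd hx (not_lt.2 (abs_le.2 ⟨h1.le, h2⟩))
    set J := ∫⁻ x in s, ENNReal.ofReal (|G x| ^ q) with hJ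
    have hint : IntegrableOn (fun x => |G x| ^ q) s := by
      refine IntegrableOn.of_bound (by simp [hs])
        (hGm.abs.pow_const q).aestronglyMeasurable
        ((ε⁻¹ * ∫ t, |g t|) ^ q) (Eventually.of_forall fun x => ?_)
      rw [Real.norm_of_nonneg (by positivity)]
      exact Real.rpow_le_rpow (abs_nonneg _) (hGb x) hq0.le
    have hJI : J = ENNReal.ofReal (∫ x in s, |G x| ^ q) :=
      (ofReal_integral_eq_lintegral_ofReal hint (Eventually.of_forall fun x => by positivity)).symm
    have hJtop : J ≠ ∞ := by rw [hJI]; exact ENNReal.ofReal_ne_top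
    have hGh : ∀ x, G x * h x = s.indicator (fun x => |G x| ^ q) x := by
      intro x
      by_cases hx : x ∈ s
      · rw [hh, Set.indicator_of_mem hx, Set.indicator_of_mem hx, ← mul_assoc, self_mul_sign]
        rcases eq_or_ne (G x) 0 with h0 | h0
        · simp [h0, Real.zero_rpow hq0.ne']
        · conv_lhs => rw [← Real.rpow_one |G x|]
          rw [← Real.rpow_mul (abs_nonneg _), one_mul, ← Real.rpow_add (abs_pos.2 h0)]
          congr 1; ring
      · simp [hh, hx]
    have hhp : eLpNorm h (ENNReal.ofReal p) volume = J ^ (1 / p) := by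
      rw [eLpNorm_eq_lintegral_ofReal_abs_rpow hp0, hJ, ← lintegral_indicator hsm]
      congr 1
      refine lintegral_congr fun x => ?_
      rw [habs]
      by_cases hx : x ∈ s
      · rw [Set.indicator_of_mem hx, Set.indicator_of_mem hx, ← Real.rpow_mul (abs_nonneg _)]
        congr 2
        rw [hpdef, Real.conjExponent]
        field_simp
        rw [div_self (by linarith)]
      · simp [hx, Real.zero_rpow hp0.ne']
    have hle : J ≤ (C * eLpNorm g (ENNReal.ofReal q) volume) * J ^ (1 / p) := by
      have h1 : J = ‖∫ x, g x * truncHilbert ε h x‖ₑ := by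
        have : ∫ x, g x * truncHilbert ε h x = -∫ x in s, |G x| ^ q := by
          have h2 := integral_truncHilbert_mul hg hhs hε
          rw [← hG] at h2
          simp only [hGh] at h2
          rw [integral_indicator hsm] at h2
          linarith
        rw [this, enorm_neg, hJI, Real.enorm_of_nonneg]
        exact setIntegral_nonneg hsm fun x _ => by positivity
      calc J ≤ ∫⁻ x, ‖g x‖ₑ * ‖truncHilbert ε h x‖ₑ := by
            rw [h1]
            refine (enorm_integral_le_lintegral_enorm _).trans_eq ?_
            simp only [enorm_mul]
        _ ≤ eLpNorm g (ENNReal.ofReal q) volume *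
              eLpNorm (truncHilbert ε h) (ENNReal.ofReal p) volume := by
            rw [eLpNorm_eq_lintegral_rpow_enorm_toReal (by simpa using hq0) ENNReal.ofReal_ne_top,
              eLpNorm_eq_lintegral_rpow_enorm_toReal (by simpa using hp0) ENNReal.ofReal_ne_top,
              ENNReal.toReal_ofReal hq0.le, ENNReal.toReal_ofReal hp0.le]
            exact ENNReal.lintegral_mul_le_Lp_mul_Lq volume hpq.symm
              hg.measurable.enorm.aemeasurable
              (measurable_truncHilbert hhs.measurable ε).enorm.aemeasurable
        _ ≤ eLpNorm g (ENNReal.ofReal q) volume * (C * J ^ (1 / p)) := by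
            rw [← hhp]
            gcongr
            exact hC h hhs ε hε
        _ = _ := by ring
    rcases eq_or_ne J 0 with h0 | h0
    · rw [h0]; exact zero_le
    · have h2 : J ^ (1 / q) * J ^ (1 / p) ≤
          (C * eLpNorm g (ENNReal.ofReal q) volume) * J ^ (1 / p) := by
        rw [← ENNReal.rpow_add _ _ h0 hJtop]
        have : 1 / q + 1 / p = 1 := by
          have := hpq.inv_add_inv_eq_one
          rw [one_div, one_div]; linarith
        rwa [this, ENNReal.rpow_one]
      have h3 : J ^ (1 / p) ≠ 0 := by simp [h0, hJtop]
      have h4 : J ^ (1 / p) ≠ ∞ := ENNReal.rpow_ne_top_of_nonneg (by positivity) hJtop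
      have h5 := (ENNReal.mul_le_mul_iff_left h3 h4).1 h2
      rwa [one_div, ENNReal.rpow_inv_le_iff hq0] at h5
  rw [eLpNorm_eq_lintegral_ofReal_abs_rpow hq0, one_div, ENNReal.rpow_inv_le_iff hq0]
  have hcov : AECover (volume : Measure ℝ) atTop fun N : ℕ => Set.Ioc (-(N : ℝ)) N :=
    aecover_Ioc (tendsto_neg_atTop_atBot.comp tendsto_natCast_atTop_atTop)
      tendsto_natCast_atTop_atTop
  exact le_of_tendsto' (hcov.lintegral_tendsto_of_countably_generated
    (f := fun x => ENNReal.ofReal (|G x| ^ q)) (hGm.abs.pow_const q).ennreal_ofReal.aemeasurable) hloc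

/-! ### Directional Hilbert transforms -/

section Slicing

variable {E : Type*} [NormedAddCommGroup E] [InnerProductSpace ℝ E] [FiniteDimensional ℝ E]
  [MeasurableSpace E] [BorelSpace E]

/-- Tonelli's theorem along the lines of direction `z`: the slab `0 ≤ ⟪z, x⟫ / ‖z‖² < 1` meets each
such line in a segment of unit parameter length. -/
theorem lintegral_eq_lintegral_slab {z : E} (hz : z ≠ 0) {Φ : E → ℝ≥0∞} (hΦ : Measurable Φ) :
    ∫⁻ x, Φ x = ∫⁻ x in {x : E | inner ℝ z x / ‖z‖ ^ 2 ∈ Set.Ico (0 : ℝ) 1},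
      ∫⁻ s : ℝ, Φ (x + s • z) := by
  set S : Set E := {x : E | inner ℝ z x / ‖z‖ ^ 2 ∈ Set.Ico (0 : ℝ) 1} with hS
  have hSm : MeasurableSet S := by
    refine measurableSet_Ico.preimage (f := fun x : E => inner ℝ z x / ‖z‖ ^ 2) ?_
    fun_prop
  have hz' : ‖z‖ ^ 2 ≠ 0 := by positivity
  have hone : ∀ x : E, ∫⁻ s : ℝ, S.indicator 1 (x - s • z) = 1 := by
    intro x
    set a := inner ℝ z x / ‖z‖ ^ 2 with ha
    have : (fun s : ℝ => S.indicator (1 : E → ℝ≥0∞) (x - s • z)) =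
        (Set.Ioc (a - 1) a).indicator 1 := by
      ext s
      have e : inner ℝ z (x - s • z) / ‖z‖ ^ 2 = a - s := by
        rw [inner_sub_right, inner_smul_right, real_inner_self_eq_norm_sq, sub_div,
          mul_div_cancel_right₀ _ hz']
      have : x - s • z ∈ S ↔ s ∈ Set.Ioc (a - 1) a := by
        rw [hS, Set.mem_ofPred_eq, e, Set.mem_Ico, Set.mem_Ioc]
        constructor <;> rintro ⟨h1, h2⟩ <;> constructor <;> linarith
      by_cases h : s ∈ Set.Ioc (a - 1) a
      · rw [Set.indicator_of_mem h, Set.indicator_of_mem (this.2 h)]; rfl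
      · rw [Set.indicator_of_notMem h, Set.indicator_of_notMem (mt this.1 h)]
    rw [this, lintegral_indicator_one measurableSet_Ioc]
    simp
  have hind : Measurable (S.indicator (1 : E → ℝ≥0∞)) := measurable_one.indicator hSm
  calc ∫⁻ x, Φ x = ∫⁻ x, ∫⁻ s : ℝ, S.indicator 1 (x - s • z) * Φ x := by
        refine lintegral_congr fun x => ?_
        rw [lintegral_mul_const (Φ x) (f := fun s : ℝ => S.indicator 1 (x - s • z))
          (hind.comp (by fun_prop)), hone, one_mul]
    _ = ∫⁻ s : ℝ, ∫⁻ x, S.indicator 1 (x - s • z) * Φ x := by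
        apply lintegral_lintegral_swap
        refine Measurable.aemeasurable ?_
        simp only [Function.uncurry_def]
        exact (hind.comp (by fun_prop)).mul (hΦ.comp measurable_fst)
    _ = ∫⁻ s : ℝ, ∫⁻ x, S.indicator 1 x * Φ (x + s • z) := by
        refine lintegral_congr fun s => ?_
        rw [← lintegral_add_right_eq_self _ (s • z)]
        simp
    _ = ∫⁻ x, ∫⁻ s : ℝ, S.indicator 1 x * Φ (x + s • z) := by
        apply lintegral_lintegral_swap
        refine Measurable.aemeasurable ?_
        simp only [Function.uncurry_def]
        exact (hind.comp measurable_snd).mul (hΦ.comp (by fun_prop))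
    _ = ∫⁻ x, S.indicator (fun x => ∫⁻ s : ℝ, Φ (x + s • z)) x := by
        refine lintegral_congr fun x => ?_
        rw [lintegral_const_mul _ (f := fun s : ℝ => Φ (x + s • z)) (hΦ.comp (by fun_prop))]
        by_cases h : x ∈ S
        · rw [Set.indicator_of_mem h, Set.indicator_of_mem h]; simp
        · rw [Set.indicator_of_notMem h, Set.indicator_of_notMem h, zero_mul]
    _ = _ := lintegral_indicator hSm _

/-- The truncated Hilbert transform in the direction `z`. -/
noncomputable def dirHilbert (ε : ℝ) (f : E → ℝ) (z x : E) : ℝ :=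
  ∫ t, hilbertKernel ε t • f (x - t • z)

theorem stronglyMeasurable_dirHilbert (ε : ℝ) {f : E → ℝ} (hf : Measurable f) :
    StronglyMeasurable (Function.uncurry (dirHilbert ε f)) := by
  have : StronglyMeasurable (fun p : (E × E) × ℝ => hilbertKernel ε p.2 • f (p.1.2 - p.2 • p.1.1)) :=
    Measurable.stronglyMeasurable (by fun_prop)
  exact this.integral_prod_right

omit [FiniteDimensional ℝ E] in
theorem IsBoundedSupp.comp_line {f : E → ℝ} (hf : IsBoundedSupp f) {z : E} (hz : z ≠ 0) (x : E) :
    IsBoundedSupp fun s : ℝ => f (x + s • z) := by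
  obtain ⟨B, hB⟩ := hf.exists_bound
  obtain ⟨N, hN⟩ := hf.exists_supp
  have hz' : 0 < ‖z‖ := norm_pos_iff.2 hz
  refine ⟨hf.measurable.comp (by fun_prop), ⟨B, fun s => hB _⟩, ⟨(N + ‖x‖) / ‖z‖, fun s hs => hN _ ?_⟩⟩
  rw [div_lt_iff₀ hz', ← norm_smul] at hs
  have := norm_sub_norm_le (s • z) (-x)
  rw [norm_neg, sub_neg_eq_add, add_comm (s • z)] at this
  linarith

/-- A bound for the truncated Hilbert transform on the line passes to every direction `z`, with the
same constant for all `z`: apply it on each line parallel to `z`. -/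
theorem eLpNorm_dirHilbert_le {q : ℝ} (hq : 1 < q) {C : ℝ≥0}
    (hC : ∀ g : ℝ → ℝ, IsBoundedSupp g → ∀ ε : ℝ, 0 < ε →
      eLpNorm (truncHilbert ε g) (ENNReal.ofReal q) volume ≤
        C * eLpNorm g (ENNReal.ofReal q) volume)
    {f : E → ℝ} (hf : IsBoundedSupp f) {ε : ℝ} (hε : 0 < ε) {z : E} (hz : z ≠ 0) :
    eLpNorm (dirHilbert ε f z) (ENNReal.ofReal q) volume ≤
      C * eLpNorm f (ENNReal.ofReal q) volume := by
  have hq0 : 0 < q := by linarith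
  have hqr : (C : ℝ≥0∞) ^ q ≠ ∞ := ENNReal.rpow_ne_top_of_nonneg hq0.le ENNReal.coe_ne_top
  have hcomp : ∀ x s, dirHilbert ε f z (x + s • z) = truncHilbert ε (fun s => f (x + s • z)) s := by
    intro x s
    rw [dirHilbert, truncHilbert]
    refine integral_congr_ae (Eventually.of_forall fun t => ?_)
    simp only
    congr 2
    rw [sub_smul]; abel
  have hdm : Measurable (dirHilbert ε f z) :=
    ((stronglyMeasurable_dirHilbert ε hf.measurable).measurable).comp
      (measurable_const.prodMk measurable_id)
  rw [eLpNorm_eq_lintegral_rpow_enorm_toReal (by simpa using hq0) ENNReal.ofReal_ne_top,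
    eLpNorm_eq_lintegral_rpow_enorm_toReal (by simpa using hq0) ENNReal.ofReal_ne_top,
    ENNReal.toReal_ofReal hq0.le, one_div, ENNReal.rpow_inv_le_iff hq0,
    ENNReal.mul_rpow_of_nonneg _ _ hq0.le, ← ENNReal.rpow_mul, inv_mul_cancel₀ hq0.ne',
    ENNReal.rpow_one, lintegral_eq_lintegral_slab hz (hdm.enorm.pow_const q),
    lintegral_eq_lintegral_slab hz (hf.measurable.enorm.pow_const q),
    ← lintegral_const_mul' _ _ hqr]
  refine lintegral_mono fun x => ?_
  have h := hC _ (hf.comp_line hz x) ε hε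
  rw [eLpNorm_eq_lintegral_rpow_enorm_toReal (by simpa using hq0) ENNReal.ofReal_ne_top,
    eLpNorm_eq_lintegral_rpow_enorm_toReal (by simpa using hq0) ENNReal.ofReal_ne_top,
    ENNReal.toReal_ofReal hq0.le, one_div, ENNReal.rpow_inv_le_iff hq0,
    ENNReal.mul_rpow_of_nonneg _ _ hq0.le, ← ENNReal.rpow_mul, inv_mul_cancel₀ hq0.ne',
    ENNReal.rpow_one] at h
  simpa only [hcomp] using h

end Slicing

/-! ### Averaging over directions -/

section Rotation

theorem integrableOn_inv_pow_Ioi (m : ℕ) {a : ℝ} (ha : 0 < a) :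
    IntegrableOn (fun t : ℝ => (t ^ (m + 2))⁻¹) (Set.Ioi a) := by
  have h := integrableOn_Ioi_rpow_of_lt (a := -(m + 2 : ℝ)) (c := a) (by
    have : (0 : ℝ) ≤ m := by positivity
    linarith) ha
  refine h.congr_fun (fun t ht => ?_) measurableSet_Ioi
  have ht0 : 0 < t := ha.trans ht
  simp only
  rw [Real.rpow_neg ht0.le]
  norm_cast

theorem integral_inv_pow_Ioi (m : ℕ) {a : ℝ} (ha : 0 < a) :
    ∫ t in Set.Ioi a, (t ^ (m + 2))⁻¹ = (1 / (m + 1)) * (a ^ (m + 1))⁻¹ := by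
  have h := integral_Ioi_rpow_of_lt (a := -(m + 2 : ℝ)) (c := a) (by
    have : (0 : ℝ) ≤ m := by positivity
    linarith) ha
  have e : ∫ t in Set.Ioi a, (t ^ (m + 2))⁻¹ = ∫ t in Set.Ioi a, t ^ (-(m + 2 : ℝ)) := by
    refine setIntegral_congr_fun measurableSet_Ioi fun t ht => ?_
    have ht0 : 0 < t := ha.trans ht
    rw [Real.rpow_neg ht0.le]
    norm_cast
  rw [e, h]
  have : (-(m + 2 : ℝ) + 1) = -((m + 1 : ℕ) : ℝ) := by push_cast; ring
  rw [this, Real.rpow_neg ha.le, Real.rpow_natCast]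
  push_cast
  field_simp

theorem integral_ite_inv_abs_pow (m : ℕ) {a : ℝ} (ha : 0 < a) :
    ∫ t : ℝ, (if a < |t| then (|t| ^ (m + 2))⁻¹ else 0) = (2 / (m + 1)) * (a ^ (m + 1))⁻¹ := by
  have h := integral_comp_abs (f := (Set.Ioi a).indicator fun t : ℝ => (t ^ (m + 2))⁻¹)
  simp only [Set.indicator_apply, Set.mem_Ioi] at h
  rw [h]
  have : ∀ t : ℝ, (if a < t then (t ^ (m + 2))⁻¹ else 0) =
    (Set.Ioi a).indicator (fun t : ℝ => (t ^ (m + 2))⁻¹) t := fun t => by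
      simp [Set.indicator_apply]
  simp only [this]
  rw [setIntegral_indicator measurableSet_Ioi, Set.Ioi_inter_Ioi, sup_eq_right.2 ha.le,
    integral_inv_pow_Ioi m ha]
  ring

theorem integrable_ite_inv_abs_pow (m : ℕ) {a : ℝ} (ha : 0 < a) :
    Integrable (fun t : ℝ => if a < |t| then (|t| ^ (m + 2))⁻¹ else 0) := by
  refine Integrable.of_integral_ne_zero ?_
  rw [integral_ite_inv_abs_pow m ha]
  positivity

variable {n : ℕ}

/-- The kernel `u_j / max(|u|, ε)^(n+1)`, a Lipschitz truncation of the Riesz kernel. -/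
noncomputable def cappedKernel (j : Fin n) (ε : ℝ) (u : EuclideanSpace ℝ (Fin n)) : ℝ :=
  u j * (max ‖u‖ ε ^ (n + 1))⁻¹

/-- The weight `z_j 1_{|z| < 1}`. -/
noncomputable def ballWeight (j : Fin n) (z : EuclideanSpace ℝ (Fin n)) : ℝ :=
  if ‖z‖ < 1 then z j else 0

theorem abs_coord_le (j : Fin n) (z : EuclideanSpace ℝ (Fin n)) : |z j| ≤ ‖z‖ :=
  PiLp.norm_apply_le z j

@[fun_prop]
theorem measurable_coord (j : Fin n) : Measurable fun z : EuclideanSpace ℝ (Fin n) => z j :=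
  (EuclideanSpace.proj (𝕜 := ℝ) j).continuous.measurable

@[fun_prop]
theorem measurable_ballWeight (j : Fin n) : Measurable (ballWeight j) :=
  Measurable.ite (measurableSet_lt measurable_norm measurable_const) (measurable_coord j)
    measurable_const

theorem integral_ballWeight_mul_comp_sub_smul {f : EuclideanSpace ℝ (Fin n) → ℝ} (j : Fin n)
    (x : EuclideanSpace ℝ (Fin n)) {t : ℝ} (ht : t ≠ 0) :
    ∫ z, ballWeight j z * f (x - t • z) =
      ∫ u, (if ‖u‖ < |t| then u j * t⁻¹ * (|t| ^ n)⁻¹ * f (x - u) else 0) := by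
  have h := Measure.integral_comp_smul (volume : Measure (EuclideanSpace ℝ (Fin n)))
    (fun u => ballWeight j (t⁻¹ • u) * f (x - u)) t
  simp only [smul_smul, inv_mul_cancel₀ ht, one_smul, finrank_euclideanSpace, Fintype.card_fin,
    smul_eq_mul] at h
  rw [h, ← integral_const_mul]
  refine integral_congr_ae (Eventually.of_forall fun u => ?_)
  have e : ‖t⁻¹ • u‖ < 1 ↔ ‖u‖ < |t| := by
    rw [norm_smul, norm_inv, Real.norm_eq_abs, inv_mul_lt_iff₀ (abs_pos.2 ht), mul_one]
  simp only [ballWeight, e]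
  split_ifs
  · rw [abs_inv, abs_pow, PiLp.smul_apply, smul_eq_mul]; ring
  · simp

/-- **Method of rotations**: the average of the directional Hilbert transforms against
`z_j 1_{|z| < 1}` is, up to a constant, convolution with the capped Riesz kernel. Integrating over
the ball instead of the sphere avoids polar coordinates and is what produces the cap. -/
theorem integral_ballWeight_dirHilbert {f : EuclideanSpace ℝ (Fin n) → ℝ} (hf : IsBoundedSupp f)
    (j : Fin n) {ε : ℝ} (hε : 0 < ε) (x : EuclideanSpace ℝ (Fin n)) :
    ∫ z, ballWeight j z • dirHilbert ε f z x =
      (2 / (n + 1)) * ∫ u, cappedKernel j ε u • f (x - u) := by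
  obtain ⟨B, hB⟩ := hf.exists_bound
  obtain ⟨N, hN⟩ := hf.exists_supp
  have hfm := hf.measurable
  have hB0 : 0 ≤ B := (norm_nonneg _).trans (hB 0)
  set N' := |N| + ‖x‖ with hN'
  have hN'0 : 0 ≤ N' := by positivity
  have hk : Integrable (fun t : ℝ => if ε < |t| then (|t| ^ (0 + 2))⁻¹ else 0) :=
    integrable_ite_inv_abs_pow 0 hε
  have hball : Integrable (fun z : EuclideanSpace ℝ (Fin n) =>
      (Metric.ball (0 : EuclideanSpace ℝ (Fin n)) 1).indicator (fun _ => (B * N' : ℝ)) z) :=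
    (integrable_indicator_iff measurableSet_ball).2
      (integrableOn_const measure_ball_lt_top.ne)
  have swap1 : ∫ z, ballWeight j z • dirHilbert ε f z x =
      ∫ t, ∫ z, ballWeight j z * (hilbertKernel ε t * f (x - t • z)) := by
    simp only [dirHilbert, smul_eq_mul, ← integral_const_mul]
    apply integral_integral_swap
    refine (hball.mul_prod hk).mono' (Measurable.aestronglyMeasurable ?_)
      (Eventually.of_forall fun p => ?_)
    · simp only [Function.uncurry_def]; fun_prop
    · obtain ⟨z, t⟩ := p
      simp only [Function.uncurry_apply_pair, norm_mul, Real.norm_eq_abs]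
      unfold ballWeight hilbertKernel
      by_cases hz : ‖z‖ < 1
      · by_cases ht : ε < |t|
        · have ht0 : 0 < |t| := hε.trans ht
          have hmem : z ∈ Metric.ball (0 : EuclideanSpace ℝ (Fin n)) 1 := by simpa using hz
          rw [if_pos hz, if_pos ht, if_pos ht, Set.indicator_of_mem hmem]
          by_cases h0 : f (x - t • z) = 0
          · rw [h0, abs_zero, mul_zero, mul_zero]; positivity
          · have h1 : ‖x - t • z‖ ≤ N := by
              by_contra hcon
              exact h0 (hN _ (not_le.1 hcon))
            have h2 : |t| * ‖z‖ ≤ N' := by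
              rw [← Real.norm_eq_abs, ← norm_smul]
              have := norm_sub_norm_le (t • z) x
              rw [norm_sub_rev] at this
              have := le_abs_self N
              linarith
            have h3 : |z j| ≤ N' * |t|⁻¹ := by
              rw [← div_eq_mul_inv, le_div_iff₀ ht0]
              have := abs_coord_le j z
              nlinarith
            have h4 := hB (x - t • z)
            rw [Real.norm_eq_abs] at h4
            rw [abs_inv]
            calc |z j| * (|t|⁻¹ * |f (x - t • z)|) ≤ (N' * |t|⁻¹) * (|t|⁻¹ * B) := by gcongr
              _ = _ := by rw [zero_add, pow_two, mul_inv]; ring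
        · simp [ht]
      · simp [hz]
  rw [swap1]
  have hinner : ∀ t : ℝ, ∫ z, ballWeight j z * (hilbertKernel ε t * f (x - t • z)) =
      ∫ u : EuclideanSpace ℝ (Fin n), (u j * f (x - u)) *
        (if max ‖u‖ ε < |t| then (|t| ^ (n + 2))⁻¹ else 0) := by
    intro t
    rcases eq_or_ne t 0 with rfl | ht
    · have h0 : hilbertKernel ε 0 = 0 := by simp [hilbertKernel]
      simp [h0]
    · have := integral_ballWeight_mul_comp_sub_smul (f := f) j x ht
      calc _ = hilbertKernel ε t * ∫ z, ballWeight j z * f (x - t • z) := by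
            rw [← integral_const_mul]
            refine integral_congr_ae (Eventually.of_forall fun u => ?_)
            simp only; ring
        _ = _ := by
          rw [this, ← integral_const_mul]
          refine integral_congr_ae (Eventually.of_forall fun u => ?_)
          simp only [hilbertKernel, max_lt_iff]
          by_cases h1 : ‖u‖ < |t| <;> by_cases h2 : ε < |t| <;> simp only [h1, h2, if_true, if_false, and_self,
            and_true, and_false, mul_zero, zero_mul]
          have h3 : t⁻¹ * t⁻¹ = (|t| ^ 2)⁻¹ := by rw [sq_abs, pow_two, mul_inv]
          rw [pow_add, mul_inv, ← h3]; ring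
  simp only [hinner]
  have hu : IsBoundedSupp (fun u : EuclideanSpace ℝ (Fin n) => u j * f (x - u)) := by
    refine ⟨by fun_prop, ⟨N' * B, fun u => ?_⟩, ⟨N', fun u hu => ?_⟩⟩
    · by_cases h0 : f (x - u) = 0
      · rw [h0, mul_zero, norm_zero]; positivity
      · have h1 : ‖x - u‖ ≤ N := by
          by_contra hcon
          exact h0 (hN _ (not_le.1 hcon))
        have := norm_sub_norm_le u x
        rw [norm_sub_rev] at this
        have h2 := le_abs_self N
        rw [norm_mul]
        have h3 := abs_coord_le j u
        gcongr
        · rw [Real.norm_eq_abs]; linarith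
        · exact hB _
    · have := norm_sub_norm_le u x
      rw [norm_sub_rev] at this
      have h2 := le_abs_self N
      rw [hN _ (by linarith), mul_zero]
  rw [integral_integral_swap]
  · rw [← integral_const_mul]
    refine integral_congr_ae (Eventually.of_forall fun u => ?_)
    simp only
    rw [integral_const_mul, integral_ite_inv_abs_pow n (lt_max_of_lt_right hε), cappedKernel,
      smul_eq_mul]
    ring
  · have hk2 := integrable_ite_inv_abs_pow n hε
    refine (hk2.mul_prod hu.integrable.norm).mono' (Measurable.aestronglyMeasurable ?_)
      (Eventually.of_forall fun p => ?_)
    · simp only [Function.uncurry_def]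
      refine Measurable.mul (by fun_prop) (Measurable.ite ?_ (by fun_prop) measurable_const)
      exact measurableSet_lt (by fun_prop) (by fun_prop)
    · obtain ⟨t, u⟩ := p
      simp only [Function.uncurry_apply_pair]
      rw [norm_mul, mul_comm]
      gcongr
      by_cases h : max ‖u‖ ε < |t|
      · rw [if_pos h, if_pos ((le_max_right _ _).trans_lt h), Real.norm_of_nonneg (by positivity)]
      · rw [if_neg h, norm_zero]
        split_ifs <;> positivity

end Rotation

/-! ### Uniform bounds for the truncated Riesz transforms -/

section Truncation

variable {n : ℕ}

/-- The convolution `k * f` of a real kernel with a complex function on `ℝⁿ`. -/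
noncomputable def kernelConv (k : EuclideanSpace ℝ (Fin n) → ℝ) (f : EuclideanSpace ℝ (Fin n) → ℂ)
    (x : EuclideanSpace ℝ (Fin n)) : ℂ :=
  ∫ u, k u • f (x - u)

theorem stronglyMeasurable_kernelConv {k : EuclideanSpace ℝ (Fin n) → ℝ} (hk : Measurable k)
    {f : EuclideanSpace ℝ (Fin n) → ℂ} (hf : Measurable f) :
    StronglyMeasurable (kernelConv k f) := by
  apply StronglyMeasurable.integral_prod_right
  exact Measurable.stronglyMeasurable (by simp only [Function.uncurry_def]; fun_prop)

theorem integrable_smul_comp_sub {k : EuclideanSpace ℝ (Fin n) → ℝ} (hk : Measurable k) {c : ℝ}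
    (hc : ∀ u, ‖k u‖ ≤ c) {f : EuclideanSpace ℝ (Fin n) → ℂ} (hf : Integrable f)
    (x : EuclideanSpace ℝ (Fin n)) : Integrable fun u => k u • f (x - u) :=
  (hf.comp_sub_left x).bdd_smul c hk.aestronglyMeasurable (Eventually.of_forall hc)

/-- **Young's inequality** `L¹ * L^q ⊆ L^q`. -/
theorem eLpNorm_kernelConv_le {q : ℝ} (hq : 1 < q) {k : EuclideanSpace ℝ (Fin n) → ℝ}
    (hk : Measurable k) {f : EuclideanSpace ℝ (Fin n) → ℂ} (hf : Measurable f) :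
    eLpNorm (kernelConv k f) (ENNReal.ofReal q) volume ≤
      (∫⁻ u, ‖k u‖ₑ) * eLpNorm f (ENNReal.ofReal q) volume := by
  refine eLpNorm_integral_smul_le (w := k) (G := fun u x => f (x - u)) hq hk ?_ ?_
  · exact Measurable.stronglyMeasurable (by simp only [Function.uncurry_def]; fun_prop)
  · intro s _
    exact (eLpNorm_comp_sub_right s _ hf.aestronglyMeasurable).le

@[fun_prop]
theorem measurable_cappedKernel (j : Fin n) (ε : ℝ) : Measurable (cappedKernel j ε) := by
  unfold cappedKernel; fun_prop

theorem norm_cappedKernel_le (j : Fin n) {ε : ℝ} (hε : 0 < ε) (u : EuclideanSpace ℝ (Fin n)) :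
    ‖cappedKernel j ε u‖ ≤ (ε ^ n)⁻¹ := by
  have hm : 0 < max ‖u‖ ε := lt_max_of_lt_right hε
  rw [cappedKernel, norm_mul, norm_inv, norm_pow, Real.norm_of_nonneg hm.le, Real.norm_eq_abs]
  calc |u j| * (max ‖u‖ ε ^ (n + 1))⁻¹ ≤ max ‖u‖ ε * (max ‖u‖ ε ^ (n + 1))⁻¹ := by
        gcongr
        exact (abs_coord_le j u).trans (le_max_left _ _)
    _ = (max ‖u‖ ε ^ n)⁻¹ := by field_simp; ring
    _ ≤ _ := by
        gcongr
        exact le_max_right _ _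

theorem lintegral_enorm_ballWeight_le (j : Fin n) :
    ∫⁻ z, ‖ballWeight j z‖ₑ ≤ volume (Metric.ball (0 : EuclideanSpace ℝ (Fin n)) 1) := by
  rw [← lintegral_indicator_one measurableSet_ball]
  refine lintegral_mono fun z => ?_
  unfold ballWeight
  split_ifs with h
  · rw [Set.indicator_of_mem (by simpa using h), Pi.one_apply, ← enorm_one (G := ℝ),
      enorm_le_iff_norm_le, norm_one]
    exact (abs_coord_le j z).trans h.le
  · simp

/-- The method of rotations, for real bounded functions with bounded support. -/
theorem exists_eLpNorm_cappedKernel_real_le (n : ℕ) {q : ℝ} (hq : 1 < q) :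
    ∃ C : ℝ≥0, ∀ (j : Fin n) (f : EuclideanSpace ℝ (Fin n) → ℝ), IsBoundedSupp f →
      ∀ ε : ℝ, 0 < ε →
      eLpNorm (fun x => ∫ u, cappedKernel j ε u • f (x - u)) (ENNReal.ofReal q) volume ≤
        C * eLpNorm f (ENNReal.ofReal q) volume := by
  obtain ⟨C, hC⟩ := exists_eLpNorm_truncHilbert_le hq
  set C' : ℝ≥0∞ := ‖((n : ℝ) + 1) / 2‖ₑ * (volume (Metric.ball (0 : EuclideanSpace ℝ (Fin n)) 1) * C)
    with hC'
  have hC't : C' ≠ ∞ := ENNReal.mul_ne_top enorm_ne_top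
    (ENNReal.mul_ne_top measure_ball_lt_top.ne ENNReal.coe_ne_top)
  refine ⟨C'.toNNReal, fun j f hf ε hε => ?_⟩
  rw [ENNReal.coe_toNNReal hC't]
  have e : (fun x => ∫ u, cappedKernel j ε u • f (x - u)) =
      (((n : ℝ) + 1) / 2) • fun x => ∫ z, ballWeight j z • dirHilbert ε f z x := by
    ext x
    rw [Pi.smul_apply, integral_ballWeight_dirHilbert hf j hε x, smul_eq_mul]
    field_simp
  rw [e, eLpNorm_const_smul, hC', mul_assoc]
  gcongr
  refine (eLpNorm_integral_smul_le hq (measurable_ballWeight j)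
    (stronglyMeasurable_dirHilbert ε hf.measurable) (C := C * eLpNorm f (ENNReal.ofReal q) volume)
    fun z hz => ?_).trans ?_
  · refine eLpNorm_dirHilbert_le hq hC hf hε ?_
    rintro rfl
    simp [ballWeight] at hz
  · rw [mul_assoc]
    gcongr
    exact lintegral_enorm_ballWeight_le j

/-- The bound for the capped kernel extends to complex integrable functions by Fatou's lemma. -/
theorem exists_eLpNorm_cappedKernel_le (n : ℕ) {q : ℝ} (hq : 1 < q) :
    ∃ C : ℝ≥0, ∀ (j : Fin n) (f : EuclideanSpace ℝ (Fin n) → ℂ), Measurable f → Integrable f →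
      ∀ ε : ℝ, 0 < ε →
      eLpNorm (kernelConv (cappedKernel j ε) f) (ENNReal.ofReal q) volume ≤
        C * eLpNorm f (ENNReal.ofReal q) volume := by
  obtain ⟨C, hC⟩ := exists_eLpNorm_cappedKernel_real_le n hq
  have hq1 : 1 ≤ ENNReal.ofReal q := by simpa using hq.le
  refine ⟨2 * C, fun j f hf hfi ε hε => ?_⟩
  -- bounded functions with bounded support
  have hbdd : ∀ g : EuclideanSpace ℝ (Fin n) → ℂ, IsBoundedSupp g →
      eLpNorm (kernelConv (cappedKernel j ε) g) (ENNReal.ofReal q) volume ≤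
        2 * C * eLpNorm g (ENNReal.ofReal q) volume := by
    intro g hg
    obtain ⟨B, hB⟩ := hg.exists_bound
    obtain ⟨N, hN⟩ := hg.exists_supp
    have hre : IsBoundedSupp fun x => (g x).re :=
      ⟨Complex.measurable_re.comp hg.measurable, ⟨B, fun x => (Complex.abs_re_le_norm _).trans (hB x)⟩,
        ⟨N, fun x hx => by simp [hN x hx]⟩⟩
    have him : IsBoundedSupp fun x => (g x).im :=
      ⟨Complex.measurable_im.comp hg.measurable, ⟨B, fun x => (Complex.abs_im_le_norm _).trans (hB x)⟩,
        ⟨N, fun x hx => by simp [hN x hx]⟩⟩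
    have hint := fun x => integrable_smul_comp_sub (measurable_cappedKernel j ε)
      (norm_cappedKernel_le j hε) hg.integrable x
    have e1 : ∀ x, (kernelConv (cappedKernel j ε) g x).re =
        ∫ u, cappedKernel j ε u • (g (x - u)).re := fun x => by
      have := Complex.reCLM.integral_comp_comm (hint x)
      simpa [kernelConv] using this.symm
    have e2 : ∀ x, (kernelConv (cappedKernel j ε) g x).im =
        ∫ u, cappedKernel j ε u • (g (x - u)).im := fun x => by
      have := Complex.imCLM.integral_comp_comm (hint x)
      simpa [kernelConv] using this.symm
    have hm := stronglyMeasurable_kernelConv (measurable_cappedKernel j ε) hg.measurable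
    have h1 := hC j _ hre ε hε
    have h2 := hC j _ him ε hε
    simp only [← e1, ← e2] at h1 h2
    have h3 : eLpNorm (fun x => (g x).re) (ENNReal.ofReal q) volume ≤
        eLpNorm g (ENNReal.ofReal q) volume := eLpNorm_mono fun x => Complex.abs_re_le_norm _
    have h4 : eLpNorm (fun x => (g x).im) (ENNReal.ofReal q) volume ≤
        eLpNorm g (ENNReal.ofReal q) volume := eLpNorm_mono fun x => Complex.abs_im_le_norm _
    calc eLpNorm (kernelConv (cappedKernel j ε) g) (ENNReal.ofReal q) volume
        ≤ eLpNorm (fun x => ‖(kernelConv (cappedKernel j ε) g x).re‖ +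
            ‖(kernelConv (cappedKernel j ε) g x).im‖) (ENNReal.ofReal q) volume := by
          refine eLpNorm_mono fun x => ?_
          rw [Real.norm_of_nonneg (r := ‖_‖ + ‖_‖) (by positivity)]
          exact Complex.norm_le_abs_re_add_abs_im _
      _ ≤ eLpNorm (fun x => ‖(kernelConv (cappedKernel j ε) g x).re‖) (ENNReal.ofReal q) volume +
            eLpNorm (fun x => ‖(kernelConv (cappedKernel j ε) g x).im‖) (ENNReal.ofReal q) volume :=
          eLpNorm_add_le (Complex.measurable_re.comp hm.measurable).norm.aestronglyMeasurable
            (Complex.measurable_im.comp hm.measurable).norm.aestronglyMeasurable hq1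
      _ = eLpNorm (fun x => (kernelConv (cappedKernel j ε) g x).re) (ENNReal.ofReal q) volume +
            eLpNorm (fun x => (kernelConv (cappedKernel j ε) g x).im) (ENNReal.ofReal q) volume := by
          rw [eLpNorm_norm, eLpNorm_norm]
      _ ≤ C * eLpNorm g (ENNReal.ofReal q) volume + C * eLpNorm g (ENNReal.ofReal q) volume := by
          gcongr
          · exact h1.trans (by gcongr)
          · exact h2.trans (by gcongr)
      _ = _ := by ring
  -- the general case, by truncation and Fatou's lemma
  set s : ℕ → Set (EuclideanSpace ℝ (Fin n)) := fun N => {x | ‖x‖ ≤ N ∧ ‖f x‖ ≤ N} with hs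
  have hsm : ∀ N, MeasurableSet (s N) := fun N =>
    (measurableSet_le measurable_norm measurable_const).inter
      (measurableSet_le hf.norm measurable_const)
  have hsb : ∀ N, IsBoundedSupp ((s N).indicator f) := by
    intro N
    refine ⟨hf.indicator (hsm N), ⟨N, fun x => ?_⟩, ⟨N, fun x hx => ?_⟩⟩
    · by_cases h : x ∈ s N
      · rw [Set.indicator_of_mem h]; exact h.2
      · rw [Set.indicator_of_notMem h]; simp
    · exact Set.indicator_of_notMem (fun h => absurd h.1 (not_le.2 hx)) _
  have hle : ∀ N x, ‖(s N).indicator f x‖ ≤ ‖f x‖ := fun N x => norm_indicator_le_norm_self _ _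
  have hlim : ∀ x, ∀ᶠ N : ℕ in atTop, (s N).indicator f x = f x := by
    intro x
    filter_upwards [tendsto_natCast_atTop_atTop.eventually_ge_atTop ‖x‖,
      tendsto_natCast_atTop_atTop.eventually_ge_atTop ‖f x‖] with N h1 h2
    exact Set.indicator_of_mem (show x ∈ s N from ⟨h1, h2⟩) _
  push_cast
  refine Lp.eLpNorm_le_of_ae_tendsto (u := atTop)
    (f := fun N : ℕ => kernelConv (cappedKernel j ε) ((s N).indicator f)) ?_ ?_ ?_
  · refine Eventually.of_forall fun N => (hbdd _ (hsb N)).trans ?_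
    gcongr
    exact eLpNorm_mono (hle N)
  · exact fun N => (stronglyMeasurable_kernelConv (measurable_cappedKernel j ε)
      (hsb N).measurable).aestronglyMeasurable
  · refine Eventually.of_forall fun x => ?_
    refine tendsto_integral_of_dominated_convergence
      (fun u => ‖cappedKernel j ε u • f (x - u)‖) (fun N => ?_) ?_ (fun N => ?_) ?_
    · exact (integrable_smul_comp_sub (measurable_cappedKernel j ε) (norm_cappedKernel_le j hε)
        (hsb N).integrable x).aestronglyMeasurable
    · exact (integrable_smul_comp_sub (measurable_cappedKernel j ε) (norm_cappedKernel_le j hε)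
        hfi x).norm
    · refine Eventually.of_forall fun u => ?_
      rw [norm_smul, norm_smul]
      gcongr
      exact hle N _
    · refine Eventually.of_forall fun u => tendsto_const_nhds.congr' ?_
      filter_upwards [hlim (x - u)] with N hN
      rw [hN]

/-- The sharply truncated Riesz kernel `u_j / |u|^(n+1) 1_{|u| > ε}`. -/
noncomputable def truncKernel (j : Fin n) (ε : ℝ) (u : EuclideanSpace ℝ (Fin n)) : ℝ :=
  if ε < ‖u‖ then u j * (‖u‖ ^ (n + 1))⁻¹ else 0

@[fun_prop]
theorem measurable_truncKernel (j : Fin n) (ε : ℝ) : Measurable (truncKernel j ε) :=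
  Measurable.ite (measurableSet_lt measurable_const measurable_norm) (by fun_prop) measurable_const

theorem norm_coord_mul_inv_pow_le (j : Fin n) (u : EuclideanSpace ℝ (Fin n)) :
    ‖u j * (‖u‖ ^ (n + 1))⁻¹‖ ≤ (‖u‖ ^ n)⁻¹ := by
  rcases eq_or_ne u 0 with rfl | hu
  · simp
  have hu' : 0 < ‖u‖ := norm_pos_iff.2 hu
  rw [norm_mul, norm_inv, norm_pow, norm_norm, Real.norm_eq_abs]
  calc |u j| * (‖u‖ ^ (n + 1))⁻¹ ≤ ‖u‖ * (‖u‖ ^ (n + 1))⁻¹ := by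
        gcongr
        exact abs_coord_le j u
    _ = _ := by field_simp; ring

theorem norm_truncKernel_le' (j : Fin n) (ε : ℝ) (u : EuclideanSpace ℝ (Fin n)) :
    ‖truncKernel j ε u‖ ≤ (‖u‖ ^ n)⁻¹ := by
  unfold truncKernel
  split_ifs
  · exact norm_coord_mul_inv_pow_le j u
  · rw [norm_zero]; positivity

theorem norm_truncKernel_le (j : Fin n) {ε : ℝ} (hε : 0 < ε) (u : EuclideanSpace ℝ (Fin n)) :
    ‖truncKernel j ε u‖ ≤ (ε ^ n)⁻¹ := by
  by_cases h : ε < ‖u‖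
  · refine (norm_truncKernel_le' j ε u).trans ?_
    gcongr
  · rw [truncKernel, if_neg h, norm_zero]; positivity

/-- Sharp and capped truncations differ by a kernel whose `L¹` norm is bounded independently of
`ε`. -/
theorem lintegral_enorm_truncKernel_sub_le (j : Fin n) {ε : ℝ} (hε : 0 < ε) :
    ∫⁻ u, ‖truncKernel j ε u - cappedKernel j ε u‖ₑ ≤
      volume (Metric.ball (0 : EuclideanSpace ℝ (Fin n)) 1) := by
  have hle : ∀ u : EuclideanSpace ℝ (Fin n), ‖truncKernel j ε u - cappedKernel j ε u‖ₑ ≤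
      (Metric.closedBall (0 : EuclideanSpace ℝ (Fin n)) ε).indicator
        (fun _ => ENNReal.ofReal ((ε ^ n)⁻¹)) u := by
    intro u
    by_cases h : ε < ‖u‖
    · rw [truncKernel, if_pos h, cappedKernel, max_eq_left h.le, sub_self, enorm_zero]
      exact zero_le
    · rw [Set.indicator_of_mem (by simpa using h), truncKernel, if_neg h, zero_sub, enorm_neg,
        ← ofReal_norm]
      exact ENNReal.ofReal_le_ofReal (norm_cappedKernel_le j hε u)
  refine (lintegral_mono hle).trans ?_
  rw [lintegral_indicator_const Metric.isClosed_closedBall.measurableSet,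
    Measure.addHaar_closedBall _ _ hε.le, finrank_euclideanSpace, Fintype.card_fin, ← mul_assoc,
    ← ENNReal.ofReal_mul (by positivity), inv_mul_cancel₀ (by positivity), ENNReal.ofReal_one,
    one_mul]

/-- The uniform `L^q` bound for truncated Riesz transforms. -/
theorem exists_eLpNorm_truncKernel_le (n : ℕ) {q : ℝ} (hq : 1 < q) :
    ∃ C : ℝ≥0, ∀ (j : Fin n) (f : EuclideanSpace ℝ (Fin n) → ℂ), Measurable f → Integrable f →
      ∀ ε : ℝ, 0 < ε →
      eLpNorm (kernelConv (truncKernel j ε) f) (ENNReal.ofReal q) volume ≤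
        C * eLpNorm f (ENNReal.ofReal q) volume := by
  obtain ⟨C, hC⟩ := exists_eLpNorm_cappedKernel_le n hq
  have hq1 : 1 ≤ ENNReal.ofReal q := by simpa using hq.le
  have hV : volume (Metric.ball (0 : EuclideanSpace ℝ (Fin n)) 1) ≠ ∞ := measure_ball_lt_top.ne
  refine ⟨(volume (Metric.ball (0 : EuclideanSpace ℝ (Fin n)) 1)).toNNReal + C,
    fun j f hf hfi ε hε => ?_⟩
  have hd : kernelConv (truncKernel j ε) f =
      kernelConv (fun u => truncKernel j ε u - cappedKernel j ε u) f +
        kernelConv (cappedKernel j ε) f := by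
    ext x
    have i1 := integrable_smul_comp_sub (measurable_truncKernel j ε) (norm_truncKernel_le j hε) hfi x
    have i2 := integrable_smul_comp_sub (measurable_cappedKernel j ε) (norm_cappedKernel_le j hε)
      hfi x
    simp only [Pi.add_apply, kernelConv, sub_smul]
    rw [integral_sub i1 i2, sub_add_cancel]
  have hk : Measurable fun u => truncKernel j ε u - cappedKernel j ε u := by fun_prop
  rw [hd, ENNReal.coe_add, ENNReal.coe_toNNReal hV, add_mul]
  refine (eLpNorm_add_le (stronglyMeasurable_kernelConv hk hf).aestronglyMeasurable
    (stronglyMeasurable_kernelConv (measurable_cappedKernel j ε) hf).aestronglyMeasurable hq1).trans ?_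
  gcongr
  · refine (eLpNorm_kernelConv_le hq hk hf).trans ?_
    gcongr
    exact lintegral_enorm_truncKernel_sub_le j hε
  · exact hC j f hf hfi ε hε

end Truncation

/-! ### The local part of the fractional kernel -/

section Fractional

variable {n : ℕ}

@[fun_prop]
theorem measurable_kernel (j : Fin n) (β : ℝ) : Measurable (kernel j β) := by
  unfold kernel; fun_prop

theorem norm_kernel_le (j : Fin n) {β : ℝ} (u : EuclideanSpace ℝ (Fin n)) :
    ‖kernel j β u‖ ≤ ‖u‖ ^ (β - n) := by
  rcases eq_or_ne u 0 with rfl | hu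
  · simp only [kernel, PiLp.zero_apply, zero_div, norm_zero]
    positivity
  have hu' : 0 < ‖u‖ := norm_pos_iff.2 hu
  rw [kernel, norm_div, Real.norm_of_nonneg (r := ‖u‖ ^ _) (by positivity), Real.norm_eq_abs,
    div_le_iff₀ (by positivity), ← Real.rpow_add hu']
  have : β - n + (n + 1 - β) = 1 := by ring
  rw [this, Real.rpow_one]
  exact abs_coord_le j u

theorem integrableOn_norm_rpow_ball (hn : 1 ≤ n) {γ : ℝ} (hγ : 0 < γ) :
    IntegrableOn (fun u : EuclideanSpace ℝ (Fin n) => ‖u‖ ^ (γ - n)) (Metric.ball 0 1) := by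
  have : Nonempty (Fin n) := ⟨⟨0, hn⟩⟩
  refine (integrableOn_fun_norm_addHaar volume (f := fun r : ℝ => r ^ (γ - n)) (r := 1)).2 ?_
  have h : IntegrableOn (fun r : ℝ => r ^ (γ - 1)) (Set.Ioo 0 1) := by
    rw [intervalIntegral.integrableOn_Ioo_rpow_iff one_pos]
    linarith
  refine h.congr_fun (fun r hr => ?_) measurableSet_Ioo
  rw [finrank_euclideanSpace, Fintype.card_fin, smul_eq_mul, ← Real.rpow_natCast,
    ← Real.rpow_add hr.1, Nat.cast_sub hn, Nat.cast_one,
    show (n : ℝ) - 1 + (γ - n) = γ - 1 by ring]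

/-- Riesz potentials of integrable functions converge absolutely almost everywhere. -/
theorem ae_integrable_norm_rpow_mul (hn : 1 ≤ n) {γ : ℝ} (hγ : 0 < γ) (hγn : γ ≤ n)
    {f : EuclideanSpace ℝ (Fin n) → ℂ} (hf : Measurable f) (hfi : Integrable f) :
    ∀ᵐ x, Integrable fun u : EuclideanSpace ℝ (Fin n) => ‖u‖ ^ (γ - n) * ‖f (x - u)‖ := by
  have h1 : Integrable ((Metric.ball (0 : EuclideanSpace ℝ (Fin n)) 1).indicator
      fun u => ‖u‖ ^ (γ - n)) :=
    (integrable_indicator_iff measurableSet_ball).2 (integrableOn_norm_rpow_ball hn hγ)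
  have h2 := h1.ae_convolution_exists (ContinuousLinearMap.mul ℝ ℝ) hfi.norm
  filter_upwards [h2] with x hx
  have hx' : Integrable fun u => (Metric.ball (0 : EuclideanSpace ℝ (Fin n)) 1).indicator
      (fun u => ‖u‖ ^ (γ - n)) u * ‖f (x - u)‖ := hx
  have h3 : Integrable fun u => ‖f (x - u)‖ := hfi.norm.comp_sub_left x
  refine (hx'.add h3).mono' (Measurable.aestronglyMeasurable (by fun_prop))
    (Eventually.of_forall fun u => ?_)
  rw [Real.norm_of_nonneg (by positivity), Pi.add_apply]
  by_cases hu : u ∈ Metric.ball (0 : EuclideanSpace ℝ (Fin n)) 1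
  · rw [Set.indicator_of_mem hu]
    have := norm_nonneg (f (x - u))
    linarith
  · rw [Set.indicator_of_notMem hu, zero_mul, zero_add]
    have h1u : 1 ≤ ‖u‖ := by simpa using hu
    have : ‖u‖ ^ (γ - n) ≤ 1 := Real.rpow_le_one_of_one_le_of_nonpos h1u (by linarith)
    nlinarith [norm_nonneg (f (x - u))]

/-- The weight `β s^(β-1) 1_{0 < s ≤ R}`. -/
noncomputable def powWeight (β R s : ℝ) : ℝ := (Set.Ioc 0 R).indicator (fun s => β * s ^ (β - 1)) s

@[fun_prop]
theorem measurable_powWeight (β R : ℝ) : Measurable (powWeight β R) :=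
  Measurable.indicator (by fun_prop) measurableSet_Ioc

theorem powWeight_nonneg {β R : ℝ} (hβ : 0 < β) (s : ℝ) : 0 ≤ powWeight β R s := by
  refine Set.indicator_nonneg (fun s hs => ?_) s
  have := hs.1
  positivity

theorem integrable_powWeight {β R : ℝ} (hβ : 0 < β) (hR : 0 < R) : Integrable (powWeight β R) := by
  refine (integrable_indicator_iff measurableSet_Ioc).2 ?_
  have := (intervalIntegral.intervalIntegrable_rpow' (a := 0) (b := R)
    (by linarith : -1 < β - 1)).const_mul β
  rwa [intervalIntegrable_iff_integrableOn_Ioc_of_le hR.le] at this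

theorem setIntegral_Ioc_powWeight {β R : ℝ} (hβ : 0 < β) (hR : 0 < R) :
    ∫ s in Set.Ioc 0 R, β * s ^ (β - 1) = R ^ β := by
  rw [← intervalIntegral.integral_of_le hR.le, intervalIntegral.integral_const_mul,
    integral_rpow (Or.inl (by linarith))]
  rw [sub_add_cancel, Real.zero_rpow hβ.ne']
  field_simp
  ring

theorem lintegral_enorm_powWeight {β R : ℝ} (hβ : 0 < β) (hR : 0 < R) :
    ∫⁻ s, ‖powWeight β R s‖ₑ = ENNReal.ofReal (R ^ β) := by
  rw [← ofReal_integral_norm_eq_lintegral_enorm (integrable_powWeight hβ hR),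
    ← setIntegral_Ioc_powWeight hβ hR]
  congr 1
  simp only [Real.norm_of_nonneg (powWeight_nonneg hβ _)]
  exact integral_indicator measurableSet_Ioc

/-- The truncated kernels of radius `s < r` are those that see a point at distance `r`. -/
theorem integral_powWeight_lt {β R r : ℝ} (hβ : 0 < β) (hR : 0 < R) (hr : 0 < r) :
    ∫ s, powWeight β R s * (if s < r then 1 else 0) = min r R ^ β := by
  have hm : 0 < min r R := lt_min hr hR
  have e : ∀ s, powWeight β R s * (if s < r then 1 else 0) =
      (Set.Ioc 0 R ∩ Set.Iio r).indicator (fun s => β * s ^ (β - 1)) s := by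
    intro s
    rw [powWeight]
    by_cases h1 : s ∈ Set.Ioc 0 R <;> by_cases h2 : s < r <;>
      simp [h1, h2]
  simp only [e]
  rw [integral_indicator (measurableSet_Ioc.inter measurableSet_Iio)]
  rcases le_or_gt r R with h | h
  · have : Set.Ioc 0 R ∩ Set.Iio r = Set.Ioo 0 r := by
      ext s
      simp only [Set.mem_inter_iff, Set.mem_Ioc, Set.mem_Iio, Set.mem_Ioo]
      constructor
      · rintro ⟨⟨h1, h2⟩, h3⟩; exact ⟨h1, h3⟩
      · rintro ⟨h1, h2⟩; exact ⟨⟨h1, h2.le.trans h⟩, h2⟩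
    rw [this, min_eq_left h, ← integral_Ioc_eq_integral_Ioo, setIntegral_Ioc_powWeight hβ hr]
  · have : Set.Ioc 0 R ∩ Set.Iio r = Set.Ioc 0 R := by
      ext s
      simp only [Set.mem_inter_iff, Set.mem_Ioc, Set.mem_Iio]
      exact ⟨fun h => h.1, fun h' => ⟨h', h'.2.trans_lt h⟩⟩
    rw [this, min_eq_right h.le, setIntegral_Ioc_powWeight hβ hR]

/-- The part of the fractional kernel inside the ball of radius `R`. -/
noncomputable def localKernel (j : Fin n) (β R : ℝ) (u : EuclideanSpace ℝ (Fin n)) : ℝ :=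
  if ‖u‖ ≤ R then kernel j β u else 0

/-- The part of the fractional kernel outside the ball of radius `R`. -/
noncomputable def tailKernel (j : Fin n) (β R : ℝ) (u : EuclideanSpace ℝ (Fin n)) : ℝ :=
  if R < ‖u‖ then kernel j β u else 0

@[fun_prop]
theorem measurable_localKernel (j : Fin n) (β R : ℝ) : Measurable (localKernel j β R) :=
  Measurable.ite (measurableSet_le measurable_norm measurable_const) (by fun_prop) measurable_const

@[fun_prop]
theorem measurable_tailKernel (j : Fin n) (β R : ℝ) : Measurable (tailKernel j β R) :=
  Measurable.ite (measurableSet_lt measurable_const measurable_norm) (by fun_prop) measurable_const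

/-- The local fractional kernel is a superposition of truncated Riesz kernels. -/
theorem localKernel_eq (j : Fin n) {β R : ℝ} (hβ : 0 < β) (hR : 0 < R)
    (u : EuclideanSpace ℝ (Fin n)) :
    localKernel j β R u =
      (∫ s, powWeight β R s * truncKernel j s u) - R ^ β * truncKernel j R u := by
  rcases eq_or_ne u 0 with rfl | hu
  · simp [localKernel, truncKernel, kernel]
  have hu' : 0 < ‖u‖ := norm_pos_iff.2 hu
  have e : ∀ s, powWeight β R s * truncKernel j s u =
      (powWeight β R s * (if s < ‖u‖ then 1 else 0)) * (u j * (‖u‖ ^ (n + 1))⁻¹) := by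
    intro s
    unfold truncKernel
    split_ifs <;> ring
  simp only [e]
  rw [integral_mul_const, integral_powWeight_lt hβ hR hu', localKernel, truncKernel]
  rcases le_or_gt ‖u‖ R with h | h
  · rw [if_pos h, if_neg (not_lt.2 h), min_eq_left h, mul_zero, sub_zero, kernel]
    rw [Real.rpow_sub hu', show ((n : ℝ) + 1) = ((n + 1 : ℕ) : ℝ) by push_cast; ring,
      Real.rpow_natCast]
    field_simp
  · rw [if_neg (not_le.2 h), if_pos h, min_eq_right h.le]
    ring

@[fun_prop]
theorem measurable_truncKernel_comp {α : Type*} [MeasurableSpace α] (j : Fin n) {s : α → ℝ}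
    {u : α → EuclideanSpace ℝ (Fin n)} (hs : Measurable s) (hu : Measurable u) :
    Measurable fun a => truncKernel j (s a) (u a) :=
  Measurable.ite (measurableSet_lt hs hu.norm) (by fun_prop) measurable_const

theorem stronglyMeasurable_kernelConv_truncKernel (j : Fin n)
    {f : EuclideanSpace ℝ (Fin n) → ℂ} (hf : Measurable f) :
    StronglyMeasurable (Function.uncurry fun s => kernelConv (truncKernel j s) f) := by
  have h : StronglyMeasurable (fun p : (ℝ × EuclideanSpace ℝ (Fin n)) × EuclideanSpace ℝ (Fin n) =>
      truncKernel j p.1.1 p.2 • f (p.1.2 - p.2)) := by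
    exact Measurable.stronglyMeasurable (by fun_prop)
  exact h.integral_prod_right

/-- Trading half of the power of `s` for a power of `‖u‖` gives an integrable majorant in `(s, u)`:
on the support of the truncated kernel `s < ‖u‖`. -/
theorem norm_powWeight_mul_truncKernel_le (j : Fin n) {β R : ℝ} (hβ : 0 < β) (s : ℝ)
    (u : EuclideanSpace ℝ (Fin n)) :
    ‖powWeight β R s * truncKernel j s u‖ ≤ 2 * powWeight (β / 2) R s * ‖u‖ ^ (β / 2 - n) := by
  have h0 := powWeight_nonneg (R := R) (half_pos hβ) s
  by_cases hs : s ∈ Set.Ioc 0 R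
  · have hs0 := hs.1
    by_cases hu : s < ‖u‖
    · have hu' : 0 < ‖u‖ := hs0.trans hu
      rw [norm_mul, Real.norm_of_nonneg (powWeight_nonneg hβ s), powWeight, powWeight,
        Set.indicator_of_mem hs, Set.indicator_of_mem hs]
      have h1 : s ^ (β - 1) = s ^ (β / 2 - 1) * s ^ (β / 2) := by
        rw [← Real.rpow_add hs0]; congr 1; ring
      have h2 : (‖u‖ ^ n)⁻¹ * ‖u‖ ^ (β / 2) = ‖u‖ ^ (β / 2 - n) := by
        rw [Real.rpow_sub hu', Real.rpow_natCast]; field_simp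
      calc β * s ^ (β - 1) * ‖truncKernel j s u‖
          ≤ β * (s ^ (β / 2 - 1) * ‖u‖ ^ (β / 2)) * (‖u‖ ^ n)⁻¹ := by
            rw [h1]
            gcongr
            exact norm_truncKernel_le' j s u
        _ = 2 * (β / 2 * s ^ (β / 2 - 1)) * ‖u‖ ^ (β / 2 - n) := by rw [← h2]; ring
    · rw [truncKernel, if_neg hu, mul_zero, norm_zero]
      positivity
  · rw [powWeight, Set.indicator_of_notMem hs, zero_mul, norm_zero]
    positivity

theorem ae_kernelConv_localKernel_eq (hn : 1 ≤ n) (j : Fin n) {β R : ℝ} (hβ : 0 < β) (hβn : β ≤ n)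
    (hR : 0 < R) {f : EuclideanSpace ℝ (Fin n) → ℂ} (hf : Measurable f) (hfi : Integrable f) :
    ∀ᵐ x, kernelConv (localKernel j β R) f x =
      (∫ s, powWeight β R s • kernelConv (truncKernel j s) f x) -
        R ^ β • kernelConv (truncKernel j R) f x := by
  have hβ2 := half_pos hβ
  filter_upwards [ae_integrable_norm_rpow_mul hn hβ2 (by linarith) hf hfi] with x hx
  have hH : Integrable (Function.uncurry fun (s : ℝ) (u : EuclideanSpace ℝ (Fin n)) =>
      (powWeight β R s * truncKernel j s u) • f (x - u)) (volume.prod volume) := by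
    refine (((integrable_powWeight hβ2 hR).const_mul 2).mul_prod hx).mono'
      (Measurable.aestronglyMeasurable ?_) (Eventually.of_forall fun p => ?_)
    · simp only [Function.uncurry_def]
      fun_prop
    · obtain ⟨s, u⟩ := p
      simp only [Function.uncurry_apply_pair]
      rw [norm_smul, ← mul_assoc]
      exact mul_le_mul_of_nonneg_right (norm_powWeight_mul_truncKernel_le j hβ s u) (norm_nonneg _)
  have e1 : ∀ s, powWeight β R s • kernelConv (truncKernel j s) f x =
      ∫ u, (powWeight β R s * truncKernel j s u) • f (x - u) := by
    intro s
    rw [kernelConv, ← integral_smul]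
    simp only [smul_smul]
  simp only [e1]
  rw [integral_integral_swap hH, kernelConv, kernelConv, ← integral_smul, ← integral_sub]
  · refine integral_congr_ae (Eventually.of_forall fun u => ?_)
    simp only
    rw [localKernel_eq j hβ hR, sub_smul, smul_smul, integral_smul_const]
  · exact hH.integral_prod_right
  · exact (integrable_smul_comp_sub (measurable_truncKernel j R) (norm_truncKernel_le j hR) hfi
      x).smul _

/-- The local part inherits the uniform bound of the truncated Riesz transforms; the total weight
is `R ^ β`. -/
theorem eLpNorm_kernelConv_localKernel_le (hn : 1 ≤ n) {q : ℝ} (hq : 1 < q) {C : ℝ≥0}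
    (hC : ∀ (j : Fin n) (f : EuclideanSpace ℝ (Fin n) → ℂ), Measurable f → Integrable f →
      ∀ ε : ℝ, 0 < ε →
      eLpNorm (kernelConv (truncKernel j ε) f) (ENNReal.ofReal q) volume ≤
        C * eLpNorm f (ENNReal.ofReal q) volume)
    (j : Fin n) {β R : ℝ} (hβ : 0 < β) (hβn : β ≤ n)
    (hR : 0 < R) {f : EuclideanSpace ℝ (Fin n) → ℂ} (hf : Measurable f) (hfi : Integrable f) :
    eLpNorm (kernelConv (localKernel j β R) f) (ENNReal.ofReal q) volume ≤
      ENNReal.ofReal (R ^ β) * (2 * C) * eLpNorm f (ENNReal.ofReal q) volume := by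
  have hq1 : 1 ≤ ENNReal.ofReal q := by simpa using hq.le
  have hsm := stronglyMeasurable_kernelConv_truncKernel j hf
  have hm1 : StronglyMeasurable fun x => ∫ s, powWeight β R s • kernelConv (truncKernel j s) f x := by
    apply StronglyMeasurable.integral_prod_right
    have hw : StronglyMeasurable fun p : EuclideanSpace ℝ (Fin n) × ℝ => powWeight β R p.2 :=
      Measurable.stronglyMeasurable (by fun_prop)
    exact hw.smul (hsm.comp_measurable measurable_swap)
  have hm2 : StronglyMeasurable (R ^ β • kernelConv (truncKernel j R) f) :=
    (stronglyMeasurable_kernelConv (measurable_truncKernel j R) hf).const_smul _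
  rw [eLpNorm_congr_ae (ae_kernelConv_localKernel_eq hn j hβ hβn hR hf hfi)]
  refine (eLpNorm_sub_le hm1.aestronglyMeasurable hm2.aestronglyMeasurable hq1).trans ?_
  have h1 := eLpNorm_integral_smul_le (μ := volume) (ν := volume) hq (measurable_powWeight β R) hsm
    (C := C * eLpNorm f (ENNReal.ofReal q) volume) fun s hs => by
      have : s ∈ Set.Ioc 0 R := by
        by_contra hcon
        exact hs (Set.indicator_of_notMem hcon _)
      exact hC j f hf hfi s this.1
  rw [lintegral_enorm_powWeight hβ hR] at h1
  have h2 : eLpNorm (R ^ β • kernelConv (truncKernel j R) f) (ENNReal.ofReal q) volume ≤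
      ENNReal.ofReal (R ^ β) * (C * eLpNorm f (ENNReal.ofReal q) volume) := by
    rw [eLpNorm_const_smul, Real.enorm_of_nonneg (by positivity)]
    gcongr
    exact hC j f hf hfi R hR
  refine (add_le_add h1 h2).trans_eq ?_
  ring

end Fractional

/-! ### The tail of the fractional kernel -/

section Tail

variable {n : ℕ}

/-- **Young's inequality** `L^q * L¹ ⊆ L^q`, with the kernel in `L^q`. -/
theorem eLpNorm_kernelConv_le_mul_eLpNorm_one {q : ℝ} (hq : 1 < q)
    {k : EuclideanSpace ℝ (Fin n) → ℝ}
    (hk : Measurable k) {f : EuclideanSpace ℝ (Fin n) → ℂ} (hf : Measurable f) :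
    eLpNorm (kernelConv k f) (ENNReal.ofReal q) volume ≤
      eLpNorm k (ENNReal.ofReal q) volume * eLpNorm f 1 volume := by
  have h := eLpNorm_integral_smul_le (μ := volume) (ν := volume) hq (w := fun y => ‖f y‖) hf.norm
    (G := fun y x => ‖k (x - y)‖)
    (Measurable.stronglyMeasurable (by simp only [Function.uncurry_def]; fun_prop))
    (C := eLpNorm k (ENNReal.ofReal q) volume)
    (fun y _ => by
      rw [eLpNorm_norm]
      exact (eLpNorm_comp_sub_right y _ hk.aestronglyMeasurable).le)
  have e : ∫⁻ y, ‖(‖f y‖ : ℝ)‖ₑ = eLpNorm f 1 volume := by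
    rw [eLpNorm_one_eq_lintegral_enorm]
    simp only [enorm_norm]
  rw [e] at h
  rw [mul_comm]
  refine (eLpNorm_mono fun x => ?_).trans h
  rw [kernelConv, ← integral_sub_left_eq_self _ volume x]
  simp only [sub_sub_cancel]
  refine (norm_integral_le_integral_norm _).trans ((le_abs_self _).trans_eq ?_)
  rw [Real.norm_eq_abs]
  congr 1
  refine integral_congr_ae (Eventually.of_forall fun y => ?_)
  simp only [norm_smul, smul_eq_mul]
  ring

theorem integral_tail_norm_rpow (hn : 1 ≤ n) {s R : ℝ} (hs : (n : ℝ) < s) (hR : 0 < R) :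
    ∫ u : EuclideanSpace ℝ (Fin n), (Set.Ioi R).indicator (fun r : ℝ => r ^ (-s)) ‖u‖ =
      n * volume.real (Metric.ball (0 : EuclideanSpace ℝ (Fin n)) 1) *
        (R ^ (n - s) / (s - n)) := by
  have : Nonempty (Fin n) := ⟨⟨0, hn⟩⟩
  rw [integral_fun_norm_addHaar, finrank_euclideanSpace, Fintype.card_fin]
  have e : ∀ r : ℝ, r ^ (n - 1) • (Set.Ioi R).indicator (fun r : ℝ => r ^ (-s)) r =
      (Set.Ioi R).indicator (fun r : ℝ => r ^ ((n : ℝ) - s - 1)) r := by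
    intro r
    by_cases h : r ∈ Set.Ioi R
    · have hr : 0 < r := hR.trans h
      rw [Set.indicator_of_mem h, Set.indicator_of_mem h, smul_eq_mul, ← Real.rpow_natCast,
        ← Real.rpow_add hr, Nat.cast_sub hn, Nat.cast_one]
      congr 1; ring
    · rw [Set.indicator_of_notMem h, Set.indicator_of_notMem h, smul_zero]
  simp only [e]
  rw [setIntegral_indicator measurableSet_Ioi, Set.Ioi_inter_Ioi, sup_eq_right.2 hR.le,
    integral_Ioi_rpow_of_lt (by linarith) hR, nsmul_eq_mul, smul_eq_mul, sub_add_cancel, mul_assoc]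
  congr 2
  rw [← neg_sub s (n : ℝ), div_neg, neg_div, neg_neg]

theorem eLpNorm_tailKernel_le (hn : 1 ≤ n) (j : Fin n) {q β R : ℝ} (hq : 1 < q)
    (hD : 0 < n * (q - 1) - β * q) (hR : 0 < R) :
    eLpNorm (tailKernel j β R) (ENNReal.ofReal q) volume ≤
      ENNReal.ofReal ((n * volume.real (Metric.ball (0 : EuclideanSpace ℝ (Fin n)) 1) *
        (R ^ (-(n * (q - 1) - β * q)) / (n * (q - 1) - β * q))) ^ (1 / q)) := by
  have hq0 : 0 < q := by linarith
  have hn0 : (0 : ℝ) < n := by exact_mod_cast hn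
  have hs : (n : ℝ) < (n - β) * q := by linarith
  have h := integral_tail_norm_rpow hn hs hR
  have e1 : (n : ℝ) - (n - β) * q = -(n * (q - 1) - β * q) := by ring
  have e2 : (n - β) * q - (n : ℝ) = n * (q - 1) - β * q := by ring
  rw [e1, e2] at h
  have hV : 0 < volume.real (Metric.ball (0 : EuclideanSpace ℝ (Fin n)) 1) :=
    ENNReal.toReal_pos (Metric.measure_ball_pos _ _ one_pos).ne' measure_ball_lt_top.ne
  have hint : Integrable fun u : EuclideanSpace ℝ (Fin n) =>
      (Set.Ioi R).indicator (fun r : ℝ => r ^ (-((n - β) * q))) ‖u‖ := by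
    refine Integrable.of_integral_ne_zero ?_
    rw [h]; positivity
  rw [eLpNorm_eq_lintegral_rpow_enorm_toReal (by simpa using hq0) ENNReal.ofReal_ne_top,
    ENNReal.toReal_ofReal hq0.le, ← ENNReal.ofReal_rpow_of_nonneg (by positivity) (by positivity),
    ← h, ofReal_integral_eq_lintegral_ofReal hint]
  · gcongr with u
    rw [← ofReal_norm, ENNReal.ofReal_rpow_of_nonneg (norm_nonneg _) hq0.le]
    apply ENNReal.ofReal_le_ofReal
    unfold tailKernel
    by_cases hu : R < ‖u‖
    · rw [if_pos hu, Set.indicator_of_mem (show ‖u‖ ∈ Set.Ioi R from hu)]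
      have : -((n - β) * q) = (β - n) * q := by ring
      rw [this, Real.rpow_mul (norm_nonneg _)]
      exact Real.rpow_le_rpow (norm_nonneg _) (norm_kernel_le j u) hq0.le
    · rw [if_neg hu, norm_zero, Real.zero_rpow hq0.ne']
      exact Set.indicator_nonneg (fun r hr => Real.rpow_nonneg (hR.trans hr).le _) _
  · exact Eventually.of_forall fun u =>
      Set.indicator_nonneg (fun r hr => Real.rpow_nonneg (hR.trans hr).le _) _

theorem inv_rpow_self_le {β : ℝ} (hβ : 0 < β) : β⁻¹ ^ β ≤ Real.exp 1 := by
  rw [Real.rpow_def_of_pos (by positivity)]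
  gcongr
  have := Real.log_le_sub_one_of_pos (inv_pos.2 hβ)
  calc Real.log β⁻¹ * β ≤ (β⁻¹ - 1) * β := by gcongr
    _ = 1 - β := by field_simp
    _ ≤ 1 := by linarith

/-- With the splitting radius `1 / β` the tail of the kernel has the required `L^q` norm. -/
theorem eLpNorm_tailKernel_inv_le (hn : 1 ≤ n) (j : Fin n) {q β : ℝ} (hq : 1 < q) (hβ : 0 < β)
    (hD : 0 < n * (q - 1) - β * q) :
    eLpNorm (tailKernel j β β⁻¹) (ENNReal.ofReal q) volume ≤
      ENNReal.ofReal (Real.exp 1 *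
        (n * volume.real (Metric.ball (0 : EuclideanSpace ℝ (Fin n)) 1)) ^ (1 / q)) *
        ENNReal.ofReal (tailFactor n q β) := by
  have hq0 : 0 < q := by linarith
  have hV : 0 ≤ volume.real (Metric.ball (0 : EuclideanSpace ℝ (Fin n)) 1) := measureReal_nonneg
  refine (eLpNorm_tailKernel_le hn j hq hD (inv_pos.2 hβ)).trans ?_
  rw [← ENNReal.ofReal_mul (by positivity)]
  apply ENNReal.ofReal_le_ofReal
  set D := n * (q - 1) - β * q with hDd
  rw [Real.mul_rpow (by positivity) (by positivity), Real.div_rpow (by positivity) hD.le]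
  have e : (β⁻¹ ^ (-D)) ^ (1 / q) = β⁻¹ ^ β * β ^ ((n : ℝ) * (q - 1) / q) := by
    rw [Real.inv_rpow hβ.le, Real.inv_rpow hβ.le, ← Real.rpow_neg hβ.le, ← Real.rpow_neg hβ.le,
      ← Real.rpow_mul hβ.le, ← Real.rpow_add hβ]
    congr 1
    rw [hDd]; field_simp; ring
  rw [e, tailFactor]
  have := inv_rpow_self_le hβ
  calc _ = β⁻¹ ^ β * (((n : ℝ) * volume.real (Metric.ball (0 : EuclideanSpace ℝ (Fin n)) 1)) ^ (1 / q) *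
        (β ^ ((n : ℝ) * (q - 1) / q) / D ^ (1 / q))) := by ring
    _ ≤ Real.exp 1 * (((n : ℝ) * volume.real (Metric.ball (0 : EuclideanSpace ℝ (Fin n)) 1)) ^ (1 / q) *
        (β ^ ((n : ℝ) * (q - 1) / q) / D ^ (1 / q))) := by gcongr
    _ = _ := by ring

theorem T_eq_kernelConv (j : Fin n) {β : ℝ} (hβ : β ≠ 0) (f : EuclideanSpace ℝ (Fin n) → ℂ) :
    T j β f = kernelConv (kernel j β) f := by
  ext x
  rw [T, if_neg hβ, kernelConv, ← integral_sub_left_eq_self _ volume x]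
  simp only [sub_sub_cancel]

theorem ae_integrable_kernel_smul (hn : 1 ≤ n) (j : Fin n) {β : ℝ} (hβ : 0 < β) (hβn : β ≤ n)
    {f : EuclideanSpace ℝ (Fin n) → ℂ} (hf : Measurable f) (hfi : Integrable f) :
    ∀ᵐ x, Integrable fun u => kernel j β u • f (x - u) := by
  filter_upwards [ae_integrable_norm_rpow_mul hn hβ hβn hf hfi] with x hx
  refine hx.mono' (Measurable.aestronglyMeasurable (by fun_prop)) (Eventually.of_forall fun u => ?_)
  rw [norm_smul]
  exact mul_le_mul_of_nonneg_right (norm_kernel_le j u) (norm_nonneg _)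

theorem ae_converges_of_pos (hn : 1 ≤ n) (j : Fin n) {β : ℝ} (hβ : 0 < β) (hβn : β ≤ n)
    {f : EuclideanSpace ℝ (Fin n) → ℂ} (hf : Measurable f) (hfi : Integrable f) :
    ∀ᵐ x, Converges j β f x := by
  filter_upwards [ae_integrable_kernel_smul hn j hβ hβn hf hfi] with x hx
  rw [Converges, if_neg hβ.ne']
  simpa using hx.comp_sub_left x

/-- The bound for `β > 0`, by splitting the kernel at radius `1 / β`. This radius keeps the total
weight `β⁻¹ ^ β` of the local part bounded and gives the tail the factor `tailFactor`. -/
theorem exists_eLpNorm_T_le_of_pos (hn : 1 ≤ n) {q : ℝ} (hq : 1 < q) :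
    ∃ C : ℝ≥0, ∀ (j : Fin n) (f : EuclideanSpace ℝ (Fin n) → ℂ), Measurable f → Integrable f →
      ∀ β : ℝ, 0 < β → β < (n : ℝ) * (q - 1) / q →
        eLpNorm (T j β f) (ENNReal.ofReal q) volume ≤
          C * (eLpNorm f (ENNReal.ofReal q) volume +
            ENNReal.ofReal (tailFactor n q β) * eLpNorm f 1 volume) := by
  obtain ⟨C, hC⟩ := exists_eLpNorm_truncKernel_le n hq
  have hq0 : 0 < q := by linarith
  have hq1 : 1 ≤ ENNReal.ofReal q := by simpa using hq.le
  have hn0 : (0 : ℝ) < n := by exact_mod_cast hn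
  set C₂ : ℝ := Real.exp 1 *
        (n * volume.real (Metric.ball (0 : EuclideanSpace ℝ (Fin n)) 1)) ^ (1 / q) with hC₂
  refine ⟨Real.toNNReal (Real.exp 1) * (2 * C) + Real.toNNReal C₂, fun j f hf hfi β hβ hβq => ?_⟩
  have hD : 0 < n * (q - 1) - β * q := by
    rw [lt_div_iff₀ hq0] at hβq; linarith
  have hβn : β ≤ n := by
    refine hβq.le.trans ?_
    rw [div_le_iff₀ hq0]; nlinarith
  have hsplit : kernelConv (kernel j β) f =ᵐ[volume]
      kernelConv (localKernel j β β⁻¹) f + kernelConv (tailKernel j β β⁻¹) f := by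
    filter_upwards [ae_integrable_kernel_smul hn j hβ hβn hf hfi] with x hx
    have i1 : Integrable fun u => localKernel j β β⁻¹ u • f (x - u) := by
      refine hx.norm.mono' (Measurable.aestronglyMeasurable (by fun_prop))
        (Eventually.of_forall fun u => ?_)
      unfold localKernel
      split_ifs
      · exact le_rfl
      · rw [zero_smul, norm_zero]; exact norm_nonneg _
    have i2 : Integrable fun u => tailKernel j β β⁻¹ u • f (x - u) := by
      refine hx.norm.mono' (Measurable.aestronglyMeasurable (by fun_prop))
        (Eventually.of_forall fun u => ?_)
      unfold tailKernel
      split_ifs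
      · exact le_rfl
      · rw [zero_smul, norm_zero]; exact norm_nonneg _
    rw [Pi.add_apply, kernelConv, kernelConv, kernelConv, ← integral_add i1 i2]
    refine integral_congr_ae (Eventually.of_forall fun u => ?_)
    simp only [localKernel, tailKernel]
    rcases le_or_gt ‖u‖ β⁻¹ with h | h
    · simp [h, not_lt.2 h]
    · simp [h, not_le.2 h]
  rw [T_eq_kernelConv j hβ.ne', eLpNorm_congr_ae hsplit]
  refine (eLpNorm_add_le
    (stronglyMeasurable_kernelConv (measurable_localKernel j _ _) hf).aestronglyMeasurable
    (stronglyMeasurable_kernelConv (measurable_tailKernel j _ _) hf).aestronglyMeasurable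
    hq1).trans ?_
  have h1 := eLpNorm_kernelConv_localKernel_le hn hq hC j hβ hβn (inv_pos.2 hβ) hf hfi
  have h2 := (eLpNorm_kernelConv_le_mul_eLpNorm_one hq (measurable_tailKernel j β β⁻¹) hf).trans
    (mul_le_mul' (eLpNorm_tailKernel_inv_le hn j hq hβ hD) le_rfl)
  have h3 : ENNReal.ofReal (β⁻¹ ^ β) ≤ ENNReal.ofReal (Real.exp 1) :=
    ENNReal.ofReal_le_ofReal (inv_rpow_self_le hβ)
  rw [← hC₂] at h2
  set a := eLpNorm f (ENNReal.ofReal q) volume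
  set b := eLpNorm f 1 volume
  set t := ENNReal.ofReal (tailFactor n q β)
  push_cast
  change _ ≤ (ENNReal.ofReal (Real.exp 1) * (2 * C) + ENNReal.ofReal C₂) * (a + t * b)
  calc _ ≤ ENNReal.ofReal (Real.exp 1) * (2 * C) * a + ENNReal.ofReal C₂ * t * b := by
        gcongr
        exact h1.trans (by gcongr)
    _ ≤ (ENNReal.ofReal (Real.exp 1) * (2 * C) * a + ENNReal.ofReal C₂ * t * b) +
        (ENNReal.ofReal (Real.exp 1) * (2 * C) * (t * b) + ENNReal.ofReal C₂ * a) := le_self_add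
    _ = _ := by ring

end Tail

/-! ### Mollifying the truncated Riesz kernel -/

section Mollifier

variable {n : ℕ}

/-- The tent function `max(0, 1 - |w|/ε)`. -/
noncomputable def tent (ε : ℝ) (w : EuclideanSpace ℝ (Fin n)) : ℝ := max 0 (1 - ‖w‖ / ε)

theorem continuous_tent (ε : ℝ) : Continuous (tent (n := n) ε) := by
  unfold tent; fun_prop

theorem tent_nonneg (ε : ℝ) (w : EuclideanSpace ℝ (Fin n)) : 0 ≤ tent ε w := le_max_left _ _

theorem tent_le_one {ε : ℝ} (hε : 0 < ε) (w : EuclideanSpace ℝ (Fin n)) : tent ε w ≤ 1 := by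
  refine max_le zero_le_one ?_
  have : 0 ≤ ‖w‖ / ε := by positivity
  linarith

theorem tent_eq_zero {ε : ℝ} (hε : 0 < ε) {w : EuclideanSpace ℝ (Fin n)} (hw : ε ≤ ‖w‖) :
    tent ε w = 0 := by
  refine max_eq_left ?_
  have : 1 ≤ ‖w‖ / ε := (one_le_div hε).2 hw
  linarith

theorem abs_tent_sub_le {ε : ℝ} (hε : 0 < ε) (a b : EuclideanSpace ℝ (Fin n)) :
    |tent ε a - tent ε b| ≤ ‖a - b‖ / ε := by
  have h := abs_max_sub_max_le_abs (1 - ‖a‖ / ε) (1 - ‖b‖ / ε) 0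
  rw [max_comm _ 0, max_comm _ 0] at h
  refine h.trans ?_
  have : 1 - ‖a‖ / ε - (1 - ‖b‖ / ε) = (‖b‖ - ‖a‖) / ε := by ring
  rw [this, abs_div, abs_of_pos hε]
  gcongr
  rw [norm_sub_rev]
  exact abs_norm_sub_norm_le b a

theorem hasCompactSupport_tent {ε : ℝ} (hε : 0 < ε) :
    HasCompactSupport (tent (n := n) ε) := by
  refine HasCompactSupport.of_support_subset_isCompact (isCompact_closedBall 0 ε) fun w hw => ?_
  by_contra h
  exact hw (tent_eq_zero hε (by simpa using (not_le.1 (by simpa using h : ¬ ‖w‖ ≤ ε)).le))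

theorem integral_tent_one_pos : 0 < ∫ w : EuclideanSpace ℝ (Fin n), tent 1 w := by
  refine (continuous_tent 1).integral_pos_of_hasCompactSupport_nonneg_nonzero
    (hasCompactSupport_tent one_pos) (tent_nonneg 1) (x := 0) ?_
  simp [tent]

theorem integral_tent {ε : ℝ} (hε : 0 < ε) :
    ∫ w : EuclideanSpace ℝ (Fin n), tent ε w =
      ε ^ n * ∫ w : EuclideanSpace ℝ (Fin n), tent 1 w := by
  have h := Measure.integral_comp_inv_smul_of_nonneg
    (volume : Measure (EuclideanSpace ℝ (Fin n))) (tent 1) hε.le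
  rw [finrank_euclideanSpace, Fintype.card_fin, smul_eq_mul] at h
  rw [← h]
  congr 1
  ext w
  rw [tent, tent, norm_smul, norm_inv, Real.norm_of_nonneg hε.le, div_one, inv_mul_eq_div]

/-- The Lipschitz bump of mass one supported in the ball of radius `ε`. -/
noncomputable def mollifier (ε : ℝ) (w : EuclideanSpace ℝ (Fin n)) : ℝ :=
  (ε ^ n * ∫ w : EuclideanSpace ℝ (Fin n), tent 1 w)⁻¹ * tent ε w

theorem continuous_mollifier (ε : ℝ) : Continuous (mollifier (n := n) ε) :=
  continuous_const.mul (continuous_tent ε)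

@[fun_prop]
theorem measurable_mollifier (ε : ℝ) : Measurable (mollifier (n := n) ε) :=
  (continuous_mollifier ε).measurable

theorem mollifier_nonneg {ε : ℝ} (hε : 0 < ε) (w : EuclideanSpace ℝ (Fin n)) :
    0 ≤ mollifier ε w :=
  mul_nonneg (inv_nonneg.2 (mul_nonneg (pow_nonneg hε.le n) integral_tent_one_pos.le))
    (tent_nonneg ε w)

theorem mollifier_le {ε : ℝ} (hε : 0 < ε) (w : EuclideanSpace ℝ (Fin n)) :
    mollifier ε w ≤ (ε ^ n * ∫ w : EuclideanSpace ℝ (Fin n), tent 1 w)⁻¹ := by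
  have := integral_tent_one_pos (n := n)
  exact mul_le_of_le_one_right (by positivity) (tent_le_one hε w)

theorem mollifier_eq_zero {ε : ℝ} (hε : 0 < ε) {w : EuclideanSpace ℝ (Fin n)} (hw : ε ≤ ‖w‖) :
    mollifier ε w = 0 := by rw [mollifier, tent_eq_zero hε hw, mul_zero]

theorem integrable_mollifier {ε : ℝ} (hε : 0 < ε) : Integrable (mollifier (n := n) ε) :=
  ((continuous_tent ε).integrable_of_hasCompactSupport (hasCompactSupport_tent hε)).const_mul _

theorem integral_mollifier {ε : ℝ} (hε : 0 < ε) :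
    ∫ w : EuclideanSpace ℝ (Fin n), mollifier ε w = 1 := by
  have := integral_tent_one_pos (n := n)
  simp only [mollifier]
  rw [integral_const_mul, integral_tent hε]
  exact inv_mul_cancel₀ (by positivity)

theorem mollifier_neg (ε : ℝ) (w : EuclideanSpace ℝ (Fin n)) :
    mollifier ε (-w) = mollifier ε w := by
  simp [mollifier, tent]

theorem abs_mollifier_sub_le {ε : ℝ} (hε : 0 < ε) (a b : EuclideanSpace ℝ (Fin n)) :
    |mollifier ε a - mollifier ε b| ≤
      (ε ^ n * ∫ w : EuclideanSpace ℝ (Fin n), tent 1 w)⁻¹ * (‖a - b‖ / ε) := by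
  have := integral_tent_one_pos (n := n)
  rw [mollifier, mollifier, ← mul_sub, abs_mul, abs_of_nonneg (by positivity)]
  gcongr
  exact abs_tent_sub_le hε a b

theorem truncKernel_neg (j : Fin n) (ε : ℝ) (u : EuclideanSpace ℝ (Fin n)) :
    truncKernel j ε (-u) = -truncKernel j ε u := by
  unfold truncKernel
  rw [norm_neg]
  split_ifs <;> simp

/-- The integral of `|v|^(1-n)` over the ball of radius `r` is `O(r)`. -/
theorem integral_norm_mul_inv_norm_pow (hn : 1 ≤ n) {r : ℝ} (hr : 0 < r) :
    ∫ v : EuclideanSpace ℝ (Fin n), (Set.Iic r).indicator (fun s : ℝ => s * (s ^ n)⁻¹) ‖v‖ =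
      n * volume.real (Metric.ball (0 : EuclideanSpace ℝ (Fin n)) 1) * r := by
  have : Nonempty (Fin n) := ⟨⟨0, hn⟩⟩
  rw [integral_fun_norm_addHaar, finrank_euclideanSpace, Fintype.card_fin]
  have e : ∫ y in Set.Ioi (0 : ℝ), y ^ (n - 1) • (Set.Iic r).indicator
      (fun s : ℝ => s * (s ^ n)⁻¹) y = ∫ y in Set.Ioi (0 : ℝ), (Set.Iic r).indicator 1 y := by
    refine setIntegral_congr_fun measurableSet_Ioi fun y hy => ?_
    have hy0 : 0 < y := hy
    by_cases h : y ∈ Set.Iic r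
    · simp only [Set.indicator_of_mem h, smul_eq_mul, Pi.one_apply]
      have h2 : y ^ n = y ^ (n - 1) * y := by rw [← pow_succ, Nat.sub_add_cancel hn]
      rw [h2]; field_simp
    · simp only [Set.indicator_of_notMem h, smul_zero]
  rw [e, setIntegral_indicator measurableSet_Iic, Set.Ioi_inter_Iic]
  simp [hr.le, mul_assoc]

theorem integrable_norm_mul_inv_norm_pow (hn : 1 ≤ n) {r : ℝ} (hr : 0 < r) :
    Integrable fun v : EuclideanSpace ℝ (Fin n) =>
      (Set.Iic r).indicator (fun s : ℝ => s * (s ^ n)⁻¹) ‖v‖ := by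
  refine Integrable.of_integral_ne_zero ?_
  have hV : 0 < volume.real (Metric.ball (0 : EuclideanSpace ℝ (Fin n)) 1) :=
    ENNReal.toReal_pos (Metric.measure_ball_pos _ _ one_pos).ne' measure_ball_lt_top.ne
  rw [integral_norm_mul_inv_norm_pow hn hr]
  positivity

/-- The gradient estimate for the Riesz kernel. -/
theorem abs_riesz_sub_le (j : Fin n) {u w : EuclideanSpace ℝ (Fin n)} (hu : u ≠ 0)
    (hw : 2 * ‖w‖ ≤ ‖u‖) :
    |u j * (‖u‖ ^ (n + 1))⁻¹ - (u - w) j * (‖u - w‖ ^ (n + 1))⁻¹| ≤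
      (1 + (n + 1) * 3 ^ n) * (‖w‖ * (‖u‖ ^ (n + 1))⁻¹) := by
  set v := u - w with hv
  have ha : 0 < ‖u‖ := norm_pos_iff.2 hu
  have h1 : ‖u‖ - ‖w‖ ≤ ‖v‖ := norm_sub_norm_le u w
  have hb : 0 < ‖v‖ := by linarith
  have h3 : ‖u‖ ≤ 3 * ‖v‖ := by linarith
  have hd : |‖v‖ - ‖u‖| ≤ ‖w‖ := by
    have := abs_norm_sub_norm_le v u
    have e : v - u = -w := by rw [hv]; abel
    rwa [e, norm_neg] at this
  have hj : |u j - v j| ≤ ‖w‖ := by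
    have : u j - v j = w j := by rw [hv, PiLp.sub_apply]; ring
    rw [this]; exact abs_coord_le j w
  have hp := abs_pow_sub_pow_le ‖v‖ ‖u‖ (n + 1)
  rw [abs_norm, abs_norm, Nat.add_sub_cancel] at hp
  have hmax : max ‖v‖ ‖u‖ ≤ 3 * ‖v‖ := max_le (by linarith) h3
  have hp' : |‖v‖ ^ (n + 1) - ‖u‖ ^ (n + 1)| ≤ ‖w‖ * (n + 1) * (3 * ‖v‖) ^ n := by
    refine hp.trans ?_
    push_cast
    gcongr
  have e : u j * (‖u‖ ^ (n + 1))⁻¹ - v j * (‖v‖ ^ (n + 1))⁻¹ =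
      (u j - v j) * (‖u‖ ^ (n + 1))⁻¹ + v j * ((‖v‖ ^ (n + 1) - ‖u‖ ^ (n + 1)) *
        ((‖u‖ ^ (n + 1))⁻¹ * (‖v‖ ^ (n + 1))⁻¹)) := by
    field_simp; ring
  rw [e]
  have ha' : 0 ≤ (‖u‖ ^ (n + 1))⁻¹ := by positivity
  have hb' : 0 ≤ (‖v‖ ^ (n + 1))⁻¹ := by positivity
  calc _ ≤ |u j - v j| * (‖u‖ ^ (n + 1))⁻¹ + |v j| * (|‖v‖ ^ (n + 1) - ‖u‖ ^ (n + 1)| *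
        ((‖u‖ ^ (n + 1))⁻¹ * (‖v‖ ^ (n + 1))⁻¹)) := by
        refine (abs_add_le _ _).trans_eq ?_
        rw [abs_mul, abs_mul, abs_mul, abs_of_nonneg ha', abs_of_nonneg (mul_nonneg ha' hb')]
    _ ≤ ‖w‖ * (‖u‖ ^ (n + 1))⁻¹ + ‖v‖ * ((‖w‖ * (n + 1) * (3 * ‖v‖) ^ n) *
        ((‖u‖ ^ (n + 1))⁻¹ * (‖v‖ ^ (n + 1))⁻¹)) := by
        gcongr
        exact abs_coord_le j v
    _ = _ := by
        rw [mul_pow]; field_simp; ring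

/-- The truncated kernel mollified at scale `ε`. -/
noncomputable def mollifiedKernel (j : Fin n) (ε δ : ℝ) (u : EuclideanSpace ℝ (Fin n)) : ℝ :=
  ∫ w, mollifier ε w * truncKernel j δ (u - w)

theorem integrable_mollifier_mul_truncKernel (j : Fin n) {ε δ : ℝ} (hε : 0 < ε) (hδ : 0 < δ)
    (u : EuclideanSpace ℝ (Fin n)) :
    Integrable fun w => mollifier ε w * truncKernel j δ (u - w) :=
  (integrable_mollifier hε).mul_bdd (c := (δ ^ n)⁻¹) (Measurable.aestronglyMeasurable (by fun_prop))
    (Eventually.of_forall fun w => norm_truncKernel_le j hδ _)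

theorem mollifiedKernel_neg (j : Fin n) (ε δ : ℝ) (u : EuclideanSpace ℝ (Fin n)) :
    mollifiedKernel j ε δ (-u) = -mollifiedKernel j ε δ u := by
  rw [mollifiedKernel, mollifiedKernel, ← integral_neg, ← integral_neg_eq_self]
  congr 1
  ext w
  rw [mollifier_neg, ← mul_neg, ← truncKernel_neg]
  congr 2
  abel

/-- Near the origin the mollified kernel is `O(ε^(-n))` uniformly in `δ`: by oddness the mollifier
may be replaced by its increment, which compensates one power of the singularity. -/
theorem abs_mollifiedKernel_le_of_norm_le (hn : 1 ≤ n) (j : Fin n) {ε δ : ℝ} (hε : 0 < ε)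
    (hδ : 0 < δ) {u : EuclideanSpace ℝ (Fin n)} (hu : ‖u‖ ≤ 2 * ε) :
    |mollifiedKernel j ε δ u| ≤
      (3 * n * volume.real (Metric.ball (0 : EuclideanSpace ℝ (Fin n)) 1) *
        (∫ w : EuclideanSpace ℝ (Fin n), tent 1 w)⁻¹) * (ε ^ n)⁻¹ := by
  have hI := integral_tent_one_pos (n := n)
  set I := ∫ w : EuclideanSpace ℝ (Fin n), tent 1 w with hIdef
  set k : EuclideanSpace ℝ (Fin n) → ℝ := fun v => if ‖v‖ ≤ 3 * ε then truncKernel j δ v else 0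
    with hk
  have hkm : Measurable k :=
    Measurable.ite (measurableSet_le measurable_norm measurable_const) (by fun_prop)
      measurable_const
  have hkodd : ∫ v, k v = 0 := by
    have h1 : ∫ v, k v = -∫ v, k v := by
      conv_lhs => rw [← integral_neg_eq_self]
      rw [← integral_neg]
      congr 1
      ext v
      simp only [hk, norm_neg, truncKernel_neg]
      split_ifs <;> simp
    linarith
  have hki : Integrable k := by
    have : k = (Metric.closedBall 0 (3 * ε)).indicator (truncKernel j δ) := by
      ext v
      by_cases h : ‖v‖ ≤ 3 * ε
      · rw [Set.indicator_of_mem (by simpa using h)]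
        simp [hk, h]
      · rw [Set.indicator_of_notMem (by simpa using h)]
        simp [hk, h]
    rw [this, integrable_indicator_iff Metric.isClosed_closedBall.measurableSet]
    exact IntegrableOn.of_bound (isCompact_closedBall _ _).measure_lt_top
      (measurable_truncKernel j δ).aestronglyMeasurable (δ ^ n)⁻¹
      (Eventually.of_forall fun v => norm_truncKernel_le j hδ v)
  have e1 : mollifiedKernel j ε δ u = ∫ v, mollifier ε (u - v) * k v := by
    rw [mollifiedKernel, ← integral_sub_left_eq_self _ volume u]
    refine integral_congr_ae (Eventually.of_forall fun v => ?_)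
    simp only [sub_sub_cancel, hk]
    split_ifs with h
    · rfl
    · have : ε ≤ ‖u - v‖ := by
        have := norm_sub_norm_le v u
        rw [norm_sub_rev] at this
        push Not at h
        linarith
      rw [mollifier_eq_zero hε this, zero_mul, zero_mul]
  have i1 : Integrable fun v => mollifier ε (u - v) * k v := by
    refine hki.bdd_mul (c := (ε ^ n * I)⁻¹) (Measurable.aestronglyMeasurable (by fun_prop))
      (Eventually.of_forall fun v => ?_)
    rw [Real.norm_of_nonneg (mollifier_nonneg hε _)]
    exact mollifier_le hε _
  have e2 : mollifiedKernel j ε δ u = ∫ v, (mollifier ε (u - v) - mollifier ε u) * k v := by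
    simp only [sub_mul]
    rw [integral_sub i1 (hki.const_mul _), integral_const_mul, hkodd, mul_zero, sub_zero, e1]
  rw [e2]
  have hr : 0 < 3 * ε := by positivity
  have hdom := (integrable_norm_mul_inv_norm_pow hn hr).const_mul ((ε ^ n * I)⁻¹ / ε)
  refine (norm_integral_le_of_norm_le hdom (f := fun v => (mollifier ε (u - v) - mollifier ε u) * k v)
    (Eventually.of_forall fun v => ?_)).trans_eq ?_
  · rw [norm_mul, Real.norm_eq_abs]
    by_cases h : ‖v‖ ≤ 3 * ε
    · rw [Set.indicator_of_mem (show ‖v‖ ∈ Set.Iic (3 * ε) from h)]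
      have h1 := abs_mollifier_sub_le hε (u - v) u
      have h2 : ‖u - v - u‖ = ‖v‖ := by rw [← norm_neg]; congr 1; abel
      rw [h2] at h1
      have h3 : ‖k v‖ ≤ (‖v‖ ^ n)⁻¹ := by
        simp only [hk, if_pos h]; exact norm_truncKernel_le' j δ v
      calc _ ≤ ((ε ^ n * I)⁻¹ * (‖v‖ / ε)) * (‖v‖ ^ n)⁻¹ := by gcongr
        _ = _ := by ring
    · rw [Set.indicator_of_notMem (show ‖v‖ ∉ Set.Iic (3 * ε) from h)]
      simp [hk, h]
  · rw [integral_const_mul, integral_norm_mul_inv_norm_pow hn hr]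
    field_simp

/-- Truncation and mollification of the Riesz kernel differ by a kernel with a radially decreasing
integrable majorant, uniformly in the inner truncation `δ`. -/
theorem exists_abs_truncKernel_sub_mollifiedKernel_le (hn : 1 ≤ n) :
    ∃ C : ℝ, 0 ≤ C ∧ ∀ (j : Fin n) (ε δ : ℝ), 0 < δ → δ < ε → ∀ u : EuclideanSpace ℝ (Fin n),
      |truncKernel j ε u - mollifiedKernel j ε δ u| ≤ C * (ε * (max ‖u‖ ε ^ (n + 1))⁻¹) := by
  have hI := integral_tent_one_pos (n := n)
  set c₁ := 3 * n * volume.real (Metric.ball (0 : EuclideanSpace ℝ (Fin n)) 1) *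
        (∫ w : EuclideanSpace ℝ (Fin n), tent 1 w)⁻¹ with hc₁
  have hV : 0 ≤ volume.real (Metric.ball (0 : EuclideanSpace ℝ (Fin n)) 1) := measureReal_nonneg
  have hc₁0 : 0 ≤ c₁ := by positivity
  set c₂ : ℝ := 1 + (n + 1) * 3 ^ n with hc₂
  have hc₂0 : 0 ≤ c₂ := by positivity
  refine ⟨(1 + c₁) * 2 ^ (n + 1) + c₂, by positivity, fun j ε δ hδ hδε u => ?_⟩
  have hε : 0 < ε := hδ.trans hδε
  have hm : 0 < max ‖u‖ ε := lt_max_of_lt_right hε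
  have hP : 0 ≤ ε * (max ‖u‖ ε ^ (n + 1))⁻¹ := by positivity
  rcases le_or_gt ‖u‖ (2 * ε) with hu | hu
  · have h1 := abs_mollifiedKernel_le_of_norm_le hn j hε hδ hu
    have h2 := norm_truncKernel_le j hε u
    rw [Real.norm_eq_abs] at h2
    have h3 : (ε ^ n)⁻¹ ≤ 2 ^ (n + 1) * (ε * (max ‖u‖ ε ^ (n + 1))⁻¹) := by
      have : max ‖u‖ ε ≤ 2 * ε := max_le hu (by linarith)
      calc (ε ^ n)⁻¹ = 2 ^ (n + 1) * (ε * ((2 * ε) ^ (n + 1))⁻¹) := by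
            rw [mul_pow]; field_simp; ring
        _ ≤ _ := by gcongr
    have h4 : |truncKernel j ε u - mollifiedKernel j ε δ u| ≤ (1 + c₁) * (ε ^ n)⁻¹ := by
      have := abs_sub (truncKernel j ε u) (mollifiedKernel j ε δ u)
      linarith
    have h5 : (1 + c₁) * (ε ^ n)⁻¹ ≤ (1 + c₁) * (2 ^ (n + 1) * (ε * (max ‖u‖ ε ^ (n + 1))⁻¹)) := by
      gcongr
    have h6 : 0 ≤ c₂ * (ε * (max ‖u‖ ε ^ (n + 1))⁻¹) := by positivity
    linarith
  · have hu0 : u ≠ 0 := by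
      rw [← norm_pos_iff]; linarith
    have hmax : max ‖u‖ ε = ‖u‖ := max_eq_left (by linarith)
    have e : truncKernel j ε u - mollifiedKernel j ε δ u =
        ∫ w, mollifier ε w * (truncKernel j ε u - truncKernel j δ (u - w)) := by
      simp only [mul_sub]
      rw [integral_sub ((integrable_mollifier hε).mul_const _)
        (integrable_mollifier_mul_truncKernel j hε hδ u), integral_mul_const,
        integral_mollifier hε, one_mul, mollifiedKernel]
    have hdom : Integrable fun w : EuclideanSpace ℝ (Fin n) =>
        mollifier ε w * (c₂ * (ε * (‖u‖ ^ (n + 1))⁻¹)) := (integrable_mollifier hε).mul_const _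
    have h1 : |truncKernel j ε u - mollifiedKernel j ε δ u| ≤ c₂ * (ε * (‖u‖ ^ (n + 1))⁻¹) := by
      rw [e]
      refine (norm_integral_le_of_norm_le hdom
        (f := fun w => mollifier ε w * (truncKernel j ε u - truncKernel j δ (u - w)))
        (Eventually.of_forall fun w => ?_)).trans_eq ?_
      · rcases le_or_gt ε ‖w‖ with hw | hw
        · rw [mollifier_eq_zero hε hw, zero_mul, zero_mul, norm_zero]
        · rw [norm_mul, Real.norm_of_nonneg (mollifier_nonneg hε w), Real.norm_eq_abs]
          refine mul_le_mul_of_nonneg_left ?_ (mollifier_nonneg hε w)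
          have h2 : δ < ‖u - w‖ := by
            have := norm_sub_norm_le u w
            linarith
          rw [truncKernel, truncKernel, if_pos (by linarith), if_pos h2]
          refine (abs_riesz_sub_le j hu0 (by linarith)).trans ?_
          gcongr
      · rw [integral_mul_const, integral_mollifier hε, one_mul]
    rw [hmax] at hP ⊢
    have : 0 ≤ (1 + c₁) * 2 ^ (n + 1) * (ε * (‖u‖ ^ (n + 1))⁻¹) := by positivity
    linarith

end Mollifier

/-! ### Poisson averages at Lebesgue points -/

section LebesguePoints

variable {n : ℕ}

/-- The `L¹` oscillation of `f` about its value at `x` over the ball of radius `r`. -/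
noncomputable def oscillation (f : EuclideanSpace ℝ (Fin n) → ℂ) (x : EuclideanSpace ℝ (Fin n))
    (r : ℝ) : ℝ≥0∞ :=
  ∫⁻ u in Metric.closedBall (0 : EuclideanSpace ℝ (Fin n)) r, ‖f (x - u) - f x‖ₑ

/-- `x` is a Lebesgue point of `f`. -/
def IsLebesguePoint (f : EuclideanSpace ℝ (Fin n) → ℂ) (x : EuclideanSpace ℝ (Fin n)) : Prop :=
  Tendsto (fun r => oscillation f x r / ENNReal.ofReal (r ^ n)) (𝓝[>] 0) (𝓝 0)

theorem oscillation_eq (f : EuclideanSpace ℝ (Fin n) → ℂ) (x : EuclideanSpace ℝ (Fin n)) (r : ℝ) :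
    oscillation f x r = ∫⁻ y in Metric.closedBall x r, ‖f y - f x‖ₑ := by
  rw [oscillation, ← lintegral_indicator Metric.isClosed_closedBall.measurableSet,
    ← lintegral_indicator Metric.isClosed_closedBall.measurableSet,
    ← lintegral_sub_left_eq_self ((Metric.closedBall x r).indicator fun y => ‖f y - f x‖ₑ) x]
  refine lintegral_congr fun u => ?_
  have : u ∈ Metric.closedBall (0 : EuclideanSpace ℝ (Fin n)) r ↔ x - u ∈ Metric.closedBall x r := by
    rw [Metric.mem_closedBall, Metric.mem_closedBall, dist_eq_norm, dist_eq_norm, sub_zero]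
    have : x - u - x = -u := by abel
    rw [this, norm_neg]
  by_cases h : u ∈ Metric.closedBall (0 : EuclideanSpace ℝ (Fin n)) r
  · rw [Set.indicator_of_mem h, Set.indicator_of_mem (this.1 h)]
  · rw [Set.indicator_of_notMem h, Set.indicator_of_notMem (mt this.2 h)]

theorem ae_isLebesguePoint {f : EuclideanSpace ℝ (Fin n) → ℂ} (hf : LocallyIntegrable f) :
    ∀ᵐ x, IsLebesguePoint f x := by
  filter_upwards [(Besicovitch.vitaliFamily
    (volume : Measure (EuclideanSpace ℝ (Fin n)))).ae_tendsto_lintegral_enorm_sub_div hf] with x hx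
  have h := hx.comp (Besicovitch.tendsto_filterAt volume x)
  set V := volume (Metric.ball (0 : EuclideanSpace ℝ (Fin n)) 1) with hV
  have hV0 : V ≠ 0 := (Metric.measure_ball_pos _ _ one_pos).ne'
  have hVt : V ≠ ∞ := measure_ball_lt_top.ne
  have h2 := ENNReal.Tendsto.const_mul h (a := V) (Or.inr hVt)
  rw [mul_zero] at h2
  refine h2.congr' ?_
  filter_upwards [self_mem_nhdsWithin] with r hr
  have hr : 0 < r := hr
  simp only [Function.comp_apply]
  rw [← oscillation_eq, Measure.addHaar_closedBall _ _ hr.le, finrank_euclideanSpace,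
    Fintype.card_fin, ← hV, mul_comm (ENNReal.ofReal _) V, ← mul_div_assoc]
  exact ENNReal.mul_div_mul_left _ _ hV0 hVt

theorem oscillation_le (f : EuclideanSpace ℝ (Fin n) → ℂ)
    (x : EuclideanSpace ℝ (Fin n)) {r : ℝ} (hr : 0 ≤ r) :
    oscillation f x r ≤ (∫⁻ u, ‖f u‖ₑ) +
      ‖f x‖ₑ * (ENNReal.ofReal (r ^ n) * volume (Metric.ball (0 : EuclideanSpace ℝ (Fin n)) 1)) := by
  calc oscillation f x r ≤ ∫⁻ u in Metric.closedBall (0 : EuclideanSpace ℝ (Fin n)) r,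
        (‖f (x - u)‖ₑ + ‖f x‖ₑ) := lintegral_mono fun u => enorm_sub_le
    _ = (∫⁻ u in Metric.closedBall (0 : EuclideanSpace ℝ (Fin n)) r, ‖f (x - u)‖ₑ) +
        ∫⁻ u in Metric.closedBall (0 : EuclideanSpace ℝ (Fin n)) r, ‖f x‖ₑ :=
        lintegral_add_right _ measurable_const
    _ ≤ _ := by
        refine add_le_add ?_ (le_of_eq ?_)
        · refine (setLIntegral_le_lintegral _ _).trans_eq ?_
          exact lintegral_sub_left_eq_self (fun u => ‖f u‖ₑ) x
        · rw [setLIntegral_const, Measure.addHaar_closedBall _ _ hr, finrank_euclideanSpace,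
            Fintype.card_fin]

/-- Layer-cake representation of the Poisson-like kernel by indicators of balls. -/
theorem ofReal_inv_max_pow {ε : ℝ} (hε : 0 < ε) (a : ℝ) :
    ENNReal.ofReal ((max a ε ^ (n + 1))⁻¹) =
      ENNReal.ofReal (n + 1) * ∫⁻ t in Set.Ioi ε, (if a < t then ENNReal.ofReal ((t ^ (n + 2))⁻¹) else 0) := by
  have hm : 0 < max a ε := lt_max_of_lt_right hε
  have e : ∫⁻ t in Set.Ioi ε, (if a < t then ENNReal.ofReal ((t ^ (n + 2))⁻¹) else 0) =
      ∫⁻ t in Set.Ioi (max a ε), ENNReal.ofReal ((t ^ (n + 2))⁻¹) := by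
    rw [← lintegral_indicator measurableSet_Ioi, ← lintegral_indicator measurableSet_Ioi]
    refine lintegral_congr fun t => ?_
    by_cases h1 : ε < t <;> by_cases h2 : a < t <;> simp [h1, h2]
  rw [e, ← ofReal_integral_eq_lintegral_ofReal (integrableOn_inv_pow_Ioi n hm),
    ← ENNReal.ofReal_mul (by positivity), integral_inv_pow_Ioi n hm]
  · congr 1; field_simp
  · filter_upwards [ae_restrict_mem measurableSet_Ioi] with t ht
    have : 0 < t := hm.trans ht
    simp only [Pi.zero_apply]; positivity

/-- The integral of the oscillation against the Poisson-like kernel `ε / max(|u|, ε)^(n+1)`. -/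
noncomputable def oscPoisson (f : EuclideanSpace ℝ (Fin n) → ℂ) (x : EuclideanSpace ℝ (Fin n))
    (ε : ℝ) : ℝ≥0∞ :=
  ∫⁻ u, ENNReal.ofReal (ε * (max ‖u‖ ε ^ (n + 1))⁻¹) * ‖f (x - u) - f x‖ₑ

theorem lintegral_layer_le {c : ℝ → ℝ≥0∞} (hc : Measurable c)
    {F : EuclideanSpace ℝ (Fin n) → ℝ≥0∞} (hF : Measurable F) (ε : ℝ) :
    ∫⁻ u, (∫⁻ t in Set.Ioi ε, (if ‖u‖ < t then c t else 0)) * F u ≤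
      ∫⁻ t in Set.Ioi ε, c t * ∫⁻ u in Metric.closedBall (0 : EuclideanSpace ℝ (Fin n)) t, F u := by
  have hm : Measurable (fun p : EuclideanSpace ℝ (Fin n) × ℝ => if ‖p.1‖ < p.2 then c p.2 else 0) :=
    Measurable.ite (measurableSet_lt measurable_fst.norm measurable_snd) (hc.comp measurable_snd)
      measurable_const
  have hm1 : ∀ u : EuclideanSpace ℝ (Fin n), Measurable (fun t : ℝ => if ‖u‖ < t then c t else 0) :=
    fun u => Measurable.ite (measurableSet_lt measurable_const measurable_id) hc measurable_const
  calc _ = ∫⁻ u, ∫⁻ t in Set.Ioi ε, (if ‖u‖ < t then c t else 0) * F u :=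
        lintegral_congr fun u => (lintegral_mul_const _ (hm1 u)).symm
    _ = ∫⁻ t in Set.Ioi ε, ∫⁻ u, (if ‖u‖ < t then c t else 0) * F u := by
        apply lintegral_lintegral_swap
        refine Measurable.aemeasurable ?_
        simp only [Function.uncurry_def]
        exact hm.mul (hF.comp measurable_fst)
    _ ≤ _ := by
        refine lintegral_mono fun t => ?_
        rw [← lintegral_indicator Metric.isClosed_closedBall.measurableSet,
          ← lintegral_const_mul _ (hF.indicator Metric.isClosed_closedBall.measurableSet)]
        refine lintegral_mono fun u => ?_
        by_cases h : ‖u‖ < t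
        · rw [if_pos h, Set.indicator_of_mem (by simpa using h.le)]
        · rw [if_neg h, zero_mul]; exact zero_le

theorem oscPoisson_le {f : EuclideanSpace ℝ (Fin n) → ℂ} (hf : Measurable f)
    (x : EuclideanSpace ℝ (Fin n)) {ε : ℝ} (hε : 0 < ε) :
    oscPoisson f x ε ≤ ENNReal.ofReal (n + 1) * (ENNReal.ofReal ε *
      ∫⁻ t in Set.Ioi ε, ENNReal.ofReal ((t ^ (n + 2))⁻¹) * oscillation f x t) := by
  have hF : Measurable fun u => ‖f (x - u) - f x‖ₑ := by fun_prop
  have hc : Measurable fun t : ℝ => ENNReal.ofReal ((t ^ (n + 2))⁻¹) := by fun_prop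
  have h := lintegral_layer_le hc hF ε
  refine le_trans (le_of_eq ?_) (mul_le_mul' le_rfl (mul_le_mul' le_rfl h))
  rw [oscPoisson, ← lintegral_const_mul' _ _ ENNReal.ofReal_ne_top,
    ← lintegral_const_mul' _ _ ENNReal.ofReal_ne_top]
  refine lintegral_congr fun u => ?_
  rw [ENNReal.ofReal_mul hε.le, ofReal_inv_max_pow hε, ← mul_assoc, ← mul_assoc, ← mul_assoc,
    mul_comm (ENNReal.ofReal ε)]

theorem lintegral_inv_sq_Ioi {a : ℝ} (ha : 0 < a) :
    ∫⁻ t in Set.Ioi a, ENNReal.ofReal ((t ^ 2)⁻¹) = ENNReal.ofReal a⁻¹ := by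
  have h := integral_inv_pow_Ioi 0 ha
  have h2 := integrableOn_inv_pow_Ioi 0 ha
  simp only [zero_add, Nat.cast_zero, pow_one, div_one, one_mul] at h h2
  rw [← h, ofReal_integral_eq_lintegral_ofReal h2]
  exact Eventually.of_forall fun t => by simp only [Pi.zero_apply]; positivity

/-- At a Lebesgue point the Poisson averages of the oscillation vanish in the limit: balls of small
radius are controlled by the Lebesgue point condition, large ones by integrability of `f`. -/
theorem IsLebesguePoint.tendsto_oscPoisson {f : EuclideanSpace ℝ (Fin n) → ℂ} (hf : Measurable f)
    (hfi : Integrable f) {x : EuclideanSpace ℝ (Fin n)} (hx : IsLebesguePoint f x) :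
    Tendsto (oscPoisson f x) (𝓝[>] 0) (𝓝 0) := by
  have key : ∀ η : ℝ, 0 < η → ∀ᶠ ε in 𝓝[>] (0 : ℝ),
      oscPoisson f x ε ≤ ENNReal.ofReal (n + 1) * (ENNReal.ofReal η + ENNReal.ofReal η) := by
    intro η hη
    have hη' : 0 < ENNReal.ofReal η := by simpa using hη
    have h1 := (ENNReal.tendsto_nhds_zero.1 hx) _ hη'
    rw [eventually_nhdsWithin_iff, Metric.eventually_nhds_iff] at h1
    obtain ⟨r₁, hr₁, h1⟩ := h1
    set r₀ := r₁ / 2 with hr₀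
    have hr₀pos : 0 < r₀ := half_pos hr₁
    have hsmall : ∀ t, 0 < t → t ≤ r₀ → oscillation f x t ≤ ENNReal.ofReal (t ^ n) * ENNReal.ofReal η := by
      intro t ht htr
      have := h1 (y := t) (by rw [Real.dist_eq, sub_zero, abs_of_pos ht]; linarith) ht
      rw [ENNReal.div_le_iff (by simpa using pow_pos ht n) ENNReal.ofReal_ne_top] at this
      rwa [mul_comm] at this
    set V := volume (Metric.ball (0 : EuclideanSpace ℝ (Fin n)) 1) with hV
    have hVt : V ≠ ∞ := measure_ball_lt_top.ne
    set M : ℝ≥0∞ := (∫⁻ u, ‖f u‖ₑ) * ENNReal.ofReal (r₀ ^ n)⁻¹ + ‖f x‖ₑ * V with hM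
    have hMt : M ≠ ∞ := ENNReal.add_ne_top.2
      ⟨ENNReal.mul_ne_top hfi.2.ne ENNReal.ofReal_ne_top, ENNReal.mul_ne_top enorm_ne_top hVt⟩
    have hlarge : ∀ t, r₀ < t → oscillation f x t ≤ ENNReal.ofReal (t ^ n) * M := by
      intro t ht
      have ht0 : 0 < t := hr₀pos.trans ht
      refine (oscillation_le f x ht0.le).trans ?_
      rw [hM, mul_add]
      have : 1 ≤ ENNReal.ofReal (t ^ n) * ENNReal.ofReal (r₀ ^ n)⁻¹ := by
        rw [← ENNReal.ofReal_mul (by positivity), ENNReal.one_le_ofReal, ← div_eq_mul_inv,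
          one_le_div (by positivity)]
        gcongr
      refine add_le_add ?_ (le_of_eq (by ring))
      calc (∫⁻ u, ‖f u‖ₑ) = (∫⁻ u, ‖f u‖ₑ) * 1 := (mul_one _).symm
        _ ≤ (∫⁻ u, ‖f u‖ₑ) * (ENNReal.ofReal (t ^ n) * ENNReal.ofReal (r₀ ^ n)⁻¹) := by gcongr
        _ = _ := by ring
    have hall : ∀ t, 0 < t → ENNReal.ofReal ((t ^ (n + 2))⁻¹) * oscillation f x t ≤
        ENNReal.ofReal ((t ^ 2)⁻¹) * ENNReal.ofReal η +
          (Set.Ioi r₀).indicator (fun t => ENNReal.ofReal ((t ^ 2)⁻¹) * M) t := by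
      intro t ht
      have e : ENNReal.ofReal ((t ^ (n + 2))⁻¹) * ENNReal.ofReal (t ^ n) =
          ENNReal.ofReal ((t ^ 2)⁻¹) := by
        rw [← ENNReal.ofReal_mul (by positivity)]
        congr 1
        rw [pow_add]; field_simp
      rcases le_or_gt t r₀ with h | h
      · refine le_trans ?_ le_self_add
        rw [← e, mul_assoc]
        gcongr
        exact hsmall t ht h
      · rw [Set.indicator_of_mem (show t ∈ Set.Ioi r₀ from h)]
        refine le_trans ?_ le_add_self
        rw [← e, mul_assoc]
        gcongr
        exact hlarge t h
    have hbound : ∀ ε, 0 < ε → oscPoisson f x ε ≤ ENNReal.ofReal (n + 1) *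
        (ENNReal.ofReal η + ENNReal.ofReal ε * (ENNReal.ofReal r₀⁻¹ * M)) := by
      intro ε hε
      refine (oscPoisson_le hf x hε).trans ?_
      gcongr
      calc ENNReal.ofReal ε * ∫⁻ t in Set.Ioi ε, ENNReal.ofReal ((t ^ (n + 2))⁻¹) * oscillation f x t
          ≤ ENNReal.ofReal ε * ∫⁻ t in Set.Ioi ε, (ENNReal.ofReal ((t ^ 2)⁻¹) * ENNReal.ofReal η +
          (Set.Ioi r₀).indicator (fun t => ENNReal.ofReal ((t ^ 2)⁻¹) * M) t) := by
            refine mul_le_mul' le_rfl ?_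
            exact setLIntegral_mono' measurableSet_Ioi fun t ht => hall t (hε.trans ht)
        _ = ENNReal.ofReal ε * ((∫⁻ t in Set.Ioi ε, ENNReal.ofReal ((t ^ 2)⁻¹) * ENNReal.ofReal η) +
            ∫⁻ t in Set.Ioi ε, (Set.Ioi r₀).indicator (fun t => ENNReal.ofReal ((t ^ 2)⁻¹) * M) t) := by
            rw [lintegral_add_left (by fun_prop)]
        _ ≤ ENNReal.ofReal ε * ((∫⁻ t in Set.Ioi ε, ENNReal.ofReal ((t ^ 2)⁻¹) * ENNReal.ofReal η) +
            ∫⁻ t in Set.Ioi r₀, ENNReal.ofReal ((t ^ 2)⁻¹) * M) := by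
            refine mul_le_mul' le_rfl (add_le_add le_rfl ?_)
            rw [← lintegral_indicator (measurableSet_Ioi (a := r₀))]
            exact setLIntegral_le_lintegral _ _
        _ = ENNReal.ofReal ε * (ENNReal.ofReal ε⁻¹ * ENNReal.ofReal η + ENNReal.ofReal r₀⁻¹ * M) := by
            rw [lintegral_mul_const _ (by fun_prop), lintegral_mul_const _ (by fun_prop),
              lintegral_inv_sq_Ioi hε, lintegral_inv_sq_Ioi hr₀pos]
        _ = _ := by
            rw [mul_add, ← mul_assoc, ← ENNReal.ofReal_mul hε.le, mul_inv_cancel₀ hε.ne',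
              ENNReal.ofReal_one, one_mul]
    have hlim : Tendsto (fun ε : ℝ => ENNReal.ofReal ε * (ENNReal.ofReal r₀⁻¹ * M)) (𝓝[>] 0) (𝓝 0) := by
      have h2 : Tendsto (fun ε : ℝ => ENNReal.ofReal ε) (𝓝[>] 0) (𝓝 0) := by
        rw [← ENNReal.ofReal_zero]
        exact (ENNReal.tendsto_ofReal tendsto_id).mono_left nhdsWithin_le_nhds
      have h3 := ENNReal.Tendsto.mul_const h2 (b := ENNReal.ofReal r₀⁻¹ * M)
        (Or.inr (ENNReal.mul_ne_top ENNReal.ofReal_ne_top hMt))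
      rwa [zero_mul] at h3
    filter_upwards [(ENNReal.tendsto_nhds_zero.1 hlim) _ hη', self_mem_nhdsWithin] with ε h2 h3
    refine (hbound ε h3).trans ?_
    gcongr
  rw [ENNReal.tendsto_nhds_zero]
  intro e he
  rcases eq_or_ne e ∞ with rfl | het
  · exact Eventually.of_forall fun _ => le_top
  have he' : 0 < e.toReal := ENNReal.toReal_pos he.ne' het
  filter_upwards [key (e.toReal / (2 * (n + 1))) (by positivity)] with ε hε
  refine hε.trans_eq ?_
  rw [← ENNReal.ofReal_add (by positivity) (by positivity), ← ENNReal.ofReal_mul (by positivity)]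
  rw [show ((n : ℝ) + 1) * (e.toReal / (2 * (n + 1)) + e.toReal / (2 * (n + 1))) = e.toReal by
    field_simp; ring]
  exact ENNReal.ofReal_toReal het

end LebesguePoints

/-! ### Comparing truncations with mollifications -/

section PrincipalValue

variable {n : ℕ}

theorem kernelConv_sub_kernel {k l : EuclideanSpace ℝ (Fin n) → ℝ} {f : EuclideanSpace ℝ (Fin n) → ℂ}
    {x : EuclideanSpace ℝ (Fin n)} (h1 : Integrable fun u => k u • f (x - u))
    (h2 : Integrable fun u => l u • f (x - u)) :
    kernelConv (fun u => k u - l u) f x = kernelConv k f x - kernelConv l f x := by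
  simp only [kernelConv, sub_smul]
  exact integral_sub h1 h2

theorem norm_mollifiedKernel_le (j : Fin n) {ε δ : ℝ} (hε : 0 < ε) (hδ : 0 < δ)
    (u : EuclideanSpace ℝ (Fin n)) : ‖mollifiedKernel j ε δ u‖ ≤ (δ ^ n)⁻¹ := by
  refine (norm_integral_le_of_norm_le ((integrable_mollifier hε).mul_const ((δ ^ n)⁻¹))
    (f := fun w => mollifier ε w * truncKernel j δ (u - w))
    (Eventually.of_forall fun w => ?_)).trans_eq ?_
  · rw [norm_mul, Real.norm_of_nonneg (mollifier_nonneg hε w)]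
    exact mul_le_mul_of_nonneg_left (norm_truncKernel_le j hδ _) (mollifier_nonneg hε w)
  · rw [integral_mul_const, integral_mollifier hε, one_mul]

theorem measurable_mollifiedKernel (j : Fin n) (ε δ : ℝ) :
    Measurable (mollifiedKernel j ε δ) := by
  apply StronglyMeasurable.measurable
  apply StronglyMeasurable.integral_prod_right
  exact Measurable.stronglyMeasurable (by simp only [Function.uncurry_def]; fun_prop)

theorem integral_mollifier_smul_kernelConv (j : Fin n) {ε δ : ℝ} (hε : 0 < ε) (hδ : 0 < δ)
    {f : EuclideanSpace ℝ (Fin n) → ℂ} (hf : Measurable f) (hfi : Integrable f)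
    (x : EuclideanSpace ℝ (Fin n)) :
    ∫ w, mollifier ε w • kernelConv (truncKernel j δ) f (x - w) =
      kernelConv (mollifiedKernel j ε δ) f x := by
  have e1 : ∀ w, mollifier ε w • kernelConv (truncKernel j δ) f (x - w) =
      ∫ u, (mollifier ε w * truncKernel j δ (u - w)) • f (x - u) := by
    intro w
    rw [kernelConv, ← integral_smul, ← integral_sub_right_eq_self _ w]
    refine integral_congr_ae (Eventually.of_forall fun u => ?_)
    simp only [smul_smul]
    congr 2
    abel
  simp only [e1]
  simp only [kernelConv, mollifiedKernel]
  rw [integral_integral_swap]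
  · refine integral_congr_ae (Eventually.of_forall fun u => ?_)
    simp only
    rw [integral_smul_const]
  · have hi := (integrable_mollifier (n := n) hε).mul_prod (hfi.comp_sub_left x).norm
    refine (hi.mul_const ((δ ^ n)⁻¹)).mono' (Measurable.aestronglyMeasurable ?_)
      (Eventually.of_forall fun p => ?_)
    · simp only [Function.uncurry_def]; fun_prop
    · obtain ⟨w, u⟩ := p
      simp only [Function.uncurry_apply_pair]
      rw [norm_smul, norm_mul, Real.norm_of_nonneg (mollifier_nonneg hε w)]
      have h1 := norm_truncKernel_le j hδ (u - w)
      have h2 := mollifier_nonneg hε w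
      calc mollifier ε w * ‖truncKernel j δ (u - w)‖ * ‖f (x - u)‖
          ≤ mollifier ε w * (δ ^ n)⁻¹ * ‖f (x - u)‖ := by gcongr
        _ = _ := by ring

/-- An odd kernel sees only the differences `f (x - u) - f x`. -/
theorem kernelConv_eq_integral_smul_sub {k : EuclideanSpace ℝ (Fin n) → ℝ}
    (hodd : ∀ u, k (-u) = -k u) {f : EuclideanSpace ℝ (Fin n) → ℂ} {x : EuclideanSpace ℝ (Fin n)}
    (h1 : Integrable fun u => k u • f (x - u))
    (h2 : Integrable fun u => k u • (f (x - u) - f x)) :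
    kernelConv k f x = ∫ u, k u • (f (x - u) - f x) := by
  have h3 : Integrable fun u => k u • f x := by
    refine (h1.sub h2).congr (Eventually.of_forall fun u => ?_)
    simp only [Pi.sub_apply]
    rw [← smul_sub, sub_sub_cancel]
  have h0 : ∫ u, k u • f x = 0 := by
    have h1 : ∫ u, k u • f x = -∫ u, k u • f x := by
      conv_lhs => rw [← integral_neg_eq_self]
      rw [← integral_neg]
      simp only [hodd, neg_smul]
    exact self_eq_neg.1 h1
  simp only [smul_sub]
  rw [integral_sub h1 h3, h0, sub_zero, kernelConv]

/-- A bounded odd kernel with a Poisson-like majorant acts on `f` through the oscillation of `f`. -/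
theorem enorm_kernelConv_le_oscPoisson {k : EuclideanSpace ℝ (Fin n) → ℝ} (hk : Measurable k)
    {c : ℝ} (hc : ∀ u, ‖k u‖ ≤ c) (hodd : ∀ u, k (-u) = -k u) {C ε : ℝ} (hC : 0 ≤ C)
    (hCk : ∀ u, |k u| ≤ C * (ε * (max ‖u‖ ε ^ (n + 1))⁻¹))
    {f : EuclideanSpace ℝ (Fin n) → ℂ} (hf : Measurable f) (hfi : Integrable f)
    {x : EuclideanSpace ℝ (Fin n)} (hx : oscPoisson f x ε ≠ ∞) :
    ‖kernelConv k f x‖ₑ ≤ ENNReal.ofReal C * oscPoisson f x ε := by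
  have i1 := integrable_smul_comp_sub hk hc hfi x
  have hle : ∫⁻ u, ‖k u • (f (x - u) - f x)‖ₑ ≤ ENNReal.ofReal C * oscPoisson f x ε := by
    rw [oscPoisson, ← lintegral_const_mul' _ _ ENNReal.ofReal_ne_top]
    refine lintegral_mono fun u => ?_
    rw [enorm_smul, ← mul_assoc, ← ENNReal.ofReal_mul hC, ← ofReal_norm (k u)]
    gcongr
    exact hCk u
  have i2 : Integrable fun u => k u • (f (x - u) - f x) :=
    ⟨Measurable.aestronglyMeasurable (by fun_prop),
      hle.trans_lt (ENNReal.mul_lt_top ENNReal.ofReal_lt_top hx.lt_top)⟩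
  rw [kernelConv_eq_integral_smul_sub hodd i1 i2]
  exact (enorm_integral_le_lintegral_enorm _).trans hle

/-- The comparison behind Cotlar's inequality: truncating at `ε` and mollifying at scale `ε` a
truncation at a smaller radius `δ` have the same effect, up to Poisson averages of the oscillation
of `f`, uniformly in `δ`. -/
theorem exists_enorm_kernelConv_sub_le (hn : 1 ≤ n) :
    ∃ C : ℝ, 0 ≤ C ∧ ∀ (j : Fin n) (f : EuclideanSpace ℝ (Fin n) → ℂ), Measurable f → Integrable f →
      ∀ (x : EuclideanSpace ℝ (Fin n)) (ε δ : ℝ), 0 < δ → δ < ε → oscPoisson f x ε ≠ ∞ →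
      ‖kernelConv (truncKernel j ε) f x -
        ∫ w, mollifier ε w • kernelConv (truncKernel j δ) f (x - w)‖ₑ ≤
          ENNReal.ofReal C * oscPoisson f x ε := by
  obtain ⟨C, hC0, hC⟩ := exists_abs_truncKernel_sub_mollifiedKernel_le hn
  refine ⟨C, hC0, fun j f hf hfi x ε δ hδ hδε hx => ?_⟩
  have hε : 0 < ε := hδ.trans hδε
  have hmm := measurable_mollifiedKernel j ε δ
  rw [integral_mollifier_smul_kernelConv j hε hδ hf hfi]
  have e : kernelConv (truncKernel j ε) f x - kernelConv (mollifiedKernel j ε δ) f x =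
      kernelConv (fun u => truncKernel j ε u - mollifiedKernel j ε δ u) f x := by
    exact (kernelConv_sub_kernel (integrable_smul_comp_sub (measurable_truncKernel j ε)
      (norm_truncKernel_le j hε) hfi x) (integrable_smul_comp_sub hmm
      (norm_mollifiedKernel_le j hε hδ) hfi x)).symm
  rw [e]
  refine enorm_kernelConv_le_oscPoisson (by fun_prop) (c := (ε ^ n)⁻¹ + (δ ^ n)⁻¹) (fun u => ?_)
    (fun u => ?_) hC0 (hC j ε δ hδ hδε) hf hfi hx
  · exact (norm_sub_le _ _).trans (add_le_add (norm_truncKernel_le j hε u)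
      (norm_mollifiedKernel_le j hε hδ u))
  · rw [truncKernel_neg, mollifiedKernel_neg]; ring

theorem integrable_mollifier_smul {q : ℝ≥0∞} (hq : 1 ≤ q) {g : EuclideanSpace ℝ (Fin n) → ℂ}
    (hg : MemLp g q volume) {ε : ℝ} (hε : 0 < ε) (x : EuclideanSpace ℝ (Fin n)) :
    Integrable fun w => mollifier ε w • g (x - w) := by
  have h1 : MemLp (fun w => g (x - w)) q volume :=
    hg.comp_measurePreserving (Measure.measurePreserving_sub_left volume x)
  refine (h1.locallyIntegrable hq).integrable_smul_left_of_hasCompactSupport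
    (continuous_mollifier ε) ?_
  exact (hasCompactSupport_tent hε).mul_left

/-- Mollification is continuous from `L^q` to pointwise values. -/
theorem tendsto_integral_mollifier_smul {q : ℝ≥0∞} (hq : 1 ≤ q)
    {G : ℕ → EuclideanSpace ℝ (Fin n) → ℂ} {g : EuclideanSpace ℝ (Fin n) → ℂ}
    (hG : ∀ k, MemLp (G k) q volume) (hg : MemLp g q volume)
    (hlim : Tendsto (fun k => eLpNorm (G k - g) q volume) atTop (𝓝 0)) {ε : ℝ} (hε : 0 < ε)
    (x : EuclideanSpace ℝ (Fin n)) :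
    Tendsto (fun k => ∫ w, mollifier ε w • G k (x - w)) atTop
      (𝓝 (∫ w, mollifier ε w • g (x - w))) := by
  set B := Metric.closedBall (0 : EuclideanSpace ℝ (Fin n)) ε with hB
  set c := (ε ^ n * ∫ w : EuclideanSpace ℝ (Fin n), tent 1 w)⁻¹ with hc
  set b : ℝ≥0∞ := ENNReal.ofReal c * volume B ^ (1 / (1 : ℝ≥0∞).toReal - 1 / q.toReal) with hb
  have hbt : b ≠ ∞ := by
    refine ENNReal.mul_ne_top ENNReal.ofReal_ne_top (ENNReal.rpow_ne_top_of_nonneg ?_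
      measure_closedBall_lt_top.ne)
    rw [ENNReal.toReal_one, div_one, sub_nonneg]
    rcases eq_or_ne q ∞ with rfl | hqt
    · simp
    · have : 1 ≤ q.toReal := by
        have := ENNReal.toReal_mono hqt hq
        simpa using this
      rw [one_div]
      exact inv_le_one_of_one_le₀ this
  have hbound : ∀ k, edist (∫ w, mollifier ε w • G k (x - w)) (∫ w, mollifier ε w • g (x - w)) ≤
      b * eLpNorm (G k - g) q volume := by
    intro k
    have hd : MemLp (G k - g) q volume := (hG k).sub hg
    have hd2 : AEStronglyMeasurable (fun w => (G k - g) (x - w)) volume :=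
      hd.1.comp_measurePreserving (Measure.measurePreserving_sub_left volume x)
    rw [edist_eq_enorm_sub, ← integral_sub (integrable_mollifier_smul hq (hG k) hε x)
      (integrable_mollifier_smul hq hg hε x)]
    refine (enorm_integral_le_lintegral_enorm _).trans ?_
    calc ∫⁻ w, ‖mollifier ε w • G k (x - w) - mollifier ε w • g (x - w)‖ₑ
        ≤ ∫⁻ w, ENNReal.ofReal c * B.indicator (fun w => ‖(G k - g) (x - w)‖ₑ) w := by
          refine lintegral_mono fun w => ?_
          rw [← smul_sub, enorm_smul]
          by_cases hw : w ∈ B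
          · rw [Set.indicator_of_mem hw, ← ofReal_norm (mollifier ε w),
              Real.norm_of_nonneg (mollifier_nonneg hε w)]
            gcongr
            · exact mollifier_le hε w
            · exact le_rfl
          · have : ε < ‖w‖ := by simpa [hB] using hw
            rw [mollifier_eq_zero hε this.le, enorm_zero, zero_mul]
            exact zero_le
      _ = ENNReal.ofReal c * eLpNorm (fun w => (G k - g) (x - w)) 1 (volume.restrict B) := by
          rw [lintegral_const_mul' _ _ ENNReal.ofReal_ne_top,
            lintegral_indicator Metric.isClosed_closedBall.measurableSet, eLpNorm_one_eq_lintegral_enorm]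
      _ ≤ ENNReal.ofReal c * (eLpNorm (fun w => (G k - g) (x - w)) q (volume.restrict B) *
            (volume.restrict B) Set.univ ^ (1 / (1 : ℝ≥0∞).toReal - 1 / q.toReal)) := by
          gcongr
          exact eLpNorm_le_eLpNorm_mul_rpow_measure_univ hq hd2.restrict
      _ ≤ ENNReal.ofReal c * (eLpNorm (fun w => (G k - g) (x - w)) q volume *
            (volume.restrict B) Set.univ ^ (1 / (1 : ℝ≥0∞).toReal - 1 / q.toReal)) := by
          exact mul_le_mul_right (mul_le_mul_left (eLpNorm_mono_measure
            (fun w => (G k - g) (x - w)) Measure.restrict_le_self) _) _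
      _ = _ := by
          have : eLpNorm (fun w => (G k - g) (x - w)) q volume = eLpNorm (G k - g) q volume :=
            eLpNorm_comp_measurePreserving hd.1 (Measure.measurePreserving_sub_left volume x)
          rw [this, Measure.restrict_apply_univ, hb]
          ring
  rw [tendsto_iff_edist_tendsto_0]
  have h := ENNReal.Tendsto.const_mul hlim (a := b) (Or.inr hbt)
  rw [mul_zero] at h
  exact tendsto_of_tendsto_of_tendsto_of_le_of_le tendsto_const_nhds h (fun _ => zero_le) hbound

theorem IsLebesguePoint.tendsto_mollifier {q : ℝ≥0∞} (hq : 1 ≤ q)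
    {g : EuclideanSpace ℝ (Fin n) → ℂ} (hg : MemLp g q volume) {x : EuclideanSpace ℝ (Fin n)}
    (hx : IsLebesguePoint g x) :
    Tendsto (fun ε => ∫ w, mollifier ε w • g (x - w)) (𝓝[>] 0) (𝓝 (g x)) := by
  have hI := integral_tent_one_pos (n := n)
  set I := ∫ w : EuclideanSpace ℝ (Fin n), tent 1 w with hIdef
  rw [tendsto_iff_edist_tendsto_0]
  have h := ENNReal.Tendsto.const_mul hx (a := ENNReal.ofReal I⁻¹) (Or.inr ENNReal.ofReal_ne_top)
  rw [mul_zero] at h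
  refine tendsto_of_tendsto_of_tendsto_of_le_of_le' tendsto_const_nhds h
    (Eventually.of_forall fun _ => zero_le) ?_
  filter_upwards [self_mem_nhdsWithin] with ε hε
  have hε : 0 < ε := hε
  have e : g x = ∫ w : EuclideanSpace ℝ (Fin n), mollifier ε w • g x := by
    rw [integral_smul_const, integral_mollifier hε, one_smul]
  conv_lhs => rw [e]
  rw [edist_eq_enorm_sub, ← integral_sub (integrable_mollifier_smul hq hg hε x)
      ((integrable_mollifier hε).smul_const _)]
  refine (enorm_integral_le_lintegral_enorm _).trans ?_
  calc ∫⁻ w, ‖mollifier ε w • g (x - w) - mollifier ε w • g x‖ₑ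
      ≤ ∫⁻ w, ENNReal.ofReal (ε ^ n * I)⁻¹ *
        (Metric.closedBall (0 : EuclideanSpace ℝ (Fin n)) ε).indicator
          (fun w => ‖g (x - w) - g x‖ₑ) w := by
        refine lintegral_mono fun w => ?_
        rw [← smul_sub, enorm_smul]
        by_cases hw : w ∈ Metric.closedBall (0 : EuclideanSpace ℝ (Fin n)) ε
        · rw [Set.indicator_of_mem hw, ← ofReal_norm (mollifier ε w),
            Real.norm_of_nonneg (mollifier_nonneg hε w)]
          gcongr
          exact mollifier_le hε w
        · have : ε < ‖w‖ := by simpa using hw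
          rw [mollifier_eq_zero hε this.le, enorm_zero, zero_mul]
          exact zero_le
    _ = ENNReal.ofReal (ε ^ n * I)⁻¹ * oscillation g x ε := by
        rw [lintegral_const_mul' _ _ ENNReal.ofReal_ne_top,
          lintegral_indicator Metric.isClosed_closedBall.measurableSet, oscillation]
    _ = _ := by
        rw [mul_inv, mul_comm (ε ^ n)⁻¹, ENNReal.ofReal_mul (by positivity),
          ENNReal.ofReal_inv_of_pos (pow_pos hε n), div_eq_mul_inv]
        ring

end PrincipalValue

/-! ### Existence of the principal value -/

section Convergence

variable {n : ℕ}

theorem abs_truncKernel_sub_truncKernel_le (j : Fin n) {η δ δ' : ℝ} (hδ : δ ≤ η) (hδ' : δ' ≤ η)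
    (hδ0 : 0 < δ) (hδ0' : 0 < δ') (u : EuclideanSpace ℝ (Fin n)) :
    |truncKernel j δ u - truncKernel j δ' u| ≤
      (Set.Iic η).indicator (fun s => (s ^ n)⁻¹) ‖u‖ := by
  by_cases hu : ‖u‖ ≤ η
  · rw [Set.indicator_of_mem (show ‖u‖ ∈ Set.Iic η from hu)]
    have hpos : 0 ≤ (‖u‖ ^ n)⁻¹ := by positivity
    have h := norm_truncKernel_le' j 0 u
    simp only [truncKernel, Real.norm_eq_abs] at h ⊢
    by_cases h0 : u = 0
    · subst h0
      simp [hδ0.not_gt, hδ0'.not_gt]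
    · rw [if_pos (norm_pos_iff.2 h0)] at h
      split_ifs <;> simp only [sub_self, abs_zero, sub_zero, zero_sub, abs_neg] <;> assumption
  · have hu' : η < ‖u‖ := not_le.1 hu
    rw [Set.indicator_of_notMem (show ‖u‖ ∉ Set.Iic η from hu)]
    simp [truncKernel, hδ.trans_lt hu', hδ'.trans_lt hu']

theorem integrable_truncKernel_smul (j : Fin n) {ε : ℝ} (hε : 0 < ε)
    {f : EuclideanSpace ℝ (Fin n) → ℂ} (hf : Integrable f) (x : EuclideanSpace ℝ (Fin n)) :
    Integrable fun u => truncKernel j ε u • f (x - u) :=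
  integrable_smul_comp_sub (measurable_truncKernel j ε) (norm_truncKernel_le j hε) hf x

/-- On Lipschitz functions, the truncations converge uniformly: the oddness of the kernel
replaces `h (x - u)` by the difference `h (x - u) - h x`. -/
theorem norm_kernelConv_truncKernel_sub_le (hn : 1 ≤ n) (j : Fin n)
    {h : EuclideanSpace ℝ (Fin n) → ℂ} {K : ℝ≥0} (hK : LipschitzWith K h) (hi : Integrable h)
    {η δ δ' : ℝ} (hδ : δ ≤ η) (hδ' : δ' ≤ η) (hδ0 : 0 < δ) (hδ0' : 0 < δ')
    (x : EuclideanSpace ℝ (Fin n)) :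
    ‖kernelConv (truncKernel j δ) h x - kernelConv (truncKernel j δ') h x‖ ≤
      K * (n * volume.real (Metric.ball (0 : EuclideanSpace ℝ (Fin n)) 1) * η) := by
  have hη : 0 < η := hδ0.trans_le hδ
  have hm : Measurable h := hK.continuous.measurable
  have hb : ∀ u, ‖(truncKernel j δ u - truncKernel j δ' u) • (h (x - u) - h x)‖ ≤
      K * (Set.Iic η).indicator (fun s => s * (s ^ n)⁻¹) ‖u‖ := by
    intro u
    have h1 := abs_truncKernel_sub_truncKernel_le j hδ hδ' hδ0 hδ0' u
    have h2 : ‖h (x - u) - h x‖ ≤ K * ‖u‖ := by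
      have := hK.dist_le_mul (x - u) x
      rwa [dist_eq_norm, dist_eq_norm, sub_sub_cancel_left, norm_neg] at this
    rw [norm_smul, Real.norm_eq_abs]
    by_cases hu : ‖u‖ ∈ Set.Iic η
    · rw [Set.indicator_of_mem hu] at h1 ⊢
      calc _ ≤ (‖u‖ ^ n)⁻¹ * (K * ‖u‖) := by gcongr
        _ = _ := by ring
    · rw [Set.indicator_of_notMem hu] at h1 ⊢
      rw [le_antisymm h1 (abs_nonneg _), zero_mul, mul_zero]
  have hbi := (integrable_norm_mul_inv_norm_pow hn hη).const_mul (K : ℝ)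
  have i1 := integrable_truncKernel_smul j hδ0 hi x
  have i2 := integrable_truncKernel_smul j hδ0' hi x
  have mk := measurable_truncKernel j δ
  have mk' := measurable_truncKernel j δ'
  rw [← kernelConv_sub_kernel i1 i2, kernelConv_eq_integral_smul_sub
    (fun u => by rw [truncKernel_neg, truncKernel_neg]; ring)
    ((i1.sub i2).congr (Eventually.of_forall fun u => (sub_smul _ _ _).symm))
    (hbi.mono' (Measurable.aestronglyMeasurable (by fun_prop)) (Eventually.of_forall hb))]
  refine (norm_integral_le_of_norm_le hbi (Eventually.of_forall hb)).trans_eq ?_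
  rw [integral_const_mul, integral_norm_mul_inv_norm_pow hn hη]

theorem kernelConv_truncKernel_eq_of_le_norm (j : Fin n) {h : EuclideanSpace ℝ (Fin n) → ℂ} {N : ℝ}
    (hN : ∀ x, N ≤ ‖x‖ → h x = 0) {η δ δ' : ℝ} (hδ : δ ≤ η) (hδ' : δ' ≤ η)
    {x : EuclideanSpace ℝ (Fin n)} (hx : N + η < ‖x‖) :
    kernelConv (truncKernel j δ) h x = kernelConv (truncKernel j δ') h x := by
  refine integral_congr_ae (Eventually.of_forall fun u => ?_)
  simp only
  by_cases hu : ‖u‖ ≤ η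
  · rw [hN (x - u) (by linarith [norm_sub_norm_le x u]), smul_zero, smul_zero]
  · have hu' : η < ‖u‖ := not_le.1 hu
    simp [truncKernel, hδ.trans_lt hu', hδ'.trans_lt hu']

/-- The rate of convergence in `L^q` of the truncations of a Lipschitz function with bounded
support, as they agree outside a fixed ball. -/
theorem exists_eLpNorm_kernelConv_truncKernel_sub_le (hn : 1 ≤ n) (j : Fin n) (q : ℝ≥0∞)
    {h : EuclideanSpace ℝ (Fin n) → ℂ} {K : ℝ≥0} (hK : LipschitzWith K h)
    (hi : Integrable h) {N : ℝ} (hN : ∀ x, N ≤ ‖x‖ → h x = 0) :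
    ∃ M : ℝ≥0∞, M ≠ ∞ ∧ ∀ η δ δ' : ℝ, η ≤ 1 → δ ≤ η → δ' ≤ η → 0 < δ → 0 < δ' →
      eLpNorm (kernelConv (truncKernel j δ) h - kernelConv (truncKernel j δ') h) q volume ≤
        M * ENNReal.ofReal η := by
  set B := Metric.closedBall (0 : EuclideanSpace ℝ (Fin n)) (N + 1) with hB
  set c : ℝ := K * (n * volume.real (Metric.ball (0 : EuclideanSpace ℝ (Fin n)) 1)) with hc
  have hc0 : 0 ≤ c := by positivity
  refine ⟨ENNReal.ofReal c * volume B ^ (1 / q.toReal), ENNReal.mul_ne_top ENNReal.ofReal_ne_top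
    (ENNReal.rpow_ne_top_of_nonneg (by positivity) measure_closedBall_lt_top.ne), ?_⟩
  intro η δ δ' hη hδ hδ' hδ0 hδ0'
  have hη0 : 0 < η := hδ0.trans_le hδ
  calc _ ≤ eLpNorm (B.indicator fun _ => c * η) q volume := by
        refine eLpNorm_mono fun x => ?_
        rw [Pi.sub_apply]
        by_cases hx : x ∈ B
        · rw [Set.indicator_of_mem hx, Real.norm_of_nonneg (by positivity)]
          refine (norm_kernelConv_truncKernel_sub_le hn j hK hi hδ hδ' hδ0 hδ0' x).trans_eq ?_
          rw [hc]; ring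
        · have hx' : N + 1 < ‖x‖ := by simpa [hB] using hx
          rw [kernelConv_truncKernel_eq_of_le_norm j hN (hδ.trans hη) (hδ'.trans hη) hx', sub_self,
            norm_zero]
          exact norm_nonneg _
    _ ≤ ‖c * η‖ₑ * volume B ^ (1 / q.toReal) := eLpNorm_indicator_const_le _ _
    _ = _ := by
        rw [← ofReal_norm, Real.norm_of_nonneg (by positivity), ENNReal.ofReal_mul hc0]
        ring

theorem kernelConv_sub_fun {k : EuclideanSpace ℝ (Fin n) → ℝ} {f g : EuclideanSpace ℝ (Fin n) → ℂ}
    {x : EuclideanSpace ℝ (Fin n)} (h1 : Integrable fun u => k u • f (x - u))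
    (h2 : Integrable fun u => k u • g (x - u)) :
    kernelConv k (f - g) x = kernelConv k f x - kernelConv k g x := by
  simp only [kernelConv, Pi.sub_apply, smul_sub]
  exact integral_sub h1 h2

/-- The truncated transforms of `f` are Cauchy in `L^q`: by the uniform bounds it suffices to
know this on a dense class. -/
theorem exists_eLpNorm_kernelConv_truncKernel_sub_lt (hn : 1 ≤ n) {q : ℝ} (hq : 1 < q) (j : Fin n)
    {f : EuclideanSpace ℝ (Fin n) → ℂ} (hf : Measurable f) (hfi : Integrable f)
    (hfq : MemLp f (ENNReal.ofReal q) volume) {θ : ℝ≥0∞} (hθ : 0 < θ) :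
    ∃ η : ℝ, 0 < η ∧ ∀ δ δ' : ℝ, δ ≤ η → δ' ≤ η → 0 < δ → 0 < δ' →
      eLpNorm (kernelConv (truncKernel j δ) f - kernelConv (truncKernel j δ') f)
        (ENNReal.ofReal q) volume < θ := by
  obtain ⟨C, hC⟩ := exists_eLpNorm_truncKernel_le n hq
  have hq1 : 1 ≤ ENNReal.ofReal q := by simpa using hq.le
  have hsmall : ∀ M : ℝ≥0∞, M ≠ ∞ → ∃ r : ℝ, 0 < r ∧ r ≤ 1 ∧ M * ENNReal.ofReal r < θ / 2 := by
    intro M hM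
    have ht : Tendsto (fun r : ℝ => M * ENNReal.ofReal r) (𝓝[>] 0) (𝓝 0) := by
      have h1 : Tendsto (fun r : ℝ => ENNReal.ofReal r) (𝓝[>] 0) (𝓝 0) := by
        have := (ENNReal.continuous_ofReal.tendsto 0).mono_left
          (nhdsWithin_le_nhds (s := Set.Ioi (0 : ℝ)))
        rwa [ENNReal.ofReal_zero] at this
      have h2 := ENNReal.Tendsto.const_mul h1 (a := M) (Or.inr hM)
      rwa [mul_zero] at h2
    have hev := (ht.eventually_lt_const (ENNReal.half_pos hθ.ne')).and
      (Ioc_mem_nhdsGT (zero_lt_one' ℝ))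
    obtain ⟨r, h1, h2⟩ := hev.exists
    exact ⟨r, h2.1, h2.2, h1⟩
  obtain ⟨r, hr0, -, hr⟩ := hsmall (2 * C) (by finiteness)
  obtain ⟨h, hcs, hsm, hle⟩ := hfq.exist_eLpNorm_sub_le ENNReal.ofReal_ne_top hq1 hr0
  obtain ⟨K, hK⟩ := hsm.lipschitzWith_of_hasCompactSupport hcs (by simp)
  have hcont : Continuous h := hsm.continuous
  have hi : Integrable h := hcont.integrable_of_hasCompactSupport hcs
  obtain ⟨N, -, hN⟩ := hcs.exists_pos_le_norm
  obtain ⟨M, hM, hMle⟩ := exists_eLpNorm_kernelConv_truncKernel_sub_le hn j (ENNReal.ofReal q) hK hi hN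
  obtain ⟨η, hη0, hη1, hη⟩ := hsmall M hM
  refine ⟨η, hη0, fun δ δ' hδ hδ' hδ0 hδ0' => ?_⟩
  have hmeas : ∀ (ε : ℝ) {g : EuclideanSpace ℝ (Fin n) → ℂ}, Measurable g →
      AEStronglyMeasurable (kernelConv (truncKernel j ε) g) volume := fun ε g hg =>
    (stronglyMeasurable_kernelConv (measurable_truncKernel j ε) hg).aestronglyMeasurable
  have hd : Measurable (f - h) := hf.sub hcont.measurable
  have hdec : kernelConv (truncKernel j δ) f - kernelConv (truncKernel j δ') f =
      (kernelConv (truncKernel j δ) (f - h) - kernelConv (truncKernel j δ') (f - h)) +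
        (kernelConv (truncKernel j δ) h - kernelConv (truncKernel j δ') h) := by
    ext x
    simp only [Pi.add_apply, Pi.sub_apply]
    rw [kernelConv_sub_fun (integrable_truncKernel_smul j hδ0 hfi x)
      (integrable_truncKernel_smul j hδ0 hi x),
      kernelConv_sub_fun (integrable_truncKernel_smul j hδ0' hfi x)
      (integrable_truncKernel_smul j hδ0' hi x)]
    ring
  rw [hdec]
  refine (eLpNorm_add_le ((hmeas δ hd).sub (hmeas δ' hd))
    ((hmeas δ hcont.measurable).sub (hmeas δ' hcont.measurable)) hq1).trans_lt ?_
  rw [← ENNReal.add_halves θ]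
  refine ENNReal.add_lt_add (lt_of_le_of_lt ?_ hr) ((hMle η δ δ' hη1 hδ hδ' hδ0 hδ0').trans_lt hη)
  refine (eLpNorm_sub_le (hmeas δ hd) (hmeas δ' hd) hq1).trans ?_
  rw [two_mul, add_mul]
  exact add_le_add ((hC j _ hd (hfi.sub hi) δ hδ0).trans (by gcongr))
    ((hC j _ hd (hfi.sub hi) δ' hδ0').trans (by gcongr))

theorem exists_tendsto_eLpNorm_kernelConv_truncKernel_sub (hn : 1 ≤ n) {q : ℝ} (hq : 1 < q)
    (j : Fin n) {f : EuclideanSpace ℝ (Fin n) → ℂ} (hf : Measurable f) (hfi : Integrable f)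
    (hfq : MemLp f (ENNReal.ofReal q) volume) :
    ∃ g, MemLp g (ENNReal.ofReal q) volume ∧
      (∀ k : ℕ, MemLp (kernelConv (truncKernel j (1 / ((k : ℝ) + 1))) f) (ENNReal.ofReal q) volume) ∧
      Tendsto (fun k : ℕ => eLpNorm (kernelConv (truncKernel j (1 / ((k : ℝ) + 1))) f - g)
        (ENNReal.ofReal q) volume) atTop (𝓝 0) := by
  obtain ⟨C, hC⟩ := exists_eLpNorm_truncKernel_le n hq
  have hmem : ∀ k : ℕ,
      MemLp (kernelConv (truncKernel j (1 / ((k : ℝ) + 1))) f) (ENNReal.ofReal q) volume := fun k =>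
    ⟨(stronglyMeasurable_kernelConv (measurable_truncKernel j _) hf).aestronglyMeasurable,
      (hC j f hf hfi _ Nat.one_div_pos_of_nat).trans_lt
        (ENNReal.mul_lt_top ENNReal.coe_lt_top hfq.2)⟩
  have : Fact (1 ≤ ENNReal.ofReal q) := ⟨by simpa using hq.le⟩
  have hcau : CauchySeq fun k : ℕ => (hmem k).toLp _ := by
    rw [EMetric.cauchySeq_iff]
    intro θ hθ
    obtain ⟨η, hη0, hη⟩ := exists_eLpNorm_kernelConv_truncKernel_sub_lt hn hq j hf hfi hfq hθ
    obtain ⟨N, hN⟩ := exists_nat_one_div_lt hη0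
    have hle : ∀ k, N ≤ k → 1 / ((k : ℝ) + 1) ≤ η := fun k hk =>
      (Nat.one_div_le_one_div hk).trans hN.le
    refine ⟨N, fun k hk l hl => ?_⟩
    rw [Lp.edist_toLp_toLp]
    exact hη _ _ (hle k hk) (hle l hl) Nat.one_div_pos_of_nat Nat.one_div_pos_of_nat
  obtain ⟨g, hg⟩ := cauchySeq_tendsto_of_complete hcau
  refine ⟨g, Lp.memLp g, hmem, ?_⟩
  rw [← Lp.toLp_coeFn g (Lp.memLp g)] at hg
  exact (Lp.tendsto_Lp_iff_tendsto_eLpNorm'' _ hmem _ (Lp.memLp g)).1 hg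

/-- The truncated transforms converge at every common Lebesgue point of `f` and of their `L^q`
limit `g`, where they are compared with the mollifications of `g`. -/
theorem ae_tendsto_kernelConv_truncKernel (hn : 1 ≤ n) {q : ℝ} (hq : 1 < q) (j : Fin n)
    {f : EuclideanSpace ℝ (Fin n) → ℂ} (hf : Measurable f) (hfi : Integrable f)
    (hfq : MemLp f (ENNReal.ofReal q) volume) :
    ∃ g, MemLp g (ENNReal.ofReal q) volume ∧ ∀ᵐ x,
      Tendsto (fun ε => kernelConv (truncKernel j ε) f x) (𝓝[>] 0) (𝓝 (g x)) := by
  obtain ⟨g, hg, hmem, hlim⟩ :=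
    exists_tendsto_eLpNorm_kernelConv_truncKernel_sub hn hq j hf hfi hfq
  obtain ⟨C, -, hC⟩ := exists_enorm_kernelConv_sub_le hn
  have hq1 : 1 ≤ ENNReal.ofReal q := by simpa using hq.le
  refine ⟨g, hg, ?_⟩
  filter_upwards [ae_isLebesguePoint hfi.locallyIntegrable,
    ae_isLebesguePoint (hg.locallyIntegrable hq1)] with x hxf hxg
  have hosc := hxf.tendsto_oscPoisson hf hfi
  have hmol := hxg.tendsto_mollifier hq1 hg
  have hbound : ∀ᶠ ε in 𝓝[>] (0 : ℝ),
      ‖kernelConv (truncKernel j ε) f x - ∫ w, mollifier ε w • g (x - w)‖ₑ ≤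
        ENNReal.ofReal C * oscPoisson f x ε := by
    filter_upwards [self_mem_nhdsWithin, hosc.eventually_lt_const ENNReal.zero_lt_top] with ε hε ho
    have hε : 0 < ε := hε
    have ht := (tendsto_const_nhds (x := kernelConv (truncKernel j ε) f x)).sub
      (tendsto_integral_mollifier_smul hq1 hmem hg hlim hε x)
    refine le_of_tendsto ((continuous_enorm.tendsto _).comp ht) ?_
    filter_upwards [tendsto_one_div_add_atTop_nhds_zero_nat.eventually_lt_const hε] with k hk
    exact hC j f hf hfi x ε _ Nat.one_div_pos_of_nat hk ho.ne
  have hz : Tendsto (fun ε => kernelConv (truncKernel j ε) f x - ∫ w, mollifier ε w • g (x - w))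
      (𝓝[>] 0) (𝓝 0) := by
    rw [tendsto_zero_iff_enorm_tendsto_zero]
    have h := ENNReal.Tendsto.const_mul hosc (a := ENNReal.ofReal C) (Or.inr ENNReal.ofReal_ne_top)
    rw [mul_zero] at h
    exact tendsto_of_tendsto_of_tendsto_of_le_of_le' tendsto_const_nhds h
      (Eventually.of_forall fun _ => zero_le) hbound
  have := hz.add hmol
  simpa only [sub_add_cancel, zero_add] using this

theorem truncated_eq_kernelConv (j : Fin n) (ε : ℝ) (f : EuclideanSpace ℝ (Fin n) → ℂ)
    (x : EuclideanSpace ℝ (Fin n)) : truncated j 0 ε f x = kernelConv (truncKernel j ε) f x := by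
  have hs : MeasurableSet {y : EuclideanSpace ℝ (Fin n) | ε < ‖x - y‖} :=
    measurableSet_lt measurable_const (by fun_prop)
  rw [truncated, kernelConv, ← integral_indicator hs, ← integral_sub_left_eq_self _ volume x]
  refine integral_congr_ae (Eventually.of_forall fun u => ?_)
  have e : ((n : ℝ) + 1 - 0) = ((n + 1 : ℕ) : ℝ) := by push_cast; ring
  simp only [Set.indicator_apply, Set.mem_ofPred_eq, sub_sub_cancel, truncKernel, kernel, e,
    Real.rpow_natCast, div_eq_mul_inv, ite_smul, zero_smul]

/-- The principal value exists almost everywhere and inherits the uniform `L^q` bound of the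
truncations. -/
theorem exists_T_zero (hn : 1 ≤ n) {q : ℝ} (hq : 1 < q) :
    ∃ C : ℝ≥0, ∀ (j : Fin n) (f : EuclideanSpace ℝ (Fin n) → ℂ), Measurable f → Integrable f →
      MemLp f (ENNReal.ofReal q) volume →
      (∀ᵐ x, Converges j 0 f x) ∧ MemLp (T j 0 f) (ENNReal.ofReal q) volume ∧
      eLpNorm (T j 0 f) (ENNReal.ofReal q) volume ≤ C * eLpNorm f (ENNReal.ofReal q) volume := by
  obtain ⟨C, hC⟩ := exists_eLpNorm_truncKernel_le n hq
  refine ⟨C, fun j f hf hfi hfq => ?_⟩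
  obtain ⟨g, hg, hlim⟩ := ae_tendsto_kernelConv_truncKernel hn hq j hf hfi hfq
  have hT : T j 0 f =ᵐ[volume] g := by
    filter_upwards [hlim] with x hx
    simp only [T, if_true, truncated_eq_kernelConv]
    exact hx.limUnder_eq
  refine ⟨?_, (memLp_congr_ae hT).2 hg, ?_⟩
  · filter_upwards [hlim] with x hx
    simp only [Converges, if_true, truncated_eq_kernelConv]
    exact ⟨_, hx⟩
  · rw [eLpNorm_congr_ae hT]
    refine Lp.eLpNorm_le_of_ae_tendsto (u := 𝓝[>] (0 : ℝ)) ?_ (fun ε =>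
      (stronglyMeasurable_kernelConv (measurable_truncKernel j ε) hf).aestronglyMeasurable) hlim
    filter_upwards [self_mem_nhdsWithin] with ε hε
    exact hC j f hf hfi ε hε

end Convergence

/-! ### Uniformity in the order of the kernel -/

section Assembly

variable {n : ℕ}

theorem truncated_congr_ae (j : Fin n) (β ε : ℝ) {f g : EuclideanSpace ℝ (Fin n) → ℂ}
    (h : f =ᵐ[volume] g) : truncated j β ε f = truncated j β ε g := by
  ext x
  exact integral_congr_ae ((ae_restrict_of_ae h).mono fun y hy => by simp only [hy])

theorem converges_congr_ae (j : Fin n) (β : ℝ) {f g : EuclideanSpace ℝ (Fin n) → ℂ}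
    (h : f =ᵐ[volume] g) (x : EuclideanSpace ℝ (Fin n)) :
    Converges j β f x ↔ Converges j β g x := by
  simp only [Converges, truncated_congr_ae j 0 _ h]
  have e : (fun y => kernel j β (x - y) • f y) =ᵐ[volume] fun y => kernel j β (x - y) • g y :=
    h.mono fun y hy => by simp only [hy]
  rw [integrable_congr e]

theorem T_congr_ae (j : Fin n) (β : ℝ) {f g : EuclideanSpace ℝ (Fin n) → ℂ}
    (h : f =ᵐ[volume] g) : T j β f = T j β g := by
  ext x
  simp only [T, truncated_congr_ae j 0 _ h]
  have e : (fun y => kernel j β (x - y) • f y) =ᵐ[volume] fun y => kernel j β (x - y) • g y :=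
    h.mono fun y hy => by simp only [hy]
  rw [integral_congr_ae e]

theorem tailFactor_le_L {q β : ℝ} (hq : 1 < q) (hβ : 0 ≤ β) : tailFactor n q β ≤ L n q β := by
  have : 0 < q - 1 := sub_pos.2 hq
  exact le_add_of_nonneg_right (by positivity)

theorem tendsto_L (hn : 1 ≤ n) {q : ℝ} (hq : 1 < q) : Tendsto (L n q) (𝓝[>] 0) (𝓝 0) := by
  have hn' : (0 : ℝ) < n := by exact_mod_cast hn
  have hq1 : 0 < q - 1 := sub_pos.2 hq
  have hq0 : 0 < q := by linarith
  have hexp : 0 < (n : ℝ) * (q - 1) / q := by positivity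
  have hc : ContinuousAt (L n q) 0 := by
    unfold L tailFactor
    refine ContinuousAt.add (ContinuousAt.div ?_ ?_ ?_) (by fun_prop)
    · exact Real.continuousAt_rpow_const _ _ (Or.inr hexp.le)
    · refine ContinuousAt.rpow_const (by fun_prop) (Or.inr (by positivity))
    · rw [zero_mul, sub_zero]
      exact (Real.rpow_pos_of_pos (by positivity) _).ne'
  have h0 : L n q 0 = 0 := by
    simp [L, tailFactor, Real.zero_rpow hexp.ne']
  have := hc.tendsto.mono_left (nhdsWithin_le_nhds (s := Set.Ioi (0 : ℝ)))
  rwa [h0] at this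

/-- All values of `β` at once. The estimate holds without an `L^p` norm on the right: the local part
of the kernel maps `L^q` to itself with a constant independent of `β`. -/
theorem exists_eLpNorm_T_le (hn : 1 ≤ n) {q : ℝ} (hq : 1 < q) :
    ∃ C : ℝ, 0 < C ∧ ∀ (j : Fin n) (f : EuclideanSpace ℝ (Fin n) → ℂ),
      MemLp f 1 volume → MemLp f (ENNReal.ofReal q) volume →
      (∀ β : ℝ, 0 ≤ β → β < (n : ℝ) * (q - 1) / q →
        (∀ᵐ x, Converges j β f x) ∧ MemLp (T j β f) (ENNReal.ofReal q) volume ∧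
        eLpNorm (T j β f) (ENNReal.ofReal q) volume ≤ ENNReal.ofReal C *
          (eLpNorm f (ENNReal.ofReal q) volume +
            ENNReal.ofReal (tailFactor n q β) * eLpNorm f 1 volume)) ∧
      eLpNorm (T j 0 f) (ENNReal.ofReal q) volume ≤
        ENNReal.ofReal C * eLpNorm f (ENNReal.ofReal q) volume := by
  obtain ⟨C₀, hC₀⟩ := exists_T_zero hn hq
  obtain ⟨C₁, hC₁⟩ := exists_eLpNorm_T_le_of_pos hn hq
  have h0 : (C₀ : ℝ≥0∞) ≤ ENNReal.ofReal (C₀ + C₁ + 1) := by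
    rw [← ENNReal.ofReal_coe_nnreal]
    exact ENNReal.ofReal_le_ofReal (by linarith [C₁.2])
  have h1 : (C₁ : ℝ≥0∞) ≤ ENNReal.ofReal (C₀ + C₁ + 1) := by
    rw [← ENNReal.ofReal_coe_nnreal]
    exact ENNReal.ofReal_le_ofReal (by linarith [C₀.2])
  refine ⟨C₀ + C₁ + 1, by positivity, fun j f hf1 hfq => ?_⟩
  have hae := hf1.1.ae_eq_mk
  set f' := hf1.1.mk f with hf'
  have hm : Measurable f' := hf1.1.stronglyMeasurable_mk.measurable
  have hi : Integrable f' := memLp_one_iff_integrable.1 ((memLp_congr_ae hae).1 hf1)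
  have hq' : MemLp f' (ENNReal.ofReal q) volume := (memLp_congr_ae hae).1 hfq
  simp only [converges_congr_ae j _ hae, T_congr_ae j _ hae, eLpNorm_congr_ae hae]
  obtain ⟨c0, m0, b0⟩ := hC₀ j f' hm hi hq'
  have b0' : eLpNorm (T j 0 f') (ENNReal.ofReal q) volume ≤
      ENNReal.ofReal (C₀ + C₁ + 1) * eLpNorm f' (ENNReal.ofReal q) volume :=
    b0.trans (by gcongr)
  refine ⟨fun β hβ hβn => ?_, b0'⟩
  rcases hβ.eq_or_lt with rfl | hβ
  · exact ⟨c0, m0, b0'.trans (by gcongr; exact le_self_add)⟩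
  · have hb := hC₁ j f' hm hi β hβ hβn
    have hβn' : β ≤ n := by
      refine hβn.le.trans ?_
      rw [div_le_iff₀ (by linarith)]
      have : (0 : ℝ) ≤ n := n.cast_nonneg
      nlinarith
    refine ⟨ae_converges_of_pos hn j hβ hβn' hm hi, ⟨?_, hb.trans_lt ?_⟩,
      hb.trans (by gcongr)⟩
    · have : T j β f' = kernelConv (kernel j β) f' := by
        ext x; rw [T_eq_kernelConv j hβ.ne']
      rw [this]
      exact (stronglyMeasurable_kernelConv (measurable_kernel j β) hm).aestronglyMeasurable
    · refine ENNReal.mul_lt_top ENNReal.coe_lt_top (ENNReal.add_lt_top.2 ⟨hq'.2,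
        ENNReal.mul_lt_top ENNReal.ofReal_lt_top ?_⟩)
      exact ((memLp_congr_ae hae).1 hf1).2

end Assembly

end RieszExt

theorem theorem1p1 (n : ℕ) (hn : 1 ≤ n) (q : ℝ) (hq : 1 < q) :
    (∃ C : ℝ, 0 < C ∧
      ∀ (j : Fin n) (f : EuclideanSpace ℝ (Fin n) → ℂ),
        MemLp f 1 volume → MemLp f (ENNReal.ofReal q) volume →
        -- the bounds, uniformly in `β`
        (∀ β : ℝ, 0 ≤ β → β < (n : ℝ) * (q - 1) / q →
          (∀ᵐ x ∂(volume : Measure (EuclideanSpace ℝ (Fin n))), RieszExt.Converges j β f x) ∧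
          MemLp (RieszExt.T j β f) (ENNReal.ofReal q) volume ∧
          (∀ p : ℝ, 1 < p → p ≤ q → 1 / q = 1 / p - β / n →
            eLpNorm (RieszExt.T j β f) (ENNReal.ofReal q) volume ≤
              ENNReal.ofReal C *
                (eLpNorm f (ENNReal.ofReal q) volume + eLpNorm f (ENNReal.ofReal p) volume +
                  ENNReal.ofReal (RieszExt.tailFactor n q β) * eLpNorm f 1 volume)) ∧
          eLpNorm (RieszExt.T j β f) (ENNReal.ofReal q) volume ≤
            ENNReal.ofReal C *
              (eLpNorm f (ENNReal.ofReal q) volume +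
                ENNReal.ofReal (RieszExt.L n q β) * eLpNorm f 1 volume)) ∧
        -- the strong (q,q) bound for the (unnormalized) Riesz transform
        eLpNorm (RieszExt.T j 0 f) (ENNReal.ofReal q) volume ≤
          ENNReal.ofReal C * eLpNorm f (ENNReal.ofReal q) volume) ∧
    Tendsto (RieszExt.L n q) (𝓝[>] 0) (𝓝 0) := by
  refine ⟨?_, RieszExt.tendsto_L hn hq⟩
  obtain ⟨C, hC, h⟩ := RieszExt.exists_eLpNorm_T_le hn hq
  refine ⟨C, hC, fun j f hf1 hfq => ⟨fun β hβ hβn => ?_, (h j f hf1 hfq).2⟩⟩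
  obtain ⟨hconv, hmem, hle⟩ := (h j f hf1 hfq).1 β hβ hβn
  refine ⟨hconv, hmem, fun p _ _ _ => hle.trans ?_, hle.trans ?_⟩
  · gcongr
    exact le_self_add
  · gcongr
    exact RieszExt.tailFactor_le_L hq hβ
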